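/- Let $n\ge 1$, $0\le\theta_0<1$, $a_1,C_0,\delta>0$, and let $a\in\mathcal C^{n+1}(\mathbb{R}^n\setminus\{0\})$ be real-valued with $a(\xi)>0$ for all $\xi\ne0$. Assume that, for all $0<|\xi|\le\delta$ and all multi-indices $|\gamma|\le n+1$, $$a(\xi)\ge a_1|\xi|^{\theta_0},\qquad |\partial_\xi^\gamma a(\xi)|\le C_0|\xi|^{\theta_0-|\gamma|},$$ and that $\delta$ is so small that $a(\xi)\ge 4|\xi|$ for $0<|\xi|\le\delta$ (possible since $\theta_0<1$; overdamping regime). For $\xi\neq 0$ let $\hat K(\cdot,\xi)$ be the solution of $$\hat K_{tt}+a(\xi)\hat K_t+|\xi|^2\hat K=0,\qquad \hat K(0,\xi)=0,\quad \hat K_t(0,\xi)=1,$$ let $\chi\in\mathcal C_c^\infty(\mathbb{R}^n)$ be real-valued with $\chi(\xi)=1$ for $|\xi|\le1$ and $\chi(\xi)=0$ for $|\xi|\ge2$, put $\varphi_0(\xi)=\chi(2\xi/\delta)$, and let $$K_0(t,x)=(2\pi)^{-n}\int_{\mathbb{R}^n}e^{ix\cdot\xi}\,\hat K(t,\xi)\,\varphi_0(\xi)\,d\xi$$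 be the fundamental solution localized at low frequencies. For $1\le p\le q\le\infty$ let $$\|T\|_{L_p^q}=\sup\{\|T*f\|_{L^q}: f\in\mathcal S(\mathbb{R}^n),\ \|f\|_{L^p}=1\},$$ and write $1/\infty=0$. Suppose $\theta_0\in(0,1)$. If neither [$p=1$ and $n(1-1/q)=\theta_0$] nor [$q=\infty$ and $n/p=\theta_0$] holds, then there is a constant $C>0$, independent of $t$, such that for all $t\ge0$ $$\|K_0(t,\cdot)\|_{L_p^q}\le\begin{cases} C\,(1+t)^{-\frac1{2-\theta_0}\left(n\left(\frac1p-\frac1q\right)-\theta_0\right)} & \text{if } n(1/p-1/q)\ge\theta_0,\\[2pt] C\,(1+t)^{1-\frac n{\theta_0}\left(\frac1p-\frac1q\right)} & \text{if } n(1/p-1/q)<\theta_0.\end{cases}$$ If $p=1$ and $n(1-1/q)=\theta_0$, or if $q=\infty$ and $n/p=\theta_0$, then there is a constant $C>0$, independent of $t$, such that $\|K_0(t,\cdot)\|_{L_p^q}\le C\log(e+t)$ for all $t\ge0$. Suppose $\theta_0=0$. Unless $p=q=1$ or $p=q=\infty$, there is a constant $C>0$, independent of $t$, such that $\|K_0(t,\cdot)\|_{L_p^q}\le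 C(1+t)^{-\frac n2\left(\frac1p-\frac1q\right)}$ for all $t\ge0$. -/

import Mathlib

open MeasureTheory
open scoped SchwartzMap ENNReal RealInnerProductSpace

noncomputable section

/-- Standing assumptions on the symbol `a` of the dissipation: `a` is of class `C^{n+1}` and positive
off the origin and satisfies the Mikhlin-type condition of order `θ₀` at low frequencies
`0 < |ξ| ≤ δ`. The norm of the `k`-th iterated derivative controls, and is controlled by, the maximum
of the partial derivatives `|∂^γ a(ξ)|` with `|γ| = k`, up to a factor depending only on `n` and `k`.
The last field says that `δ` is so small that `|ξ| ≤ δ` lies in the overdamping region. -/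
structure IsOverdampedSymbol (n : ℕ) (a : EuclideanSpace ℝ (Fin n) → ℝ)
    (θ₀ a₁ C₀ δ : ℝ) : Prop where
  contDiffOn : ContDiffOn ℝ ((n + 1 : ℕ) : WithTop ℕ∞) a {0}ᶜ
  pos : ∀ ξ, ξ ≠ 0 → 0 < a ξ
  a₁_pos : 0 < a₁
  C₀_pos : 0 < C₀
  δ_pos : 0 < δ
  lower : ∀ ξ, ξ ≠ 0 → ‖ξ‖ ≤ δ → a₁ * ‖ξ‖ ^ θ₀ ≤ a ξ
  upper : ∀ ξ, ξ ≠ 0 → ‖ξ‖ ≤ δ → ∀ k : ℕ, k ≤ n + 1 →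
    ‖iteratedFDeriv ℝ k a ξ‖ ≤ C₀ * ‖ξ‖ ^ (θ₀ - k)
  overdamped : ∀ ξ, ξ ≠ 0 → ‖ξ‖ ≤ δ → 4 * ‖ξ‖ ≤ a ξ

/-- Smooth cut-off functions equal to `1` for `|ξ| ≤ 1` and to `0` for `|ξ| ≥ 2`. -/
structure IsCutoff {n : ℕ} (χ : EuclideanSpace ℝ (Fin n) → ℝ) : Prop where
  contDiff : ContDiff ℝ ((⊤ : ℕ∞) : WithTop ℕ∞) χ
  eq_one : ∀ ξ, ‖ξ‖ ≤ 1 → χ ξ = 1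
  eq_zero : ∀ ξ, 2 ≤ ‖ξ‖ → χ ξ = 0

/-- The solution of `y'' + α y' + r² y = 0`, `y(0) = 0`, `y'(0) = 1`. -/
def dampedOscillator (α r t : ℝ) : ℝ :=
  if 2 * r < α then
    (Real.exp ((-α + √(α ^ 2 - 4 * r ^ 2)) / 2 * t)
        - Real.exp ((-α - √(α ^ 2 - 4 * r ^ 2)) / 2 * t)) / √(α ^ 2 - 4 * r ^ 2)
  else if α = 2 * r then
    t * Real.exp (-(α / 2) * t)
  else
    Real.exp (-(α / 2) * t) * (Real.sin (√(r ^ 2 - α ^ 2 / 4) * t) / √(r ^ 2 - α ^ 2 / 4))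

theorem dampedOscillator_spec (α r : ℝ) (hα : 0 < α) (hr : 0 ≤ r) :
    dampedOscillator α r 0 = 0 ∧ deriv (dampedOscillator α r) 0 = 1 ∧
      ∀ t, ∃ y₂ : ℝ, HasDerivAt (dampedOscillator α r) (deriv (dampedOscillator α r) t) t ∧
        HasDerivAt (deriv (dampedOscillator α r)) y₂ t ∧
        y₂ + α * deriv (dampedOscillator α r) t + r ^ 2 * dampedOscillator α r t = 0 := by
  suffices h : ∃ v w : ℝ → ℝ, dampedOscillator α r 0 = 0 ∧ v 0 = 1 ∧
      ∀ t, HasDerivAt (dampedOscillator α r) (v t) t ∧ HasDerivAt v (w t) t ∧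
        w t + α * v t + r ^ 2 * dampedOscillator α r t = 0 by
    obtain ⟨v, w, h0, h1, h⟩ := h
    have hv : deriv (dampedOscillator α r) = v := funext fun t => (h t).1.deriv
    rw [hv]
    exact ⟨h0, h1, fun t => ⟨w t, h t⟩⟩
  have hexp : ∀ c t : ℝ, HasDerivAt (fun t : ℝ => Real.exp (c * t)) (c * Real.exp (c * t)) t := by
    intro c t
    simpa [mul_comm] using ((hasDerivAt_id t).const_mul c).exp
  rcases lt_trichotomy (2 * r) α with h | h | h
  · have hd : 0 < α ^ 2 - 4 * r ^ 2 := by nlinarith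
    set s := √(α ^ 2 - 4 * r ^ 2) with hs
    have hs0 : s ≠ 0 := (Real.sqrt_pos.2 hd).ne'
    have hs2 : s ^ 2 = α ^ 2 - 4 * r ^ 2 := Real.sq_sqrt hd.le
    have hK : dampedOscillator α r = fun t =>
        (Real.exp ((-α + s) / 2 * t) - Real.exp ((-α - s) / 2 * t)) / s := by
      funext t
      simp only [dampedOscillator, if_pos h, ← hs]
    refine ⟨fun t => ((-α + s) / 2 * Real.exp ((-α + s) / 2 * t)
        - (-α - s) / 2 * Real.exp ((-α - s) / 2 * t)) / s,
      fun t => ((-α + s) / 2 * ((-α + s) / 2 * Real.exp ((-α + s) / 2 * t))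
        - (-α - s) / 2 * ((-α - s) / 2 * Real.exp ((-α - s) / 2 * t))) / s, ?_, ?_, ?_⟩
    · simp [hK]
    · simp only [mul_zero, Real.exp_zero, mul_one]
      field_simp
      ring
    · intro t
      rw [hK]
      refine ⟨((hexp _ t).sub (hexp _ t)).div_const s,
        (((hexp _ t).const_mul _).sub ((hexp _ t).const_mul _)).div_const s, ?_⟩
      have hr2 : r ^ 2 = (α ^ 2 - s ^ 2) / 4 := by rw [hs2]; ring
      simp only [hr2]
      field_simp
      ring
  · have hK : dampedOscillator α r = fun t => t * Real.exp (-(α / 2) * t) := by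
      funext t
      simp only [dampedOscillator, if_neg (not_lt.2 h.ge), if_pos h.symm]
    refine ⟨fun t => 1 * Real.exp (-(α / 2) * t) + t * (-(α / 2) * Real.exp (-(α / 2) * t)),
      fun t => 1 * (-(α / 2) * Real.exp (-(α / 2) * t)) +
        (1 * (-(α / 2) * Real.exp (-(α / 2) * t)) +
          t * (-(α / 2) * (-(α / 2) * Real.exp (-(α / 2) * t)))), ?_, ?_, ?_⟩
    · simp [hK]
    · simp
    · intro t
      rw [hK]
      refine ⟨(hasDerivAt_id t).mul (hexp _ t), ((hexp _ t).const_mul _).add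
        ((hasDerivAt_id t).mul ((hexp _ t).const_mul _)), ?_⟩
      have : r = α / 2 := by linarith
      subst this
      ring
  · have hd : 0 < r ^ 2 - α ^ 2 / 4 := by nlinarith
    set s := √(r ^ 2 - α ^ 2 / 4) with hs
    have hs0 : s ≠ 0 := (Real.sqrt_pos.2 hd).ne'
    have hs2 : s ^ 2 = r ^ 2 - α ^ 2 / 4 := Real.sq_sqrt hd.le
    have hK : dampedOscillator α r = fun t =>
        Real.exp (-(α / 2) * t) * (Real.sin (s * t) / s) := by
      funext t
      simp only [dampedOscillator, if_neg (not_lt.2 h.le), if_neg h.ne, ← hs]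
    have hsin : ∀ t : ℝ, HasDerivAt (fun t => Real.sin (s * t) / s) (Real.cos (s * t)) t := by
      intro t
      have := (((hasDerivAt_id t).const_mul s).sin).div_const s
      simpa [hs0] using this
    have hcos : ∀ t : ℝ, HasDerivAt (fun t => Real.cos (s * t)) (-Real.sin (s * t) * s) t := by
      intro t
      simpa using ((hasDerivAt_id t).const_mul s).cos
    refine ⟨fun t => -(α / 2) * Real.exp (-(α / 2) * t) * (Real.sin (s * t) / s) +
        Real.exp (-(α / 2) * t) * Real.cos (s * t),
      fun t => (-(α / 2) * (-(α / 2) * Real.exp (-(α / 2) * t)) * (Real.sin (s * t) / s) +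
        -(α / 2) * Real.exp (-(α / 2) * t) * Real.cos (s * t)) +
        (-(α / 2) * Real.exp (-(α / 2) * t) * Real.cos (s * t) +
          Real.exp (-(α / 2) * t) * (-Real.sin (s * t) * s)), ?_, ?_, ?_⟩
    · simp [hK]
    · simp
    · intro t
      rw [hK]
      refine ⟨(hexp _ t).mul (hsin t), (((hexp _ t).const_mul _).mul (hsin t)).add
        ((hexp _ t).mul (hcos t)), ?_⟩
      have hr2 : r ^ 2 = s ^ 2 + α ^ 2 / 4 := by rw [hs2]; ring
      simp only [hr2]
      field_simp
      ring

/-- The Fourier transform `K̂(t,ξ)` of the fundamental solution of `u_tt - Δu + A u_t = 0`, with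
`A` the Fourier multiplier with symbol `a`. -/
def fundamentalSymbol {n : ℕ} (a : EuclideanSpace ℝ (Fin n) → ℝ) (t : ℝ)
    (ξ : EuclideanSpace ℝ (Fin n)) : ℝ :=
  dampedOscillator (a ξ) ‖ξ‖ t

/-- The inverse Fourier transform `(2π)^{-n} ∫ e^{i x·ξ} g(ξ) dξ`. -/
def inverseFourier {n : ℕ} (g : EuclideanSpace ℝ (Fin n) → ℂ)
    (x : EuclideanSpace ℝ (Fin n)) : ℂ :=
  (((2 * Real.pi) ^ n)⁻¹ : ℝ) * ∫ ξ, Complex.exp (Complex.I * (⟪x, ξ⟫ : ℝ)) * g ξ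

/-- The fundamental solution localized at low frequencies, `K₀(t,·) = 𝓕⁻¹(K̂(t,·) φ₀)`, where
`φ₀(ξ) = χ(2ξ/δ)` equals `1` for `|ξ| ≤ δ/2` and vanishes for `|ξ| ≥ δ`. -/
def lowFrequencyKernel {n : ℕ} (a χ : EuclideanSpace ℝ (Fin n) → ℝ) (δ t : ℝ) :
    EuclideanSpace ℝ (Fin n) → ℂ :=
  inverseFourier fun ξ => ((fundamentalSymbol a t ξ * χ ((2 / δ) • ξ) : ℝ) : ℂ)

/-- The norm of `T` in `L_p^q`, that is, the supremum of `‖T ∗ f‖_{L^q}` over the Schwartz functions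
`f` with `‖f‖_{L^p} = 1`. It is `∞` exactly when `T` is not in `L_p^q`. It is used for bounded
continuous `T`, for which the convolution with a Schwartz function is an absolutely convergent
integral. -/
def convolutorNorm {n : ℕ} (p q : ℝ≥0∞) (T : EuclideanSpace ℝ (Fin n) → ℂ) : ℝ≥0∞ :=
  ⨆ (f : 𝓢(EuclideanSpace ℝ (Fin n), ℂ)) (_ : eLpNorm f p volume = 1),
    eLpNorm (convolution T f (ContinuousLinearMap.mul ℂ ℂ) volume) q volume

/-- The quantity `n (1/p - 1/q)`, with `1/∞ = 0`. -/
def scalingGap (n : ℕ) (p q : ℝ≥0∞) : ℝ :=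
  n * ((p⁻¹).toReal - (q⁻¹).toReal)

end

/-!
For `|ξ| ≤ δ` the characteristic roots are real and separated: the slow one decays at a rate
comparable to `|ξ|^(2-θ₀)`, and the gap between the roots is comparable to `|ξ|^θ₀`. The multiplier
`K̂(t,ξ) φ₀(ξ)` is `t exp (-t λ(ξ)) ψ(t g(ξ))` times a cut-off, with `λ` the slow rate, `g` the gap
and `ψ(y) = (1 - e^(-y)) / y`. It is therefore of size
`min (t, |ξ|^(-θ₀)) exp (-c t |ξ|^(2-θ₀))`, and Mikhlin-type estimates with `n + 1` derivatives hold
with the same size, uniformly in time (`exists_isSymbolAt_lowFrequencySymbol`).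

The part of the multiplier at frequencies `|ξ| ~ R` has a kernel concentrated on the ball of radius
`1 / R`, and Bernstein's inequality (`IsScaleKernel.eLpNorm_conv_le`) bounds its norm from `L^p` to
`L^q` by the size of the symbol times `R^G`, where `G = n (1/p - 1/q)`. The theorem follows by
summing over dyadic `R`.

* If `G > θ₀`, the sum is geometric on both sides of `R ~ (1 + t)^(-1/(2-θ₀))` and gives the decay
  rate (`convolutorNorm_le_of_lt_scalingGap`).
* If `G < θ₀`, it is geometric on both sides of `R ~ (1 + t)^(-1/θ₀)` as soon as `t` times a cut-off
  at that scale has been subtracted, which is needed for `G = 0`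
  (`convolutorNorm_le_of_scalingGap_lt`).
* If `G = θ₀`, about `log (1 + t)` terms are of size one, which gives the logarithm
  (`convolutorNorm_le_log`). For `1 < p` and `q < ∞` the logarithm is removed as in the proof of
  the Hardy–Littlewood–Sobolev inequality by real interpolation: a
  level-dependent splitting of the dyadic sum gives a distributional inequality, which is integrated
  by the layer-cake formula (`exists_eLpNorm_conv_sum_le_of_critical`).
* If `G = 0 = θ₀`, the multipliers satisfy Mikhlin's condition uniformly in time. The
  Mikhlin–Hörmander theorem is proved by the Calderón–Zygmund decomposition, Marcinkiewicz
  interpolation with `L²`, and duality (`IsCalderonZygmundKernel.exists_eLpNorm_conv_le`).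

All estimates are made for finite dyadic sums, with bounds independent of the number of terms. Such
sums have bounded integrable kernels, so that every convolution converges absolutely; the passage to
the full multiplier is `eLpNorm_conv_inverseFourier_le`.
-/

/-! ### Pointwise symbol estimates -/

section SymbolCalculus

variable {E F : Type*} [NormedAddCommGroup E] [NormedSpace ℝ E] [NormedAddCommGroup F]
  [NormedSpace ℝ F]

/-- Mikhlin-type bounds at one point: `f` is of class `C^N` near `x`, and `‖x‖ ^ k * ‖D^k f(x)‖ ≤ M`
for all `k ≤ N`. The size `M` carries the weight, so that uniform symbol classes arise by
quantifying over `x` and over parameters. -/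
structure IsSymbolAt (N : ℕ) (f : E → F) (x : E) (M : ℝ) : Prop where
  contDiffAt : ContDiffAt ℝ N f x
  bound : ∀ k ≤ N, ‖x‖ ^ k * ‖iteratedFDeriv ℝ k f x‖ ≤ M

namespace IsSymbolAt

variable {N : ℕ} {f g : E → F} {x : E} {M M' : ℝ}

lemma norm_le (h : IsSymbolAt N f x M) : ‖f x‖ ≤ M := by
  simpa using h.bound 0 (Nat.zero_le _)

lemma nonneg (h : IsSymbolAt N f x M) : 0 ≤ M := (norm_nonneg _).trans h.norm_le

lemma mono (h : IsSymbolAt N f x M) (hM : M ≤ M') : IsSymbolAt N f x M' :=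
  ⟨h.contDiffAt, fun k hk => (h.bound k hk).trans hM⟩

lemma congr (h : IsSymbolAt N f x M) (hfg : g =ᶠ[nhds x] f) : IsSymbolAt N g x M := by
  refine ⟨h.contDiffAt.congr_of_eventuallyEq hfg, fun k hk => ?_⟩
  rw [(hfg.iteratedFDeriv ℝ k).eq_of_nhds]
  exact h.bound k hk

lemma of_eventuallyEq_zero (h : f =ᶠ[nhds x] 0) (hM : 0 ≤ M) : IsSymbolAt N f x M := by
  refine IsSymbolAt.congr ⟨contDiffAt_const (c := (0 : F)), fun k _ => ?_⟩ h
  have : iteratedFDeriv ℝ k (fun _ : E => (0 : F)) x = 0 := by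
    rw [iteratedFDeriv_fun_zero]; rfl
  rw [this]
  simpa using hM

lemma add (hf : IsSymbolAt N f x M) (hg : IsSymbolAt N g x M') :
    IsSymbolAt N (fun y => f y + g y) x (M + M') := by
  refine ⟨hf.contDiffAt.add hg.contDiffAt, fun k hk => ?_⟩
  have hk' : (k : WithTop ℕ∞) ≤ N := by exact_mod_cast hk
  have : iteratedFDeriv ℝ k (fun y => f y + g y) x
      = iteratedFDeriv ℝ k f x + iteratedFDeriv ℝ k g x :=
    iteratedFDeriv_add_apply (hf.contDiffAt.of_le hk') (hg.contDiffAt.of_le hk')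
  rw [this]
  calc _ ≤ ‖x‖ ^ k * (‖iteratedFDeriv ℝ k f x‖ + ‖iteratedFDeriv ℝ k g x‖) := by
        gcongr; exact norm_add_le _ _
    _ ≤ _ := by rw [mul_add]; exact add_le_add (hf.bound k hk) (hg.bound k hk)

lemma const_smul (hf : IsSymbolAt N f x M) (c : ℝ) :
    IsSymbolAt N (fun y => c • f y) x (|c| * M) := by
  refine ⟨contDiffAt_const.smul hf.contDiffAt, fun k hk => ?_⟩
  have hk' : (k : WithTop ℕ∞) ≤ N := by exact_mod_cast hk
  have : iteratedFDeriv ℝ k (fun y => c • f y) x = c • iteratedFDeriv ℝ k f x :=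
    iteratedFDeriv_const_smul_apply (hf.contDiffAt.of_le hk')
  rw [this, norm_smul, Real.norm_eq_abs, mul_left_comm]
  exact mul_le_mul_of_nonneg_left (hf.bound k hk) (abs_nonneg _)

lemma sub (hf : IsSymbolAt N f x M) (hg : IsSymbolAt N g x M') :
    IsSymbolAt N (fun y => f y - g y) x (M + M') := by
  have := hf.add (hg.const_smul (-1))
  simpa [sub_eq_add_neg] using this

lemma exists_isOpen (hf : IsSymbolAt N f x M) :
    ∃ u : Set E, IsOpen u ∧ x ∈ u ∧ ContDiffOn ℝ N f u := by
  obtain ⟨v, hv, hfv⟩ := hf.contDiffAt.contDiffOn le_rfl (by simp)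
  obtain ⟨u, huv, hu, hxu⟩ := mem_nhds_iff.1 hv
  exact ⟨u, hu, hxu, hfv.mono huv⟩

lemma mul {A : Type*} [NormedRing A] [NormedAlgebra ℝ A] {f g : E → A}
    (hf : IsSymbolAt N f x M) (hg : IsSymbolAt N g x M') :
    IsSymbolAt N (fun y => f y * g y) x (2 ^ N * (M * M')) := by
  refine ⟨hf.contDiffAt.mul hg.contDiffAt, fun k hk => ?_⟩
  obtain ⟨u, hu, hxu, hfu⟩ := hf.exists_isOpen
  obtain ⟨v, hv, hxv, hgv⟩ := hg.exists_isOpen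
  have hk' : (k : WithTop ℕ∞) ≤ N := by exact_mod_cast hk
  have ho : IsOpen (u ∩ v) := hu.inter hv
  have key := norm_iteratedFDerivWithin_mul_le (hfu.mono Set.inter_subset_left)
    (hgv.mono Set.inter_subset_right) ho.uniqueDiffOn ⟨hxu, hxv⟩ hk'
  simp only [iteratedFDerivWithin_of_isOpen _ ho ⟨hxu, hxv⟩] at key
  calc _ ≤ ‖x‖ ^ k * ∑ i ∈ Finset.range (k + 1), (k.choose i : ℝ) * ‖iteratedFDeriv ℝ i f x‖ *
          ‖iteratedFDeriv ℝ (k - i) g x‖ := by gcongr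
    _ ≤ ∑ i ∈ Finset.range (k + 1), (k.choose i : ℝ) * (M * M') := by
        rw [Finset.mul_sum]
        refine Finset.sum_le_sum fun i hi => ?_
        have hi : i ≤ k := Nat.lt_succ_iff.1 (Finset.mem_range.1 hi)
        have e : ‖x‖ ^ k = ‖x‖ ^ i * ‖x‖ ^ (k - i) := by rw [← pow_add, Nat.add_sub_cancel' hi]
        have := mul_le_mul (hf.bound i (hi.trans hk)) (hg.bound (k - i) (by omega))
          (by positivity) hf.nonneg
        calc _ = (k.choose i : ℝ) * ((‖x‖ ^ i * ‖iteratedFDeriv ℝ i f x‖) *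
              (‖x‖ ^ (k - i) * ‖iteratedFDeriv ℝ (k - i) g x‖)) := by rw [e]; ring
          _ ≤ _ := by gcongr
    _ = 2 ^ k * (M * M') := by
        rw [← Finset.sum_mul]
        congr 1
        exact_mod_cast Nat.sum_range_choose k
    _ ≤ _ := by
        have := mul_nonneg hf.nonneg hg.nonneg
        gcongr
        norm_num

/-- Composition with a function of one real variable, at a point where the inner function is
normalised to the value `1`. All compositions are reduced to this case by scaling. -/
lemma comp {f : E → ℝ} {g : ℝ → F} {B : ℝ} (hx : x ≠ 0) (hB : 1 ≤ B) (hf : IsSymbolAt N f x B)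
    (hfx : f x = 1) (hg : IsSymbolAt N g 1 M) :
    IsSymbolAt N (fun y => g (f y)) x (N.factorial * B ^ N * M) := by
  rw [← hfx] at hg
  refine ⟨hg.contDiffAt.comp x hf.contDiffAt, fun k hk => ?_⟩
  obtain ⟨u, hu, hxu, hfu⟩ := hf.exists_isOpen
  obtain ⟨v, hv, hxv, hgv⟩ := hg.exists_isOpen
  have hk' : (k : WithTop ℕ∞) ≤ N := by exact_mod_cast hk
  have hnx : 0 < ‖x‖ := norm_pos_iff.2 hx
  have ho : IsOpen (u ∩ f ⁻¹' v) := hfu.continuousOn.isOpen_inter_preimage hu hv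
  have key := norm_iteratedFDerivWithin_comp_le (g := g) (f := f) (s := u ∩ f ⁻¹' v) (t := v)
    (x := x) (C := M) (D := B / ‖x‖) hgv (hfu.mono Set.inter_subset_left) hk'
    hv.uniqueDiffOn ho.uniqueDiffOn (fun y hy => hy.2) ⟨hxu, hxv⟩
    (fun i hi => by
      rw [iteratedFDerivWithin_of_isOpen _ hv hxv]
      simpa [hfx] using hg.bound i (hi.trans hk))
    (fun i hi hik => by
      rw [iteratedFDerivWithin_of_isOpen _ ho ⟨hxu, hxv⟩, div_pow, le_div_iff₀ (by positivity),
        mul_comm]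
      refine (hf.bound i (hik.trans hk)).trans (le_self_pow₀ hB (by omega)))
  rw [iteratedFDerivWithin_of_isOpen _ ho ⟨hxu, hxv⟩] at key
  calc _ ≤ ‖x‖ ^ k * (k.factorial * M * (B / ‖x‖) ^ k) := by
        gcongr; exact key
    _ = k.factorial * B ^ k * M := by rw [div_pow]; field_simp
    _ ≤ _ := by
        have := hg.nonneg
        gcongr

/-- Composition of a positive symbol with a function whose rescaling by the value of the symbol is
controlled at `1`. -/
lemma comp_of_pos {f : E → ℝ} {g : ℝ → F} {B : ℝ} (hx : x ≠ 0) (hB : 1 ≤ B) (hfx : 0 < f x)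
    (hf : IsSymbolAt N f x (B * f x)) (hg : IsSymbolAt N (fun u => g (f x * u)) 1 M) :
    IsSymbolAt N (fun y => g (f y)) x (N.factorial * B ^ N * M) := by
  have h1 : IsSymbolAt N (fun y => (f x)⁻¹ • f y) x B := by
    refine (hf.const_smul (f x)⁻¹).mono (le_of_eq ?_)
    rw [abs_of_pos (by positivity)]
    field_simp
  have := h1.comp hx hB (by simp [hfx.ne']) hg
  refine this.congr (Filter.Eventually.of_forall fun y => ?_)
  simp [hfx.ne']

lemma of_contDiffAt (h : ContDiffAt ℝ N f x) : ∃ M, IsSymbolAt N f x M := by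
  refine ⟨∑ k ∈ Finset.range (N + 1), ‖x‖ ^ k * ‖iteratedFDeriv ℝ k f x‖, h, fun k hk => ?_⟩
  exact Finset.single_le_sum (f := fun k => ‖x‖ ^ k * ‖iteratedFDeriv ℝ k f x‖)
    (fun i _ => by positivity) (Finset.mem_range.2 (by omega))

end IsSymbolAt

lemma exists_isSymbolAt_inv (N : ℕ) {B : ℝ} (hB : 1 ≤ B) : ∃ C, 1 ≤ C ∧ ∀ (f : E → ℝ) (x : E),
    x ≠ 0 → 0 < f x → IsSymbolAt N f x (B * f x) →
      IsSymbolAt N (fun y => (f y)⁻¹) x (C * (f x)⁻¹) := by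
  obtain ⟨M, hM⟩ := IsSymbolAt.of_contDiffAt (N := N) (f := fun u : ℝ => u⁻¹) (x := (1 : ℝ))
    (contDiffAt_inv ℝ one_ne_zero)
  refine ⟨max 1 (N.factorial * B ^ N * M), le_max_left _ _, fun f x hx hfx hf => ?_⟩
  have h : IsSymbolAt N (fun u : ℝ => (f x * u)⁻¹) 1 (|(f x)⁻¹| * M) :=
    (hM.const_smul (f x)⁻¹).congr (Filter.Eventually.of_forall fun u => by simp [mul_comm])
  refine (IsSymbolAt.comp_of_pos (g := fun u => u⁻¹) hx hB hfx hf h).mono ?_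
  rw [abs_of_pos (by positivity), mul_left_comm, mul_comm]
  gcongr
  exact le_max_right _ _

lemma exists_isSymbolAt_sqrt (N : ℕ) {B : ℝ} (hB : 1 ≤ B) : ∃ C, 1 ≤ C ∧ ∀ (f : E → ℝ) (x : E),
    x ≠ 0 → 0 < f x → IsSymbolAt N f x (B * f x) →
      IsSymbolAt N (fun y => √(f y)) x (C * √(f x)) := by
  obtain ⟨M, hM⟩ := IsSymbolAt.of_contDiffAt (N := N) (f := fun u : ℝ => √u) (x := (1 : ℝ))
    (Real.contDiffAt_sqrt one_ne_zero)
  refine ⟨max 1 (N.factorial * B ^ N * M), le_max_left _ _, fun f x hx hfx hf => ?_⟩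
  have h : IsSymbolAt N (fun u : ℝ => √(f x * u)) 1 (|√(f x)| * M) :=
    (hM.const_smul √(f x)).congr (Filter.Eventually.of_forall fun u => by
      simp [Real.sqrt_mul hfx.le])
  refine (IsSymbolAt.comp_of_pos (g := fun u => √u) hx hB hfx hf h).mono ?_
  rw [abs_of_nonneg (by positivity), mul_left_comm, mul_comm]
  gcongr
  exact le_max_right _ _

/-- A smooth function vanishing for `2 ≤ ‖ξ‖` is a symbol of order zero, uniformly under
dilations. -/
lemma exists_isSymbolAt_dilation (N : ℕ) {χ : E → F} [FiniteDimensional ℝ E]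
    (hχ : ContDiff ℝ ((⊤ : ℕ∞) : WithTop ℕ∞) χ)
    (h0 : ∀ ξ, 2 ≤ ‖ξ‖ → χ ξ = 0) :
    ∃ C, 1 ≤ C ∧ ∀ (l : ℝ) (ξ : E), IsSymbolAt N (fun y => χ (l • y)) ξ C := by
  have hb : ∀ k : ℕ, ∃ C, ∀ ξ, ‖ξ‖ ^ k * ‖iteratedFDeriv ℝ k χ ξ‖ ≤ C := by
    intro k
    have hc : Continuous fun ξ => ‖ξ‖ ^ k * ‖iteratedFDeriv ℝ k χ ξ‖ := by
      have := hχ.continuous_iteratedFDeriv (m := k) (by exact_mod_cast le_top)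
      fun_prop
    have hs : HasCompactSupport fun ξ => ‖ξ‖ ^ k * ‖iteratedFDeriv ℝ k χ ξ‖ := by
      have : HasCompactSupport χ := HasCompactSupport.intro (isCompact_closedBall (0 : E) 2)
        fun x hx => h0 x (by simpa using (not_le.1 (by simpa using hx)).le)
      exact ((this.iteratedFDeriv k).norm).mul_left
    obtain ⟨C, hC⟩ := hc.bounded_above_of_compact_support hs
    exact ⟨C, fun ξ => (le_abs_self _).trans (hC ξ)⟩
  choose C hC using hb
  have hC0 : ∀ k, 0 ≤ C k := fun k => (by positivity : (0 : ℝ) ≤ _).trans (hC k 0)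
  refine ⟨1 + ∑ k ∈ Finset.range (N + 1), C k, by
    linarith [Finset.sum_nonneg (s := Finset.range (N + 1)) fun k _ => hC0 k], fun l ξ => ?_⟩
  have hχN : ∀ k : ℕ, ContDiff ℝ k χ := fun k => hχ.of_le (by exact_mod_cast le_top)
  refine ⟨((hχN N).comp (contDiff_const_smul l)).contDiffAt, fun k hk => ?_⟩
  rw [iteratedFDeriv_comp_const_smul l (hχN k)]
  have h1 := hC k (l • ξ)
  have h2 : C k ≤ ∑ k ∈ Finset.range (N + 1), C k :=
    Finset.single_le_sum (fun i _ => hC0 i) (Finset.mem_range.2 (by omega))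
  rw [norm_smul, mul_pow] at h1
  simp only [norm_smul, norm_pow]
  linarith [h1, mul_comm (‖l‖ ^ k) (‖ξ‖ ^ k),
    mul_assoc (‖ξ‖ ^ k) (‖l‖ ^ k) (‖iteratedFDeriv ℝ k χ (l • ξ)‖),
    mul_assoc (‖l‖ ^ k) (‖ξ‖ ^ k) (‖iteratedFDeriv ℝ k χ (l • ξ)‖)]

end SymbolCalculus

/-! ### The overdamped oscillator as a symbol -/

section OneVariable

/-- If `h` is smooth and `h 0 = 0`, the rescaled functions `u ↦ h (τ u)` are of size `τ` as symbols
at `1`, uniformly in `0 ≤ τ ≤ 1`. -/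
lemma exists_isSymbolAt_rescaled (N : ℕ) {h : ℝ → ℝ} (hh : ContDiff ℝ ((⊤ : ℕ∞) : WithTop ℕ∞) h)
    (h0 : h 0 = 0) :
    ∃ C, 0 ≤ C ∧ ∀ τ, 0 ≤ τ → τ ≤ 1 → IsSymbolAt N (fun u => h (τ * u)) 1 (C * τ) := by
  have hb : ∀ k : ℕ, ∃ C, 0 ≤ C ∧ ∀ y ∈ Set.Icc (0 : ℝ) 1, ‖iteratedFDeriv ℝ k h y‖ ≤ C := by
    intro k
    have hc : Continuous fun y => iteratedFDeriv ℝ k h y :=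
      hh.continuous_iteratedFDeriv (m := k) (by exact_mod_cast le_top)
    obtain ⟨C, hC⟩ := isCompact_Icc.exists_bound_of_continuousOn
      (s := Set.Icc (0 : ℝ) 1) hc.continuousOn
    exact ⟨C, (norm_nonneg _).trans (hC 0 (by simp)), hC⟩
  choose C hC0 hC using hb
  refine ⟨C 1 + ∑ k ∈ Finset.range (N + 1), C k,
    add_nonneg (hC0 1) (Finset.sum_nonneg fun k _ => hC0 k), fun τ hτ0 hτ1 => ?_⟩
  have hhN : ∀ k : ℕ, ContDiff ℝ k h := fun k => hh.of_le (by exact_mod_cast le_top)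
  have hsum : ∀ k ≤ N, C k ≤ ∑ k ∈ Finset.range (N + 1), C k := fun k hk =>
    Finset.single_le_sum (fun i _ => hC0 i) (Finset.mem_range.2 (by omega))
  have e : (fun u => h (τ * u)) = fun u => h (τ • u) := rfl
  rw [e]
  refine ⟨((hhN N).comp (contDiff_const_smul τ)).contDiffAt, fun k hk => ?_⟩
  rcases Nat.eq_zero_or_pos k with rfl | hk0
  · have hmv : ‖h τ - h 0‖ ≤ C 1 * ‖τ - 0‖ := by
      refine (convex_Icc (0 : ℝ) 1).norm_image_sub_le_of_norm_fderiv_le (f := h) (𝕜 := ℝ)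
        (fun x _ => ((hhN 1).differentiable (by simp)).differentiableAt) (fun x hx => ?_)
        (by simp) (by simp [hτ0, hτ1])
      rw [← norm_iteratedFDeriv_one]
      exact hC 1 x hx
    simp only [h0, sub_zero, Real.norm_eq_abs, abs_of_nonneg hτ0] at hmv
    have h3 := hsum 0 hk
    have h4 := hC0 0
    simp only [pow_zero, norm_iteratedFDeriv_zero, one_mul, smul_eq_mul, mul_one, Real.norm_eq_abs]
    nlinarith
  · rw [iteratedFDeriv_comp_const_smul τ (hhN k)]
    simp only [norm_one, one_pow, one_mul, smul_eq_mul, mul_one, norm_smul, norm_pow,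
      Real.norm_eq_abs, abs_of_nonneg hτ0]
    have h1 := hC k τ ⟨hτ0, hτ1⟩
    have h2 : τ ^ k ≤ τ := pow_le_of_le_one hτ0 hτ1 (by omega)
    have h3 := hsum k hk
    calc τ ^ k * ‖iteratedFDeriv ℝ k h τ‖ ≤ τ * C k := by gcongr
      _ ≤ _ := by nlinarith [hC0 1]

lemma isSymbolAt_one {E : Type*} [NormedAddCommGroup E] [NormedSpace ℝ E] (N : ℕ) (x : E) :
    IsSymbolAt N (fun _ : E => (1 : ℝ)) x 1 := by
  refine ⟨contDiffAt_const, fun k _ => ?_⟩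
  rcases Nat.eq_zero_or_pos k with rfl | hk0
  · simp
  · simp [iteratedFDeriv_const_of_ne (𝕜 := ℝ) hk0.ne' (1 : ℝ)]

/-- Half of the exponential decay pays for the powers of `τ` that the derivatives produce. -/
lemma exists_isSymbolAt_exp (N : ℕ) :
    ∃ C, 0 ≤ C ∧ ∀ τ, 0 ≤ τ →
      IsSymbolAt N (fun u => Real.exp (-(τ * u))) 1 (C * Real.exp (-(τ / 2))) := by
  refine ⟨2 ^ N * N.factorial, by positivity, fun τ hτ => ⟨by fun_prop, fun k hk => ?_⟩⟩
  have e : (fun u => Real.exp (-(τ * u))) = fun u => Real.exp ((-τ) * u) := by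
    funext u; congr 1; ring
  rw [norm_iteratedFDeriv_eq_norm_iteratedDeriv, e]
  rw [congrFun (iteratedDeriv_exp_const_mul k (-τ)) 1]
  have h1 := Real.pow_div_factorial_le_exp (τ / 2) (by positivity) k
  rw [div_le_iff₀ (by positivity)] at h1
  have h2 : Real.exp (-τ) = Real.exp (-(τ / 2)) * Real.exp (-(τ / 2)) := by
    rw [← Real.exp_add]; congr 1; ring
  have h3 : Real.exp (τ / 2) * Real.exp (-(τ / 2)) = 1 := by rw [← Real.exp_add]; simp
  have h4 : (2 : ℝ) ^ k ≤ 2 ^ N := pow_le_pow_right₀ (by norm_num) hk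
  have h5 : (k.factorial : ℝ) ≤ N.factorial := by exact_mod_cast Nat.factorial_le hk
  simp only [norm_one, one_pow, one_mul, mul_one, norm_mul, norm_pow, norm_neg, Real.norm_eq_abs,
    abs_of_nonneg hτ, Real.abs_exp]
  calc τ ^ k * Real.exp (-τ) = 2 ^ k * (τ / 2) ^ k * Real.exp (-(τ / 2)) * Real.exp (-(τ / 2)) := by
        rw [h2, div_pow]; field_simp
    _ ≤ 2 ^ k * (Real.exp (τ / 2) * k.factorial) * Real.exp (-(τ / 2)) * Real.exp (-(τ / 2)) := by
        gcongr
    _ = 2 ^ k * k.factorial * (Real.exp (τ / 2) * Real.exp (-(τ / 2))) * Real.exp (-(τ / 2)) := by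
        ring
    _ ≤ _ := by rw [h3, mul_one]; gcongr

lemma exists_isSymbolAt_exp_sub_one (N : ℕ) :
    ∃ C, 0 ≤ C ∧ ∀ τ, 0 ≤ τ →
      IsSymbolAt N (fun u => Real.exp (-(τ * u)) - 1) 1 (C * min 1 τ) := by
  obtain ⟨C, hC, h⟩ := exists_isSymbolAt_exp N
  obtain ⟨D, hD, h'⟩ := exists_isSymbolAt_rescaled N (h := fun y => Real.exp (-y) - 1)
    (by fun_prop) (by simp)
  refine ⟨C + 1 + D, by positivity, fun τ hτ => ?_⟩
  rcases le_total τ 1 with h1 | h1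
  · rw [min_eq_right h1]
    exact (h' τ hτ h1).mono (by nlinarith)
  · rw [min_eq_left h1]
    refine ((h τ hτ).sub (isSymbolAt_one N 1)).mono ?_
    have : Real.exp (-(τ / 2)) ≤ 1 := Real.exp_le_one_iff.2 (by linarith)
    nlinarith

/-- The smooth function `y ↦ (1 - exp (-y)) / y`, with value `1` at `0`. -/
noncomputable def expQuotient : ℝ → ℝ := dslope (fun y => -Real.exp (-y)) 0

lemma expQuotient_zero : expQuotient 0 = 1 := by
  have : HasDerivAt (fun y : ℝ => -Real.exp (-y)) 1 0 := by
    simpa using ((hasDerivAt_id (0 : ℝ)).fun_neg.exp).fun_neg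
  rw [expQuotient, dslope_same, this.deriv]

lemma mul_expQuotient (y : ℝ) : y * expQuotient y = 1 - Real.exp (-y) := by
  have := sub_smul_dslope (fun y : ℝ => -Real.exp (-y)) 0 y
  simp only [sub_zero, smul_eq_mul, neg_zero, Real.exp_zero] at this
  rw [expQuotient, this]
  ring

lemma contDiff_expQuotient : ContDiff ℝ ((⊤ : ℕ∞) : WithTop ℕ∞) expQuotient := by
  rw [contDiff_iff_contDiffAt]
  intro y
  by_cases hy : y = 0
  · subst hy
    have ha : AnalyticAt ℝ (fun y : ℝ => -Real.exp (-y)) 0 := by fun_prop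
    obtain ⟨p, hp⟩ := ha
    exact (hp.has_fpower_series_dslope_fslope.analyticAt).contDiffAt
  · have h : ContDiffAt ℝ ((⊤ : ℕ∞) : WithTop ℕ∞) (fun y => (1 - Real.exp (-y)) / y) y :=
      ContDiffAt.div (by fun_prop) contDiffAt_id hy
    refine h.congr_of_eventuallyEq ?_
    filter_upwards [isOpen_ne.mem_nhds hy] with z hz
    rw [← mul_expQuotient, mul_div_cancel_left₀ _ hz]

lemma exists_isSymbolAt_expQuotient_sub_one_of_le (N : ℕ) :
    ∃ C, 0 ≤ C ∧ ∀ τ, 0 ≤ τ → τ ≤ 1 →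
      IsSymbolAt N (fun u => expQuotient (τ * u) - 1) 1 (C * τ) :=
  exists_isSymbolAt_rescaled N (h := fun y => expQuotient y - 1)
    (contDiff_expQuotient.sub contDiff_const) (by simp [expQuotient_zero])

lemma exists_isSymbolAt_expQuotient (N : ℕ) :
    ∃ C, 0 ≤ C ∧ ∀ τ, 0 ≤ τ →
      IsSymbolAt N (fun u => expQuotient (τ * u)) 1 C ∧
      (0 < τ → IsSymbolAt N (fun u => expQuotient (τ * u)) 1 (C * τ⁻¹)) ∧
      IsSymbolAt N (fun u => expQuotient (τ * u) - 1) 1 (C * min 1 τ) := by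
  obtain ⟨D, hD, hs⟩ := exists_isSymbolAt_expQuotient_sub_one_of_le N
  obtain ⟨A, hA, he⟩ := exists_isSymbolAt_exp_sub_one N
  obtain ⟨M, hM⟩ := IsSymbolAt.of_contDiffAt (N := N) (f := fun u : ℝ => u⁻¹) (x := (1 : ℝ))
    (contDiffAt_inv ℝ one_ne_zero)
  have hM0 := hM.nonneg
  -- For `τ ≥ 1` the quotient is a product of symbols; for `τ ≤ 1` smoothness at `0` is used.
  have hlarge : ∀ τ, 1 ≤ τ →
      IsSymbolAt N (fun u => expQuotient (τ * u)) 1 (2 ^ N * (A * M) * τ⁻¹) := by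
    intro τ hτ
    have h1 := ((he τ (by linarith)).mul hM).const_smul (-τ⁻¹)
    rw [min_eq_left hτ, abs_neg, abs_of_nonneg (by positivity)] at h1
    refine (h1.mono (le_of_eq (by ring))).congr ?_
    filter_upwards [isOpen_ne.mem_nhds (one_ne_zero (α := ℝ))] with u hu
    have hu : u ≠ 0 := hu
    have hτ' : τ ≠ 0 := by positivity
    have := mul_expQuotient (τ * u)
    simp only [smul_eq_mul]
    field_simp
    linarith
  have hsmall : ∀ τ, 0 ≤ τ → τ ≤ 1 → IsSymbolAt N (fun u => expQuotient (τ * u)) 1 (D + 1) := by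
    intro τ h0 h1
    refine (((hs τ h0 h1).add (isSymbolAt_one N 1)).mono ?_).congr
      (Filter.Eventually.of_forall fun u => by ring)
    nlinarith
  have hK : 0 ≤ 2 ^ N * (A * M) := by positivity
  have hall : ∀ τ, 0 ≤ τ → IsSymbolAt N (fun u => expQuotient (τ * u)) 1
      (D + 1 + 2 ^ N * (A * M)) := by
    intro τ hτ
    rcases le_total τ 1 with h1 | h1
    · exact (hsmall τ hτ h1).mono (by linarith)
    · refine (hlarge τ h1).mono ?_
      have : τ⁻¹ ≤ 1 := inv_le_one_of_one_le₀ h1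
      nlinarith
  refine ⟨D + 1 + 2 ^ N * (A * M) + 1, by positivity, fun τ hτ => ⟨(hall τ hτ).mono (by linarith),
    fun hτ0 => ?_, ?_⟩⟩
  · rcases le_total τ 1 with h1 | h1
    · refine (hsmall τ hτ h1).mono ?_
      have : 1 ≤ τ⁻¹ := (one_le_inv₀ hτ0).2 h1
      nlinarith
    · refine (hlarge τ h1).mono ?_
      have : 0 < τ⁻¹ := by positivity
      gcongr
      linarith
  · rcases le_total τ 1 with h1 | h1
    · rw [min_eq_right h1]
      exact (hs τ hτ h1).mono (by nlinarith)
    · rw [min_eq_left h1, mul_one]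
      exact (hall τ hτ).sub (isSymbolAt_one N 1)

end OneVariable

section Oscillator

variable {n : ℕ} {a χ : EuclideanSpace ℝ (Fin n) → ℝ} {θ₀ a₁ C₀ δ : ℝ}

/-- The distance `√(a² - 4|ξ|²)` between the two characteristic roots. -/
noncomputable def rootGap (a : EuclideanSpace ℝ (Fin n) → ℝ) (ξ : EuclideanSpace ℝ (Fin n)) : ℝ :=
  √(a ξ * a ξ - 4 • (‖ξ‖ ^ 2))

/-- The smaller decay rate `(a - √(a² - 4|ξ|²)) / 2`, written without cancellation. -/
noncomputable def slowRate (a : EuclideanSpace ℝ (Fin n) → ℝ) (ξ : EuclideanSpace ℝ (Fin n)) : ℝ :=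
  2 • (‖ξ‖ ^ 2) * (a ξ + rootGap a ξ)⁻¹

/-- In the overdamped case the solution is `t` times the decay of the slow root times a smooth
function of `t` times the gap of the roots, which avoids the difference of exponentials. -/
lemma dampedOscillator_eq {α r : ℝ} (h : 2 * r < α) (hr : 0 ≤ r) (t : ℝ) :
    dampedOscillator α r t = t * (Real.exp (-(t * (2 * r ^ 2 * (α + √(α * α - 4 * r ^ 2))⁻¹))) *
      expQuotient (t * √(α * α - 4 * r ^ 2))) := by
  have hd : 0 < α * α - 4 * r ^ 2 := by nlinarith
  rw [dampedOscillator, if_pos h, pow_two α]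
  set s := √(α * α - 4 * r ^ 2) with hs
  have hs0 : 0 < s := Real.sqrt_pos.2 hd
  have hs2 : s ^ 2 = α * α - 4 * r ^ 2 := Real.sq_sqrt hd.le
  have hα : 0 < α + s := by linarith
  have h1 : 2 * r ^ 2 * (α + s)⁻¹ = (α - s) / 2 := by
    field_simp
    nlinarith
  have h2 : t * expQuotient (t * s) = (1 - Real.exp (-(t * s))) / s := by
    rw [← mul_expQuotient]
    field_simp
  rw [h1, mul_left_comm, h2, mul_div_assoc', mul_sub, mul_one, ← Real.exp_add]
  congr 3 <;> ring_nf

lemma fundamentalSymbol_eventuallyEq (ha : IsOverdampedSymbol n a θ₀ a₁ C₀ δ)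
    {ξ : EuclideanSpace ℝ (Fin n)} (hξ : ξ ≠ 0) (hδ : ‖ξ‖ ≤ δ) (t : ℝ) :
    fundamentalSymbol a t =ᶠ[nhds ξ]
      fun y => t * (Real.exp (-(t * slowRate a y)) * expQuotient (t * rootGap a y)) := by
  have hc : ContinuousAt a ξ :=
    (ha.contDiffOn.continuousOn).continuousAt (isOpen_compl_singleton.mem_nhds hξ)
  have h1 : 2 * ‖ξ‖ < a ξ := by
    have := ha.overdamped ξ hξ hδ
    have := norm_pos_iff.2 hξ
    linarith
  have h2 : ∀ᶠ y in nhds ξ, 2 * ‖y‖ < a y :=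
    ContinuousAt.eventually_lt (by fun_prop) hc h1
  filter_upwards [h2] with y hy
  rw [fundamentalSymbol, dampedOscillator_eq hy (norm_nonneg _)]
  simp [slowRate, rootGap, nsmul_eq_mul]

/-- The homogeneous function `‖ξ‖²` is a symbol of order two. -/
lemma exists_isSymbolAt_norm_sq (N : ℕ) (hχ : IsCutoff χ) :
    ∃ C, 1 ≤ C ∧ ∀ ξ : EuclideanSpace ℝ (Fin n), ξ ≠ 0 →
      IsSymbolAt N (fun y : EuclideanSpace ℝ (Fin n) => ‖y‖ ^ 2) ξ (C * ‖ξ‖ ^ 2) := by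
  obtain ⟨C, hC, h⟩ := exists_isSymbolAt_dilation N (χ := fun ξ => χ ξ * ‖ξ‖ ^ 2)
    (hχ.contDiff.mul (contDiff_norm_sq ℝ)) (fun ξ hξ => by simp [hχ.eq_zero ξ hξ])
  refine ⟨4 * C, by linarith, fun ξ hξ => ?_⟩
  have hr : 0 < ‖ξ‖ := norm_pos_iff.2 hξ
  have h1 := (h (2 * ‖ξ‖)⁻¹ ξ).const_smul (4 * ‖ξ‖ ^ 2)
  rw [abs_of_nonneg (by positivity)] at h1
  refine (h1.mono (le_of_eq (by ring))).congr ?_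
  have h2 : ∀ᶠ y in nhds ξ, ‖y‖ < 2 * ‖ξ‖ :=
    ContinuousAt.eventually_lt (by fun_prop) (by fun_prop) (by linarith)
  filter_upwards [h2] with y hy
  have h3 : ‖(2 * ‖ξ‖)⁻¹ • y‖ = (2 * ‖ξ‖)⁻¹ * ‖y‖ := by
    rw [norm_smul, Real.norm_eq_abs, abs_of_nonneg (by positivity)]
  have h4 : (2 * ‖ξ‖)⁻¹ * ‖y‖ ≤ 1 := by
    rw [inv_mul_le_iff₀ (by positivity)]; linarith
  rw [hχ.eq_one _ (h3 ▸ h4), h3, smul_eq_mul]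
  field_simp
  ring

/-- Two-sided bounds and symbol estimates for the gap of the characteristic roots, of order `θ₀`,
and for the slow rate, of order `2 - θ₀`. -/
lemma exists_isSymbolAt_roots (ha : IsOverdampedSymbol n a θ₀ a₁ C₀ δ) (hχ : IsCutoff χ) :
    ∃ C c, 1 ≤ C ∧ 0 < c ∧ ∀ ξ, ξ ≠ 0 → ‖ξ‖ ≤ δ →
      IsSymbolAt (n + 1) (slowRate a) ξ (C * slowRate a ξ) ∧
      IsSymbolAt (n + 1) (rootGap a) ξ (C * rootGap a ξ) ∧
      c * ‖ξ‖ ^ θ₀ ≤ rootGap a ξ ∧ rootGap a ξ ≤ C * ‖ξ‖ ^ θ₀ ∧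
      c * ‖ξ‖ ^ (2 - θ₀) ≤ slowRate a ξ ∧ slowRate a ξ ≤ C * ‖ξ‖ ^ (2 - θ₀) := by
  have ha₁ := ha.a₁_pos
  have hC₀ := ha.C₀_pos
  obtain ⟨C₂, hC₂, hsq⟩ := exists_isSymbolAt_norm_sq (n + 1) hχ
  set B₁ := max 1 (C₀ / a₁) with hB₁
  have hB₁1 : 1 ≤ B₁ := le_max_left _ _
  set B₂ := 2 * (2 ^ (n + 1) * (B₁ * B₁) + C₂) with hB₂
  have hB₂1 : 1 ≤ B₂ := by
    have : 0 ≤ (2 : ℝ) ^ (n + 1) * (B₁ * B₁) := by positivity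
    linarith
  obtain ⟨B₃, hB₃1, hsqrt⟩ := exists_isSymbolAt_sqrt (E := EuclideanSpace ℝ (Fin n)) (n + 1) hB₂1
  have hB₄1 : 1 ≤ B₁ + B₃ := by linarith
  obtain ⟨B₅, hB₅1, hinv⟩ := exists_isSymbolAt_inv (E := EuclideanSpace ℝ (Fin n)) (n + 1) hB₄1
  set B₆ := 2 ^ (n + 1) * (C₂ * B₅) with hB₆
  have hB₆0 : 0 ≤ B₆ := by positivity
  refine ⟨B₆ + B₃ + C₀ + 2 / a₁, min (a₁ / 2) (1 / C₀), ?_, by positivity, fun ξ hξ hδ => ?_⟩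
  · have : 0 < 2 / a₁ := by positivity
    linarith
  have hr : 0 < ‖ξ‖ := norm_pos_iff.2 hξ
  have hlow := ha.lower ξ hξ hδ
  have hrθ : 0 < ‖ξ‖ ^ θ₀ := by positivity
  have hov := ha.overdamped ξ hξ hδ
  have hapos := ha.pos ξ hξ
  have hsa₀ : IsSymbolAt (n + 1) a ξ (C₀ * ‖ξ‖ ^ θ₀) := by
    refine ⟨ha.contDiffOn.contDiffAt (isOpen_compl_singleton.mem_nhds hξ), fun k hk => ?_⟩
    have h1 := ha.upper ξ hξ hδ k hk
    rw [Real.rpow_sub_natCast hr.ne'] at h1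
    calc ‖ξ‖ ^ k * ‖iteratedFDeriv ℝ k a ξ‖ ≤ ‖ξ‖ ^ k * (C₀ * (‖ξ‖ ^ θ₀ / ‖ξ‖ ^ k)) := by gcongr
      _ = _ := by field_simp
  have hup : a ξ ≤ C₀ * ‖ξ‖ ^ θ₀ := by
    simpa [abs_of_pos hapos] using hsa₀.norm_le
  have hsa : IsSymbolAt (n + 1) a ξ (B₁ * a ξ) := by
    refine hsa₀.mono ?_
    calc C₀ * ‖ξ‖ ^ θ₀ = C₀ / a₁ * (a₁ * ‖ξ‖ ^ θ₀) := by field_simp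
      _ ≤ B₁ * a ξ := by gcongr; exact le_max_right _ _
  -- In the overdamped region the discriminant is comparable to `a ^ 2`, hence away from zero.
  have hd : a ξ * a ξ ≤ 2 * (a ξ * a ξ - 4 * ‖ξ‖ ^ 2) := by nlinarith
  have hd' : a ξ * a ξ / 4 ≤ a ξ * a ξ - 4 * ‖ξ‖ ^ 2 := by nlinarith
  have hd0 : 0 < a ξ * a ξ - 4 * ‖ξ‖ ^ 2 := by nlinarith
  have hdisc : IsSymbolAt (n + 1) (fun y => a y * a y - 4 • (‖y‖ ^ 2)) ξ
      (B₂ * (a ξ * a ξ - 4 • (‖ξ‖ ^ 2))) := by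
    have h1 := (hsa.mul hsa).sub ((hsq ξ hξ).const_smul 4)
    refine (h1.mono ?_).congr (Filter.Eventually.of_forall fun y => by simp [nsmul_eq_mul])
    simp only [nsmul_eq_mul, Nat.cast_ofNat, abs_of_pos (four_pos (α := ℝ))]
    have h4 : 4 * ‖ξ‖ ^ 2 ≤ a ξ * a ξ := by nlinarith
    calc _ = 2 ^ (n + 1) * (B₁ * B₁) * (a ξ * a ξ) + C₂ * (4 * ‖ξ‖ ^ 2) := by ring
      _ ≤ 2 ^ (n + 1) * (B₁ * B₁) * (a ξ * a ξ) + C₂ * (a ξ * a ξ) := by gcongr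
      _ = (2 ^ (n + 1) * (B₁ * B₁) + C₂) * (a ξ * a ξ) := by ring
      _ ≤ (2 ^ (n + 1) * (B₁ * B₁) + C₂) * (2 * (a ξ * a ξ - 4 * ‖ξ‖ ^ 2)) := by gcongr
      _ = _ := by rw [hB₂]; ring
  have hgap := hsqrt _ ξ hξ (by simpa [nsmul_eq_mul] using hd0) hdisc
  change IsSymbolAt (n + 1) (rootGap a) ξ (B₃ * rootGap a ξ) at hgap
  have hs2 : rootGap a ξ ^ 2 = a ξ * a ξ - 4 * ‖ξ‖ ^ 2 := by
    rw [rootGap, nsmul_eq_mul]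
    exact Real.sq_sqrt (by simpa using hd0.le)
  have hs0 : 0 ≤ rootGap a ξ := Real.sqrt_nonneg _
  have hs_low : a ξ / 2 ≤ rootGap a ξ := by
    refine abs_le_of_sq_le_sq' ?_ hs0 |>.2
    rw [hs2]; linarith
  have hs_up : rootGap a ξ ≤ a ξ := by
    refine abs_le_of_sq_le_sq' ?_ hapos.le |>.2
    rw [hs2]; nlinarith
  have hsum : IsSymbolAt (n + 1) (fun y => a y + rootGap a y) ξ
      ((B₁ + B₃) * (a ξ + rootGap a ξ)) := by
    refine (hsa.add hgap).mono ?_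
    nlinarith
  have hsum_inv := hinv _ ξ hξ (by linarith) hsum
  have hslow : IsSymbolAt (n + 1) (slowRate a) ξ (B₆ * slowRate a ξ) := by
    have h1 := ((hsq ξ hξ).const_smul 2).mul hsum_inv
    refine (h1.mono (le_of_eq ?_)).congr (Filter.Eventually.of_forall fun y => ?_)
    · simp only [slowRate, nsmul_eq_mul, abs_of_pos (two_pos (α := ℝ)), hB₆, Nat.cast_ofNat]
      ring
    · simp [slowRate, nsmul_eq_mul]
  have hpow : ‖ξ‖ ^ (2 - θ₀) = ‖ξ‖ ^ 2 / ‖ξ‖ ^ θ₀ := by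
    rw [Real.rpow_sub hr]; norm_num
  have hslow_eq : slowRate a ξ = 2 * ‖ξ‖ ^ 2 / (a ξ + rootGap a ξ) := by
    rw [slowRate, nsmul_eq_mul, div_eq_mul_inv]; norm_num
  have hslow0 : 0 ≤ slowRate a ξ := by rw [hslow_eq]; positivity
  have h2a : 0 < 2 / a₁ := by positivity
  have hp2 : 0 < ‖ξ‖ ^ (2 - θ₀) := by positivity
  refine ⟨hslow.mono ?_, hgap.mono ?_, ?_, ?_, ?_, ?_⟩
  · gcongr; linarith
  · gcongr; linarith
  · calc _ ≤ a₁ / 2 * ‖ξ‖ ^ θ₀ := by gcongr; exact min_le_left _ _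
      _ ≤ _ := by linarith
  · calc _ ≤ C₀ * ‖ξ‖ ^ θ₀ := hs_up.trans hup
      _ ≤ _ := by gcongr; linarith
  · calc _ ≤ 1 / C₀ * ‖ξ‖ ^ (2 - θ₀) := by gcongr; exact min_le_right _ _
      _ = 2 * ‖ξ‖ ^ 2 / (2 * (C₀ * ‖ξ‖ ^ θ₀)) := by rw [hpow]; field_simp
      _ ≤ _ := by
        rw [hslow_eq]
        gcongr
        linarith
  · calc _ ≤ 2 * ‖ξ‖ ^ 2 / (a₁ * ‖ξ‖ ^ θ₀) := by
          rw [hslow_eq]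
          gcongr
          linarith
      _ = 2 / a₁ * ‖ξ‖ ^ (2 - θ₀) := by rw [hpow]; field_simp
      _ ≤ _ := by gcongr; linarith

end Oscillator

/-! ### Symbol bounds for the localized multiplier -/

section LowFrequencySymbol

variable {n : ℕ} {a χ : EuclideanSpace ℝ (Fin n) → ℝ} {θ₀ a₁ C₀ δ : ℝ}

/-- The Fourier multiplier `K̂(t,ξ) φ₀(ξ)`. -/
noncomputable def lowFrequencySymbol (a χ : EuclideanSpace ℝ (Fin n) → ℝ) (δ t : ℝ)
    (ξ : EuclideanSpace ℝ (Fin n)) : ℝ :=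
  fundamentalSymbol a t ξ * χ ((2 / δ) • ξ)

/-- The two factors of the multiplier, `exp (-t λ)` with the slow rate `λ ~ |ξ|^(2-θ₀)` and the
quotient at `t` times the gap `~ |ξ|^θ₀`, together with the smallness of their distance to `1`. -/
lemma exists_isSymbolAt_factors (ha : IsOverdampedSymbol n a θ₀ a₁ C₀ δ) (hχ : IsCutoff χ) :
    ∃ A c, 1 ≤ A ∧ 0 < c ∧ ∀ t, 0 ≤ t → ∀ ξ, ξ ≠ 0 → ‖ξ‖ ≤ δ →
      IsSymbolAt (n + 1) (fun y => Real.exp (-(t * slowRate a y))) ξ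
        (A * Real.exp (-(c * t * ‖ξ‖ ^ (2 - θ₀)))) ∧
      IsSymbolAt (n + 1) (fun y => Real.exp (-(t * slowRate a y)) - 1) ξ
        (A * (t * ‖ξ‖ ^ (2 - θ₀))) ∧
      IsSymbolAt (n + 1) (fun y => expQuotient (t * rootGap a y)) ξ A ∧
      IsSymbolAt (n + 1) (fun y => t * expQuotient (t * rootGap a y)) ξ
        (A * min t (‖ξ‖ ^ (-θ₀))) ∧
      IsSymbolAt (n + 1) (fun y => expQuotient (t * rootGap a y) - 1) ξ (A * (t * ‖ξ‖ ^ θ₀)) := by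
  obtain ⟨C, c, hC, hc, hroots⟩ := exists_isSymbolAt_roots ha hχ
  obtain ⟨A₁, hA₁, he⟩ := exists_isSymbolAt_exp (n + 1)
  obtain ⟨A₂, hA₂, he1⟩ := exists_isSymbolAt_exp_sub_one (n + 1)
  obtain ⟨A₃, hA₃, hq⟩ := exists_isSymbolAt_expQuotient (n + 1)
  set D : ℝ := (n + 1).factorial * C ^ (n + 1) with hD
  have hD1 : 1 ≤ D := by
    have h1 : (1 : ℝ) ≤ (n + 1).factorial := by
      exact_mod_cast (n + 1).factorial_pos
    have h2 : 1 ≤ C ^ (n + 1) := one_le_pow₀ hC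
    nlinarith
  set A := 1 + D * A₁ + D * (A₂ * C) + D * A₃ + D * (A₃ * c⁻¹) + D * (A₃ * C) with hA
  have p1 : 0 ≤ D * A₁ := by positivity
  have p2 : 0 ≤ D * (A₂ * C) := by positivity
  have p3 : 0 ≤ D * A₃ := by positivity
  have p4 : 0 ≤ D * (A₃ * c⁻¹) := by positivity
  have p5 : 0 ≤ D * (A₃ * C) := by positivity
  refine ⟨A, c / 2, by linarith, by positivity, fun t ht ξ hξ hδ => ?_⟩
  obtain ⟨hl, hs, hs1, hs2, hl1, hl2⟩ := hroots ξ hξ hδ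
  have hr : 0 < ‖ξ‖ := norm_pos_iff.2 hξ
  have hrθ : 0 < ‖ξ‖ ^ θ₀ := by positivity
  have hrl : 0 < ‖ξ‖ ^ (2 - θ₀) := by positivity
  have hs0 : 0 < rootGap a ξ := lt_of_lt_of_le (by positivity) hs1
  have hl0 : 0 < slowRate a ξ := lt_of_lt_of_le (by positivity) hl1
  have hE : IsSymbolAt (n + 1) (fun y => Real.exp (-(t * slowRate a y))) ξ
      (D * (A₁ * Real.exp (-(t * slowRate a ξ / 2)))) :=
    hl.comp_of_pos (g := fun y => Real.exp (-(t * y))) hξ hC hl0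
      ((he (t * slowRate a ξ) (by positivity)).congr
        (Filter.Eventually.of_forall fun u => by simp [mul_assoc]))
  have hE1 : IsSymbolAt (n + 1) (fun y => Real.exp (-(t * slowRate a y)) - 1) ξ
      (D * (A₂ * min 1 (t * slowRate a ξ))) :=
    hl.comp_of_pos (g := fun y => Real.exp (-(t * y)) - 1) hξ hC hl0
      ((he1 (t * slowRate a ξ) (by positivity)).congr
        (Filter.Eventually.of_forall fun u => by simp [mul_assoc]))
  obtain ⟨hq1, hq2, hq3⟩ := hq (t * rootGap a ξ) (by positivity)
  have hQ1 : IsSymbolAt (n + 1) (fun y => expQuotient (t * rootGap a y)) ξ (D * A₃) :=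
    hs.comp_of_pos (g := fun y => expQuotient (t * y)) hξ hC hs0
      (hq1.congr (Filter.Eventually.of_forall fun u => by simp [mul_assoc]))
  have hQ3 : IsSymbolAt (n + 1) (fun y => expQuotient (t * rootGap a y) - 1) ξ
      (D * (A₃ * min 1 (t * rootGap a ξ))) :=
    hs.comp_of_pos (g := fun y => expQuotient (t * y) - 1) hξ hC hs0
      (hq3.congr (Filter.Eventually.of_forall fun u => by simp [mul_assoc]))
  refine ⟨hE.mono ?_, hE1.mono ?_, hQ1.mono (by linarith), ?_, hQ3.mono ?_⟩
  · rw [← mul_assoc]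
    gcongr
    · linarith
    · calc c / 2 * t * ‖ξ‖ ^ (2 - θ₀) = t * (c * ‖ξ‖ ^ (2 - θ₀)) / 2 := by ring
        _ ≤ _ := by gcongr
  · calc _ ≤ D * (A₂ * (t * (C * ‖ξ‖ ^ (2 - θ₀)))) := by
          gcongr
          exact (min_le_right _ _).trans (by gcongr)
      _ = D * (A₂ * C) * (t * ‖ξ‖ ^ (2 - θ₀)) := by ring
      _ ≤ _ := by gcongr; linarith
  · rcases ht.eq_or_lt with rfl | ht0
    · have h0 : (fun y => 0 * expQuotient (0 * rootGap a y)) =ᶠ[nhds ξ] 0 :=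
        Filter.Eventually.of_forall fun y => by simp
      exact IsSymbolAt.of_eventuallyEq_zero h0 (by positivity)
    have hQ2 : IsSymbolAt (n + 1) (fun y => expQuotient (t * rootGap a y)) ξ
        (D * (A₃ * (t * rootGap a ξ)⁻¹)) :=
      hs.comp_of_pos (g := fun y => expQuotient (t * y)) hξ hC hs0
        ((hq2 (by positivity)).congr (Filter.Eventually.of_forall fun u => by simp [mul_assoc]))
    rcases le_total t (‖ξ‖ ^ (-θ₀)) with h | h
    · rw [min_eq_left h]
      refine (hQ1.const_smul t).mono ?_
      rw [abs_of_nonneg ht, mul_comm]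
      gcongr
      linarith
    · rw [min_eq_right h]
      refine (hQ2.const_smul t).mono ?_
      rw [abs_of_nonneg ht]
      calc _ = D * (A₃ * (rootGap a ξ)⁻¹) := by field_simp
        _ ≤ D * (A₃ * (c * ‖ξ‖ ^ θ₀)⁻¹) := by gcongr
        _ = D * (A₃ * c⁻¹) * ‖ξ‖ ^ (-θ₀) := by rw [Real.rpow_neg hr.le, mul_inv]; ring
        _ ≤ _ := by gcongr; linarith
  · calc _ ≤ D * (A₃ * (t * (C * ‖ξ‖ ^ θ₀))) := by
          gcongr
          exact (min_le_right _ _).trans (by gcongr)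
      _ = D * (A₃ * C) * (t * ‖ξ‖ ^ θ₀) := by ring
      _ ≤ _ := by gcongr; linarith

/-- The cut-off at scale `δ / l` vanishes near every point with `δ < l‖ξ‖`. -/
lemma IsCutoff.eventuallyEq_zero (hχ : IsCutoff χ) (hδ : 0 < δ) {l : ℝ} (hl : 0 < l)
    {ξ : EuclideanSpace ℝ (Fin n)} (h : δ < l * ‖ξ‖) :
    (fun y => χ ((2 / δ * l) • y)) =ᶠ[nhds ξ] 0 := by
  have h2 : ∀ᶠ y in nhds ξ, δ < l * ‖y‖ :=
    ContinuousAt.eventually_lt (by fun_prop) (by fun_prop) h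
  filter_upwards [h2] with y hy
  refine hχ.eq_zero _ ?_
  rw [norm_smul, Real.norm_eq_abs, abs_of_pos (by positivity)]
  calc (2 : ℝ) = 2 / δ * δ := by field_simp
    _ ≤ 2 / δ * (l * ‖y‖) := by gcongr
    _ = _ := by ring

lemma IsCutoff.eventuallyEq_one (hχ : IsCutoff χ) (hδ : 0 < δ) {l : ℝ} (hl : 0 < l)
    {ξ : EuclideanSpace ℝ (Fin n)} (h : l * ‖ξ‖ < δ / 2) :
    (fun y => χ ((2 / δ * l) • y)) =ᶠ[nhds ξ] fun _ => 1 := by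
  have h2 : ∀ᶠ y in nhds ξ, l * ‖y‖ < δ / 2 :=
    ContinuousAt.eventually_lt (by fun_prop) (by fun_prop) h
  filter_upwards [h2] with y hy
  refine hχ.eq_one _ ?_
  rw [norm_smul, Real.norm_eq_abs, abs_of_pos (by positivity)]
  calc 2 / δ * l * ‖y‖ = 2 / δ * (l * ‖y‖) := by ring
    _ ≤ 2 / δ * (δ / 2) := by gcongr
    _ = 1 := by field_simp

/-- The multiplier is of size `min t |ξ|^(-θ₀) * exp (-c t |ξ|^(2-θ₀))` as a symbol, uniformly
in time. -/
lemma exists_isSymbolAt_lowFrequencySymbol (ha : IsOverdampedSymbol n a θ₀ a₁ C₀ δ)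
    (hχ : IsCutoff χ) :
    ∃ C c, 0 ≤ C ∧ 0 < c ∧ ∀ t, 0 ≤ t → ∀ ξ, ξ ≠ 0 →
      IsSymbolAt (n + 1) (lowFrequencySymbol a χ δ t) ξ
        (C * (min t (‖ξ‖ ^ (-θ₀)) * Real.exp (-(c * t * ‖ξ‖ ^ (2 - θ₀))))) := by
  obtain ⟨A, c, hA, hc, hfac⟩ := exists_isSymbolAt_factors ha hχ
  obtain ⟨D, hD, hcut⟩ := exists_isSymbolAt_dilation (n + 1) hχ.contDiff hχ.eq_zero
  refine ⟨2 ^ (n + 1) * (2 ^ (n + 1) * (A * A) * D), c, by positivity, hc, fun t ht ξ hξ => ?_⟩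
  have hr : 0 < ‖ξ‖ := norm_pos_iff.2 hξ
  rcases le_or_gt ‖ξ‖ δ with hδ | hδ
  · obtain ⟨h1, -, -, h2, -⟩ := hfac t ht ξ hξ hδ
    have h3 := (h1.mul h2).mul (hcut (2 / δ) ξ)
    refine (h3.mono (le_of_eq (by ring))).congr ?_
    filter_upwards [fundamentalSymbol_eventuallyEq ha hξ hδ t] with y hy
    rw [lowFrequencySymbol, hy]
    ring
  · refine IsSymbolAt.of_eventuallyEq_zero ?_ (by positivity)
    have := hχ.eventuallyEq_zero ha.δ_pos one_pos (by simpa using hδ)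
    filter_upwards [this] with y hy
    rw [lowFrequencySymbol]
    simp only [mul_one, Pi.zero_apply] at hy
    rw [hy]; simp

/-- After subtraction of `t` times a cut-off at the scale `|ξ| ~ (1 + t)^(-1/θ₀)`, the multiplier
gains a factor `(1 + t) |ξ|^θ₀` at very low frequencies. -/
lemma exists_isSymbolAt_lowFrequencySymbol_sub (ha : IsOverdampedSymbol n a θ₀ a₁ C₀ δ)
    (hχ : IsCutoff χ) (hθ₀ : 0 < θ₀) (hθ₁ : θ₀ < 1) :
    ∃ C, 0 ≤ C ∧ ∀ t, 0 ≤ t → ∀ ξ, ξ ≠ 0 →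
      IsSymbolAt (n + 1)
        (fun y => lowFrequencySymbol a χ δ t y - t * χ ((2 / δ * (1 + t) ^ (1 / θ₀)) • y)) ξ
        (C * min ((1 + t) ^ (2 : ℝ) * ‖ξ‖ ^ θ₀) (‖ξ‖ ^ (-θ₀))) := by
  have hδ0 := ha.δ_pos
  obtain ⟨A, c, hA, hc, hfac⟩ := exists_isSymbolAt_factors ha hχ
  obtain ⟨D, hD, hcut⟩ := exists_isSymbolAt_dilation (n + 1) hχ.contDiff hχ.eq_zero
  obtain ⟨C₁, c₁, hC₁, hc₁, hlow⟩ := exists_isSymbolAt_lowFrequencySymbol ha hχ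
  set P : ℝ := 2 ^ (n + 1) with hP
  have hP0 : 0 ≤ P := by positivity
  have hpow : ∀ (t : ℝ), 0 ≤ t → ((1 + t) ^ (1 / θ₀)) ^ θ₀ = 1 + t := fun t ht => by
    rw [← Real.rpow_mul (by positivity), one_div_mul_cancel hθ₀.ne', Real.rpow_one]
  set C₂ := P * (P * (A * δ ^ (2 - 2 * θ₀) * A) * D) + P * (A * D) + 2 * D * (2 / δ) ^ θ₀ with hC₂
  set C₃ := C₁ + D * δ ^ θ₀ with hC₃
  have hC₂0 : 0 ≤ C₂ := by positivity
  have hC₃0 : 0 ≤ C₃ := by positivity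
  refine ⟨C₂ + C₃, by positivity, fun t ht ξ hξ => ?_⟩
  have hr : 0 < ‖ξ‖ := norm_pos_iff.2 hξ
  have hrθ : 0 < ‖ξ‖ ^ θ₀ := by positivity
  set l := (1 + t) ^ (1 / θ₀) with hl
  have hl0 : 0 < l := by positivity
  have hl1 : 1 ≤ l := Real.one_le_rpow (by linarith) (by positivity)
  -- the bound by the negative power needs no cancellation
  have hbig : IsSymbolAt (n + 1)
      (fun y => lowFrequencySymbol a χ δ t y - t * χ ((2 / δ * l) • y)) ξ
        (C₃ * ‖ξ‖ ^ (-θ₀)) := by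
    have h2 : IsSymbolAt (n + 1) (fun y => t * χ ((2 / δ * l) • y)) ξ
        (D * δ ^ θ₀ * ‖ξ‖ ^ (-θ₀)) := by
      rcases le_or_gt (l * ‖ξ‖) δ with h | h
      · refine ((hcut (2 / δ * l) ξ).const_smul t).mono ?_
        rw [abs_of_nonneg ht]
        have h3 : (l * ‖ξ‖) ^ θ₀ ≤ δ ^ θ₀ := by gcongr
        rw [Real.mul_rpow hl0.le hr.le, hpow t ht] at h3
        have h4 : t ≤ δ ^ θ₀ * ‖ξ‖ ^ (-θ₀) := by
          rw [Real.rpow_neg hr.le, ← div_eq_mul_inv, le_div_iff₀ hrθ]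
          nlinarith
        nlinarith
      · refine IsSymbolAt.of_eventuallyEq_zero ?_ (by positivity)
        filter_upwards [hχ.eventuallyEq_zero hδ0 hl0 h] with y hy
        rw [hy]; simp
    refine ((hlow t ht ξ hξ).sub h2).mono ?_
    have h3 : Real.exp (-(c₁ * t * ‖ξ‖ ^ (2 - θ₀))) ≤ 1 :=
      Real.exp_le_one_iff.2 (by have : 0 ≤ c₁ * t * ‖ξ‖ ^ (2 - θ₀) := by positivity
                                linarith)
    have h4 : min t (‖ξ‖ ^ (-θ₀)) * Real.exp (-(c₁ * t * ‖ξ‖ ^ (2 - θ₀))) ≤ ‖ξ‖ ^ (-θ₀) * 1 := by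
      gcongr
      exact min_le_right _ _
    rw [hC₃, add_mul]
    gcongr
    simpa using h4
  have hsmall : IsSymbolAt (n + 1)
      (fun y => lowFrequencySymbol a χ δ t y - t * χ ((2 / δ * l) • y)) ξ
        (C₂ * ((1 + t) ^ (2 : ℝ) * ‖ξ‖ ^ θ₀)) := by
    have ht2 : t * t ≤ (1 + t) ^ (2 : ℝ) := by
      rw [Real.rpow_two]; nlinarith
    rcases le_or_gt ‖ξ‖ δ with hδ | hδ
    · obtain ⟨-, h1, h2, -, h3⟩ := hfac t ht ξ hξ hδ
      have hdec : ‖ξ‖ ^ (2 - θ₀) ≤ δ ^ (2 - 2 * θ₀) * ‖ξ‖ ^ θ₀ := by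
        have : ‖ξ‖ ^ (2 - θ₀) = ‖ξ‖ ^ (2 - 2 * θ₀) * ‖ξ‖ ^ θ₀ := by
          rw [← Real.rpow_add hr]; congr 1; ring
        rw [this]
        gcongr
        linarith
      have hc := hcut (2 / δ) ξ
      -- With `e` the exponential, `q` the quotient and `φ`, `φ'` the two cut-offs,
      -- `t e q φ - t φ' = t (e - 1) q φ + t (q - 1) φ + t (φ - φ')`.
      have t1 := ((h1.mul h2).mul hc).const_smul t
      have t2 := (h3.mul hc).const_smul t
      have t3 : IsSymbolAt (n + 1) (fun y => t * (χ ((2 / δ) • y) - χ ((2 / δ * l) • y))) ξ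
          (2 * D * (2 / δ) ^ θ₀ * ((1 + t) ^ (2 : ℝ) * ‖ξ‖ ^ θ₀)) := by
        rcases lt_or_ge (l * ‖ξ‖) (δ / 2) with h | h
        · refine IsSymbolAt.of_eventuallyEq_zero ?_ (by positivity)
          filter_upwards [hχ.eventuallyEq_one hδ0 hl0 h, hχ.eventuallyEq_one hδ0 one_pos
            (ξ := ξ) (by nlinarith)] with y hy hy'
          rw [mul_one] at hy'
          rw [hy, hy']; simp
        · refine ((hc.sub (hcut (2 / δ * l) ξ)).const_smul t).mono ?_
          rw [abs_of_nonneg ht]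
          have h4 : 1 ≤ (2 / δ * (l * ‖ξ‖)) ^ θ₀ := by
            refine Real.one_le_rpow ?_ hθ₀.le
            calc (1 : ℝ) = 2 / δ * (δ / 2) := by field_simp
              _ ≤ _ := by gcongr
          rw [Real.mul_rpow (by positivity) (by positivity), Real.mul_rpow hl0.le hr.le,
            hpow t ht] at h4
          have h5 : t * 1 ≤ (1 + t) * ((2 / δ) ^ θ₀ * ((1 + t) * ‖ξ‖ ^ θ₀)) := by
            gcongr
            linarith
          calc t * (D + D) = 2 * D * (t * 1) := by ring
            _ ≤ 2 * D * ((1 + t) * ((2 / δ) ^ θ₀ * ((1 + t) * ‖ξ‖ ^ θ₀))) := by gcongr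
            _ = _ := by rw [Real.rpow_two]; ring
      refine (((t1.add t2).add t3).mono ?_).congr ?_
      · rw [abs_of_nonneg ht, hC₂, add_mul, add_mul]
        gcongr ?_ + ?_ + _
        · calc _ = P * (P * (A * ‖ξ‖ ^ (2 - θ₀) * A) * D) * (t * t) := by ring
            _ ≤ P * (P * (A * (δ ^ (2 - 2 * θ₀) * ‖ξ‖ ^ θ₀) * A) * D) * (1 + t) ^ (2 : ℝ) := by
                gcongr
            _ = _ := by ring
        · calc _ = P * (A * D) * (t * t * ‖ξ‖ ^ θ₀) := by ring
            _ ≤ _ := by gcongr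
      · filter_upwards [fundamentalSymbol_eventuallyEq ha hξ hδ t] with y hy
        rw [lowFrequencySymbol, hy]
        simp only [smul_eq_mul]
        ring
    · refine IsSymbolAt.of_eventuallyEq_zero ?_ (by positivity)
      filter_upwards [hχ.eventuallyEq_zero hδ0 one_pos (by simpa using hδ),
        hχ.eventuallyEq_zero hδ0 hl0 (ξ := ξ) (by nlinarith)] with y hy hy'
      rw [mul_one] at hy
      rw [lowFrequencySymbol, hy, hy']; simp
  rw [mul_min_of_nonneg _ _ (by positivity)]
  rcases le_total ((C₂ + C₃) * ((1 + t) ^ (2 : ℝ) * ‖ξ‖ ^ θ₀)) ((C₂ + C₃) * ‖ξ‖ ^ (-θ₀)) with h | h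
  · rw [min_eq_left h]
    refine hsmall.mono ?_
    gcongr; linarith
  · rw [min_eq_right h]
    refine hbig.mono ?_
    gcongr; linarith

end LowFrequencySymbol

/-! ### Kernels of multipliers localized at one frequency scale -/

section LocalizedSymbol

variable {E F : Type*} [NormedAddCommGroup E] [NormedSpace ℝ E] [NormedAddCommGroup F]
  [NormedSpace ℝ F]

/-- A function adapted to the ball of radius `2 R`: it vanishes outside that ball, and each of its
first `N` derivatives costs a factor `R⁻¹`. -/
structure IsLocalizedSymbol (N : ℕ) (g : E → F) (R A : ℝ) : Prop where
  contDiff : ContDiff ℝ N g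
  bound : ∀ k ≤ N, ∀ ξ, ‖iteratedFDeriv ℝ k g ξ‖ ≤ A * (R ^ k)⁻¹
  eq_zero : ∀ ξ, 2 * R < ‖ξ‖ → g ξ = 0

namespace IsLocalizedSymbol

variable {N : ℕ} {g : E → F} {R A : ℝ}

lemma nonneg (h : IsLocalizedSymbol N g R A) : 0 ≤ A := by
  simpa using (norm_nonneg _).trans (h.bound 0 (Nat.zero_le _) 0)

lemma eventuallyEq_zero (h : IsLocalizedSymbol N g R A) {ξ : E} (hξ : 2 * R < ‖ξ‖) :
    g =ᶠ[nhds ξ] 0 := by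
  have h2 : ∀ᶠ y in nhds ξ, 2 * R < ‖y‖ :=
    ContinuousAt.eventually_lt (by fun_prop) (by fun_prop) hξ
  filter_upwards [h2] with y hy using h.eq_zero y hy

lemma iteratedFDeriv_eq_zero (h : IsLocalizedSymbol N g R A) {ξ : E} (hξ : 2 * R < ‖ξ‖) (k : ℕ) :
    iteratedFDeriv ℝ k g ξ = 0 := by
  rw [((h.eventuallyEq_zero hξ).iteratedFDeriv ℝ k).eq_of_nhds, Pi.zero_def,
    iteratedFDeriv_fun_zero]
  rfl

lemma hasCompactSupport [FiniteDimensional ℝ E] (h : IsLocalizedSymbol N g R A) :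
    HasCompactSupport g :=
  HasCompactSupport.intro (isCompact_closedBall (0 : E) (2 * R)) fun ξ hξ =>
    h.eq_zero ξ (by simpa using hξ)

lemma ofReal {g : E → ℝ} (h : IsLocalizedSymbol N g R A) :
    IsLocalizedSymbol N (fun ξ => (g ξ : ℂ)) R A := by
  refine ⟨Complex.ofRealCLM.contDiff.comp h.contDiff, fun k hk ξ => ?_, fun ξ hξ => by
    simp [h.eq_zero ξ hξ]⟩
  have := Complex.ofRealLI.norm_iteratedFDeriv_comp_left (f := g) (x := ξ) (i := k)
    h.contDiff.contDiffAt (by exact_mod_cast hk)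
  refine (le_of_eq this).trans (h.bound k hk ξ)

lemma const_mul {g : E → ℝ} (h : IsLocalizedSymbol N g R A) (c : ℝ) :
    IsLocalizedSymbol N (fun ξ => c * g ξ) R (|c| * A) := by
  refine ⟨contDiff_const.mul h.contDiff, fun k hk ξ => ?_, fun ξ hξ => by
    simp [h.eq_zero ξ hξ]⟩
  have h1 : ContDiffAt ℝ k g ξ := h.contDiff.contDiffAt.of_le (by exact_mod_cast hk)
  have : iteratedFDeriv ℝ k (c • g) ξ = c • iteratedFDeriv ℝ k g ξ :=
    iteratedFDeriv_const_smul_apply h1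
  have e : (fun ξ => c * g ξ) = c • g := rfl
  rw [e, this, norm_smul, Real.norm_eq_abs, mul_assoc]
  exact mul_le_mul_of_nonneg_left (h.bound k hk ξ) (abs_nonneg _)

end IsLocalizedSymbol

/-- The part of the multiplier `m` at frequencies `R / 2 ≤ |ξ| ≤ 2 R`, cut out by the difference of
two dilates of `χ`. -/
noncomputable def dyadicPiece (χ m : E → ℝ) (R : ℝ) (ξ : E) : ℝ :=
  (χ (R⁻¹ • ξ) - χ ((2 * R⁻¹) • ξ)) * m ξ

end LocalizedSymbol

section Dyadic

variable {n : ℕ} {χ : EuclideanSpace ℝ (Fin n) → ℝ}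

lemma exists_isLocalizedSymbol_dyadicPiece (N : ℕ) (hχ : IsCutoff χ) :
    ∃ C, 0 ≤ C ∧ ∀ (m : EuclideanSpace ℝ (Fin n) → ℝ) (R W : ℝ), 0 < R → 0 ≤ W →
      (∀ ξ, R / 2 ≤ ‖ξ‖ → ‖ξ‖ ≤ 2 * R → IsSymbolAt N m ξ W) →
      IsLocalizedSymbol N (dyadicPiece χ m R) R (C * W) := by
  obtain ⟨D, hD, hcut⟩ := exists_isSymbolAt_dilation N hχ.contDiff hχ.eq_zero
  refine ⟨2 ^ N * (2 ^ N * ((D + D) * 1)), by positivity, fun m R W hR hW hm => ?_⟩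
  have hfar : ∀ ξ, 2 * R < ‖ξ‖ → dyadicPiece χ m R ξ = 0 := fun ξ hξ => by
    have h1 : 2 ≤ ‖R⁻¹ • ξ‖ := by
      rw [norm_smul, norm_inv, Real.norm_eq_abs, abs_of_pos hR, le_inv_mul_iff₀ hR]
      linarith
    have h2 : 2 ≤ ‖(2 * R⁻¹) • ξ‖ := by
      rw [mul_smul, norm_smul]
      norm_num
      linarith
    rw [dyadicPiece, hχ.eq_zero _ h1, hχ.eq_zero _ h2]
    simp
  have hnear : ∀ ξ, ‖ξ‖ < R / 2 → dyadicPiece χ m R ξ = 0 := fun ξ hξ => by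
    have h1 : ‖(2 * R⁻¹) • ξ‖ ≤ 1 := by
      rw [norm_smul, norm_mul, norm_inv, Real.norm_eq_abs, Real.norm_eq_abs, abs_of_pos hR,
        abs_two, mul_comm 2, mul_assoc, inv_mul_le_iff₀ hR]
      linarith
    have h2 : ‖R⁻¹ • ξ‖ ≤ 1 := by
      rw [mul_smul, norm_smul] at h1
      norm_num at h1
      linarith [norm_nonneg (R⁻¹ • ξ)]
    rw [dyadicPiece, hχ.eq_one _ h1, hχ.eq_one _ h2]
    simp
  have hev : ∀ ξ, ¬ (R / 2 ≤ ‖ξ‖ ∧ ‖ξ‖ ≤ 2 * R) → dyadicPiece χ m R =ᶠ[nhds ξ] 0 := by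
    intro ξ hξ
    rcases lt_or_ge ‖ξ‖ (R / 2) with h | h
    · have h2 : ∀ᶠ y in nhds ξ, ‖y‖ < R / 2 :=
        ContinuousAt.eventually_lt (by fun_prop) (by fun_prop) h
      filter_upwards [h2] with y hy using hnear y hy
    · have h2 : ∀ᶠ y in nhds ξ, 2 * R < ‖y‖ :=
        ContinuousAt.eventually_lt (by fun_prop) (by fun_prop) (by
          by_contra h'; exact hξ ⟨h, not_lt.1 h'⟩)
      filter_upwards [h2] with y hy using hfar y hy
  have hall : ∀ ξ, IsSymbolAt N (dyadicPiece χ m R) ξ (2 ^ N * ((D + D) * W)) := by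
    intro ξ
    by_cases h : R / 2 ≤ ‖ξ‖ ∧ ‖ξ‖ ≤ 2 * R
    · exact ((hcut R⁻¹ ξ).sub (hcut (2 * R⁻¹) ξ)).mul (hm ξ h.1 h.2)
    · exact IsSymbolAt.of_eventuallyEq_zero (hev ξ h) (by positivity)
  refine ⟨contDiff_iff_contDiffAt.2 fun ξ => (hall ξ).contDiffAt, fun k hk ξ => ?_, hfar⟩
  by_cases h : R / 2 ≤ ‖ξ‖ ∧ ‖ξ‖ ≤ 2 * R
  · have h1 := (hall ξ).bound k hk
    have h2 : (R / 2) ^ k ≤ ‖ξ‖ ^ k := by gcongr; exact h.1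
    have h3 : (R / 2) ^ k * ‖iteratedFDeriv ℝ k (dyadicPiece χ m R) ξ‖
        ≤ 2 ^ N * ((D + D) * W) := le_trans (by gcongr) h1
    have h4 : (2 : ℝ) ^ k ≤ 2 ^ N := pow_le_pow_right₀ (by norm_num) hk
    rw [← le_div_iff₀' (by positivity)] at h3
    refine h3.trans ?_
    calc 2 ^ N * ((D + D) * W) / (R / 2) ^ k = 2 ^ k * (2 ^ N * ((D + D) * W)) * (R ^ k)⁻¹ := by
          rw [div_pow]; field_simp
      _ ≤ 2 ^ N * (2 ^ N * ((D + D) * W)) * (R ^ k)⁻¹ := by gcongr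
      _ = _ := by ring
  · rw [((hev ξ h).iteratedFDeriv ℝ k).eq_of_nhds, Pi.zero_def, iteratedFDeriv_fun_zero]
    simp only [Pi.zero_apply, norm_zero]
    positivity

/-- The dyadic pieces at the scales `δ 2^(-j)` telescope. -/
lemma sum_dyadicPiece (m : EuclideanSpace ℝ (Fin n) → ℝ) (δ : ℝ) (N : ℕ)
    (ξ : EuclideanSpace ℝ (Fin n)) :
    ∑ j ∈ Finset.range N, dyadicPiece χ m (δ * (1 / 2) ^ j) ξ =
      (χ (δ⁻¹ • ξ) - χ ((δ * (1 / 2) ^ N)⁻¹ • ξ)) * m ξ := by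
  have h : ∀ j : ℕ, 2 * (δ * (1 / 2 : ℝ) ^ j)⁻¹ = (δ * (1 / 2) ^ (j + 1))⁻¹ := fun j => by
    rw [pow_succ, mul_inv, mul_inv, mul_inv]; ring
  simp only [dyadicPiece, h]
  rw [← Finset.sum_mul, Finset.sum_range_sub' (fun j => χ ((δ * (1 / 2 : ℝ) ^ j)⁻¹ • ξ))]
  simp

lemma exists_isLocalizedSymbol_cutoff (N : ℕ) (hχ : IsCutoff χ) :
    ∃ C, 0 ≤ C ∧ ∀ R, 0 < R →
      IsLocalizedSymbol N (fun ξ => χ (R⁻¹ • ξ)) R C := by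
  have hb : ∀ k : ℕ, ∃ C, ∀ ξ, ‖iteratedFDeriv ℝ k χ ξ‖ ≤ C := by
    intro k
    have : HasCompactSupport χ := HasCompactSupport.intro
      (isCompact_closedBall (0 : EuclideanSpace ℝ (Fin n)) 2)
        fun x hx => hχ.eq_zero x (by simpa using (not_le.1 (by simpa using hx)).le)
    have hc : Continuous (iteratedFDeriv ℝ k χ) :=
      hχ.contDiff.continuous_iteratedFDeriv (m := k) (by exact_mod_cast le_top)
    obtain ⟨C, hC⟩ := hc.norm.bounded_above_of_compact_support (this.iteratedFDeriv k).norm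
    exact ⟨C, fun ξ => by simpa using hC ξ⟩
  choose C hC using hb
  have hC0 : ∀ k, 0 ≤ C k := fun k => (norm_nonneg _).trans (hC k 0)
  refine ⟨∑ k ∈ Finset.range (N + 1), C k, Finset.sum_nonneg fun k _ => hC0 k, fun R hR => ?_⟩
  have hχN : ∀ k : ℕ, ContDiff ℝ k χ := fun k => hχ.contDiff.of_le (by exact_mod_cast le_top)
  refine ⟨(hχN N).comp (contDiff_const_smul _), fun k hk ξ => ?_, fun ξ hξ => hχ.eq_zero _ ?_⟩
  · rw [iteratedFDeriv_comp_const_smul _ (hχN k)]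
    have h2 : C k ≤ ∑ k ∈ Finset.range (N + 1), C k :=
      Finset.single_le_sum (fun i _ => hC0 i) (Finset.mem_range.2 (by omega))
    simp only [norm_smul, norm_pow, norm_inv, Real.norm_eq_abs, abs_of_pos hR]
    rw [mul_comm, inv_pow]
    gcongr
    exact (hC k _).trans h2
  · rw [norm_smul, norm_inv, Real.norm_eq_abs, abs_of_pos hR, le_inv_mul_iff₀ hR]
    linarith

end Dyadic

section Modulation

variable {E : Type*} [NormedAddCommGroup E] [InnerProductSpace ℝ E]

lemma norm_iteratedFDeriv_cexp_inner_le (y ξ : E) (k : ℕ) :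
    ‖iteratedFDeriv ℝ k (fun ξ : E => Complex.exp (Complex.I * (⟪y, ξ⟫ : ℝ))) ξ‖
      ≤ k.factorial * ‖y‖ ^ k := by
  have he : ContDiff ℝ k (fun t : ℝ => Complex.exp (Complex.I * t)) := by
    have := Complex.ofRealCLM.contDiff (n := k)
    exact (contDiff_const.mul this).cexp
  have hd : ∀ i : ℕ, iteratedDeriv i (fun t : ℝ => Complex.exp (Complex.I * t)) =
      fun t : ℝ => Complex.I ^ i * Complex.exp (Complex.I * t) := by
    intro i
    induction i with
    | zero => simp
    | succ i ih =>
      rw [iteratedDeriv_succ, ih]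
      funext t
      have h1 : HasDerivAt (fun t : ℝ => Complex.exp (Complex.I * t))
          (Complex.exp (Complex.I * t) * Complex.I) t := by
        have := ((hasDerivAt_id (t : ℂ)).const_mul Complex.I).cexp.comp_ofReal
        simpa using this
      rw [(h1.const_mul (Complex.I ^ i)).deriv]
      ring
  have hl : ContDiff ℝ k (fun ξ : E => (⟪y, ξ⟫ : ℝ)) :=
    (innerSL ℝ y).contDiff
  have := norm_iteratedFDeriv_comp_le (g := fun t : ℝ => Complex.exp (Complex.I * t))
    (f := fun ξ : E => (⟪y, ξ⟫ : ℝ)) he hl le_rfl ξ (C := 1) (D := ‖y‖)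
    (fun i _ => by
      rw [norm_iteratedFDeriv_eq_norm_iteratedDeriv, hd]
      rw [norm_mul, norm_pow, Complex.norm_I, one_pow, one_mul, mul_comm,
        Complex.norm_exp_ofReal_mul_I])
    (fun i hi _ => by
      have e : (fun ξ : E => (⟪y, ξ⟫ : ℝ)) = innerSL ℝ y := rfl
      rcases hi.eq_or_lt with rfl | hi
      · rw [norm_iteratedFDeriv_one, e, ContinuousLinearMap.fderiv, innerSL_apply_norm, pow_one]
      · obtain ⟨j, rfl⟩ : ∃ j, i = j + 1 := ⟨i - 1, by omega⟩
        have hc : fderiv ℝ (innerSL ℝ y) = fun _ => innerSL ℝ y :=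
          funext fun z => ContinuousLinearMap.fderiv _
        rw [e, ← norm_iteratedFDeriv_fderiv, hc,
          iteratedFDeriv_const_of_ne (𝕜 := ℝ) (by omega : j ≠ 0)]
        simp)
  simpa [Function.comp_def] using this

/-- Multiplication by `e^{i y·ξ} - 1`, which translates the kernel by `y` and subtracts it, gains a
factor `R‖y‖` when `R‖y‖ ≤ 1`. -/
lemma IsLocalizedSymbol.cexp_sub_one_mul {N : ℕ} {g : E → ℂ} {R A : ℝ}
    (h : IsLocalizedSymbol N g R A) (hR : 0 < R) {y : E} (hy : R * ‖y‖ ≤ 1) :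
    IsLocalizedSymbol N (fun ξ => (Complex.exp (Complex.I * (⟪y, ξ⟫ : ℝ)) - 1) * g ξ) R
      (2 ^ N * (2 * N.factorial) * A * (R * ‖y‖)) := by
  have hA := h.nonneg
  have hcd : ContDiff ℝ N (fun ξ : E => Complex.exp (Complex.I * (⟪y, ξ⟫ : ℝ)) - 1) := by
    have h1 := Complex.ofRealCLM.contDiff (n := N) (𝕜 := ℝ)
    have h2 : ContDiff ℝ N (fun ξ : E => (⟪y, ξ⟫ : ℝ)) :=
      (innerSL ℝ y).contDiff
    exact ((contDiff_const.mul (h1.comp h2)).cexp).sub contDiff_const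
  have hz : ∀ ξ, 2 * R < ‖ξ‖ → (Complex.exp (Complex.I * (⟪y, ξ⟫ : ℝ)) - 1) * g ξ = 0 :=
    fun ξ hξ => by rw [h.eq_zero ξ hξ, mul_zero]
  refine ⟨hcd.mul h.contDiff, fun k hk ξ => ?_, hz⟩
  rcases lt_or_ge (2 * R) ‖ξ‖ with hξ | hξ
  · have h0 : (fun ξ => (Complex.exp (Complex.I * (⟪y, ξ⟫ : ℝ)) - 1) * g ξ) =ᶠ[nhds ξ]
        fun _ => 0 := by
      filter_upwards [h.eventuallyEq_zero hξ] with z hz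
      rw [hz, Pi.zero_apply, mul_zero]
    rw [(h0.iteratedFDeriv ℝ k).eq_of_nhds, iteratedFDeriv_fun_zero]
    simp only [Pi.zero_apply, norm_zero]
    positivity
  have hk' : (k : WithTop ℕ∞) ≤ N := by exact_mod_cast hk
  have hexp : ∀ i ≤ k, ‖iteratedFDeriv ℝ i
      (fun ξ : E => Complex.exp (Complex.I * (⟪y, ξ⟫ : ℝ)) - 1) ξ‖ ≤
        2 * N.factorial * (R * ‖y‖) * (R ^ i)⁻¹ := by
    intro i hi
    have hfac : (1 : ℝ) ≤ N.factorial := by exact_mod_cast N.factorial_pos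
    rcases Nat.eq_zero_or_pos i with rfl | hi0
    · rw [norm_iteratedFDeriv_zero, pow_zero, inv_one, mul_one]
      have h1 := Real.norm_exp_I_mul_ofReal_sub_one_le (x := ⟪y, ξ⟫)
      refine h1.trans ?_
      calc ‖(⟪y, ξ⟫ : ℝ)‖ ≤ ‖y‖ * ‖ξ‖ := norm_inner_le_norm y ξ
        _ ≤ ‖y‖ * (2 * R) := by gcongr
        _ = 2 * 1 * (R * ‖y‖) := by ring
        _ ≤ _ := by gcongr
    · have he : ContDiff ℝ N (fun ξ : E => Complex.exp (Complex.I * (⟪y, ξ⟫ : ℝ))) := by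
        simpa using! hcd.add (contDiff_const (c := (1 : ℂ)))
      have h2 : iteratedFDeriv ℝ i
          (fun ξ : E => Complex.exp (Complex.I * (⟪y, ξ⟫ : ℝ)) - 1) ξ =
          iteratedFDeriv ℝ i (fun ξ : E => Complex.exp (Complex.I * (⟪y, ξ⟫ : ℝ))) ξ := by
        have := iteratedFDeriv_sub_apply (i := i) (x := ξ) (𝕜 := ℝ)
          (f := fun ξ : E => Complex.exp (Complex.I * (⟪y, ξ⟫ : ℝ))) (g := fun _ : E => (1 : ℂ))
          (he.contDiffAt.of_le (by exact_mod_cast hi.trans hk)) contDiffAt_const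
        simp only [iteratedFDeriv_const_of_ne (𝕜 := ℝ) hi0.ne' (1 : ℂ), Pi.zero_apply,
          sub_zero] at this
        exact this
      rw [h2]
      refine (norm_iteratedFDeriv_cexp_inner_le y ξ i).trans ?_
      have h3 : (R * ‖y‖) ^ i ≤ R * ‖y‖ :=
        pow_le_of_le_one (by positivity) hy (by omega)
      have h4 : (i.factorial : ℝ) ≤ N.factorial := by
        exact_mod_cast Nat.factorial_le (hi.trans hk)
      calc (i.factorial : ℝ) * ‖y‖ ^ i = i.factorial * (R * ‖y‖) ^ i * (R ^ i)⁻¹ := by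
            rw [mul_pow]; field_simp
        _ ≤ (2 * N.factorial) * (R * ‖y‖) * (R ^ i)⁻¹ := by
            gcongr
            linarith
  refine (norm_iteratedFDeriv_mul_le hcd h.contDiff ξ hk').trans ?_
  calc _ ≤ ∑ i ∈ Finset.range (k + 1), (k.choose i : ℝ) *
        (2 * N.factorial * (R * ‖y‖) * A * (R ^ k)⁻¹) := by
        refine Finset.sum_le_sum fun i hi => ?_
        have hi : i ≤ k := Nat.lt_succ_iff.1 (Finset.mem_range.1 hi)
        have e : (R ^ k)⁻¹ = (R ^ i)⁻¹ * (R ^ (k - i))⁻¹ := by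
          rw [← mul_inv, ← pow_add, Nat.add_sub_cancel' hi]
        rw [mul_assoc]
        refine mul_le_mul_of_nonneg_left ?_ (Nat.cast_nonneg _)
        rw [e]
        calc _ ≤ (2 * N.factorial * (R * ‖y‖) * (R ^ i)⁻¹) * (A * (R ^ (k - i))⁻¹) := by
              gcongr
              · exact hexp i hi
              · exact h.bound _ (by omega) ξ
          _ = _ := by ring
    _ = 2 ^ k * (2 * N.factorial * (R * ‖y‖) * A * (R ^ k)⁻¹) := by
        rw [← Finset.sum_mul]
        congr 1
        exact_mod_cast Nat.sum_range_choose k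
    _ ≤ 2 ^ N * (2 * N.factorial * (R * ‖y‖) * A * (R ^ k)⁻¹) := by
        gcongr
        norm_num
    _ = _ := by ring

end Modulation

section Bernstein

open FourierTransform

variable {n : ℕ}

lemma inverseFourier_eq_fourier (g : EuclideanSpace ℝ (Fin n) → ℂ) (x : EuclideanSpace ℝ (Fin n)) :
    inverseFourier g x = (((2 * Real.pi) ^ n)⁻¹ : ℝ) * 𝓕 g (-(2 * Real.pi)⁻¹ • x) := by
  rw [inverseFourier, Real.fourier_eq']
  congr 2
  funext ξ
  rw [smul_eq_mul]
  congr 2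
  rw [inner_smul_right, real_inner_comm]
  have hpi : (Real.pi : ℂ) ≠ 0 := by exact_mod_cast Real.pi_ne_zero
  push_cast
  field_simp

lemma continuous_inverseFourier {g : EuclideanSpace ℝ (Fin n) → ℂ} (hg : Integrable g) :
    Continuous (inverseFourier g) := by
  have h1 : Continuous (𝓕 g) :=
    VectorFourier.fourierIntegral_continuous Real.continuous_fourierChar continuous_inner hg
  have e : inverseFourier g =
      fun x => (((2 * Real.pi) ^ n)⁻¹ : ℝ) * 𝓕 g (-(2 * Real.pi)⁻¹ • x) :=
    funext (inverseFourier_eq_fourier g)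
  rw [e]
  exact continuous_const.mul (h1.comp (continuous_const_smul _))

lemma pow_mul_norm_fourier_le {E : Type*} [NormedAddCommGroup E] [InnerProductSpace ℝ E]
    [FiniteDimensional ℝ E] [MeasurableSpace E] [BorelSpace E] {N : ℕ} {g : E → ℂ}
    (hg : ContDiff ℝ N g) (hs : HasCompactSupport g) (w : E) :
    (2 * Real.pi * ‖w‖) ^ N * ‖𝓕 g w‖ ≤ ∫ ξ, ‖iteratedFDeriv ℝ N g ξ‖ := by
  have hint : ∀ k : ℕ, (k : ℕ∞) ≤ N → Integrable (iteratedFDeriv ℝ k g) := fun k hk =>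
    (hg.continuous_iteratedFDeriv (by exact_mod_cast hk)).integrable_of_hasCompactSupport
      (hs.iteratedFDeriv k)
  have h1 := congrFun (Real.fourier_iteratedFDeriv (N := (N : ℕ∞)) (by exact_mod_cast hg) hint
    le_rfl) w
  have h2 : ‖𝓕 (iteratedFDeriv ℝ N g) w‖ ≤ ∫ ξ, ‖iteratedFDeriv ℝ N g ξ‖ :=
    VectorFourier.norm_fourierIntegral_le_integral_norm _ _ _ _ _
  rw [h1] at h2
  have h3 := (VectorFourier.fourierPowSMulRight (-innerSL ℝ) (𝓕 g) w N).le_opNorm (fun _ => w)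
  have hin : (-innerSL ℝ (E := E)) w w = -‖w‖ ^ 2 := by simp
  rw [VectorFourier.fourierPowSMulRight_apply] at h3
  simp only [hin,
    Finset.prod_const, Finset.card_univ, Fintype.card_fin, norm_smul, norm_pow, norm_neg,
    norm_mul, Complex.norm_I, mul_one, Complex.norm_real, Real.norm_eq_abs, abs_norm,
    Complex.norm_ofNat, abs_of_pos Real.pi_pos] at h3
  rcases eq_or_lt_of_le (norm_nonneg w) with hw | hw
  · rcases Nat.eq_zero_or_pos N with rfl | hN
    · simp only [pow_zero, one_mul] at h3 ⊢
      exact h3.trans (by simpa using h2)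
    · rw [← hw]
      simp only [mul_zero, zero_pow hN.ne', zero_mul]
      positivity
  · have hwN : 0 < ‖w‖ ^ N := by positivity
    refine le_trans ?_ h2
    rw [← mul_le_mul_iff_left₀ hwN]
    refine le_trans (le_of_eq ?_) h3
    ring

lemma IsLocalizedSymbol.integral_norm_iteratedFDeriv_le {E : Type*} [NormedAddCommGroup E]
    [InnerProductSpace ℝ E] [FiniteDimensional ℝ E] [MeasurableSpace E] [BorelSpace E] {N : ℕ}
    {g : E → ℂ} {R A : ℝ} (h : IsLocalizedSymbol N g R A) (hR : 0 < R) {k : ℕ} (hk : k ≤ N) :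
    ∫ ξ, ‖iteratedFDeriv ℝ k g ξ‖ ≤ A * (R ^ k)⁻¹ *
      ((2 * R) ^ Module.finrank ℝ E * volume.real (Metric.ball (0 : E) 1)) := by
  have h0 : ∀ ξ, ξ ∉ Metric.closedBall (0 : E) (2 * R) → ‖iteratedFDeriv ℝ k g ξ‖ = 0 :=
    fun ξ hξ => by rw [h.iteratedFDeriv_eq_zero (by simpa using hξ), norm_zero]
  rw [← setIntegral_eq_integral_of_forall_compl_eq_zero h0]
  have h1 := norm_setIntegral_le_of_norm_le_const (μ := volume)
    (s := Metric.closedBall (0 : E) (2 * R)) (f := fun ξ => ‖iteratedFDeriv ℝ k g ξ‖)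
    (C := A * (R ^ k)⁻¹) measure_closedBall_lt_top (fun ξ _ => by simpa using h.bound k hk ξ)
  refine (Real.le_norm_self _).trans (h1.trans (le_of_eq ?_))
  rw [measureReal_def, Measure.addHaar_closedBall _ _ (by positivity), ENNReal.toReal_mul,
    ENNReal.toReal_ofReal (by positivity), measureReal_def]

/-- Pointwise decay of the kernel of a multiplier localized at scale `R`. -/
lemma exists_norm_inverseFourier_le (n : ℕ) :
    ∃ C, 0 ≤ C ∧ ∀ (g : EuclideanSpace ℝ (Fin n) → ℂ) (R A : ℝ), 0 < R →
      IsLocalizedSymbol (n + 1) g R A → ∀ x,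
        ‖inverseFourier g x‖ ≤ C * A * R ^ n * ((1 + R * ‖x‖) ^ (n + 1))⁻¹ := by
  set v : ℝ := volume.real (Metric.ball (0 : EuclideanSpace ℝ (Fin n)) 1) with hv
  have hv0 : 0 ≤ v := measureReal_nonneg
  have hpi := Real.pi_pos
  refine ⟨2 ^ n * (2 * (((2 * Real.pi) ^ n)⁻¹ * (2 ^ n * v))), by positivity,
    fun g R A hR h x => ?_⟩
  have hA := h.nonneg
  have key : ∀ k ≤ n + 1, (R * ‖x‖) ^ k * ‖inverseFourier g x‖ ≤
      ((2 * Real.pi) ^ n)⁻¹ * (2 ^ n * v) * A * R ^ n := by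
    intro k hk
    have h1 := pow_mul_norm_fourier_le (h.contDiff.of_le (by exact_mod_cast hk))
      h.hasCompactSupport (N := k) (-(2 * Real.pi)⁻¹ • x)
    have h2 := h.integral_norm_iteratedFDeriv_le hR hk
    have e : 2 * Real.pi * ‖-(2 * Real.pi)⁻¹ • x‖ = ‖x‖ := by
      rw [norm_smul, norm_neg, norm_inv, Real.norm_eq_abs, abs_of_pos (by positivity)]
      field_simp
    rw [e] at h1
    have h3 := h1.trans h2
    rw [finrank_euclideanSpace, Fintype.card_fin] at h3
    rw [inverseFourier_eq_fourier, norm_mul, Complex.norm_real, Real.norm_eq_abs,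
      abs_of_pos (by positivity), mul_pow]
    calc _ = ((2 * Real.pi) ^ n)⁻¹ * R ^ k * (‖x‖ ^ k * ‖𝓕 g (-(2 * Real.pi)⁻¹ • x)‖) := by ring
      _ ≤ ((2 * Real.pi) ^ n)⁻¹ * R ^ k * (A * (R ^ k)⁻¹ * ((2 * R) ^ n * v)) := by gcongr
      _ = _ := by rw [mul_pow]; field_simp; rw [mul_pow]; ring
  have k0 := key 0 (by omega)
  have k1 := key (n + 1) le_rfl
  have h4 : (1 + R * ‖x‖) ^ (n + 1) ≤ 2 ^ n * (1 + (R * ‖x‖) ^ (n + 1)) := by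
    simpa using add_pow_le (zero_le_one (α := ℝ)) (by positivity : 0 ≤ R * ‖x‖) (n + 1)
  rw [← div_eq_mul_inv, le_div_iff₀ (by positivity)]
  calc ‖inverseFourier g x‖ * (1 + R * ‖x‖) ^ (n + 1)
      ≤ ‖inverseFourier g x‖ * (2 ^ n * (1 + (R * ‖x‖) ^ (n + 1))) := by gcongr
    _ = 2 ^ n * ((R * ‖x‖) ^ 0 * ‖inverseFourier g x‖ +
          (R * ‖x‖) ^ (n + 1) * ‖inverseFourier g x‖) := by ring
    _ ≤ 2 ^ n * (((2 * Real.pi) ^ n)⁻¹ * (2 ^ n * v) * A * R ^ n +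
          ((2 * Real.pi) ^ n)⁻¹ * (2 ^ n * v) * A * R ^ n) := by gcongr
    _ = _ := by ring

lemma integral_dilated_one_add_norm (n : ℕ) {R : ℝ} (hR : 0 < R) :
    Integrable (fun x : EuclideanSpace ℝ (Fin n) =>
      R ^ n * (1 + R * ‖x‖) ^ (-(n + 1 / 2 : ℝ))) ∧
    ∫ x : EuclideanSpace ℝ (Fin n), R ^ n * (1 + R * ‖x‖) ^ (-(n + 1 / 2 : ℝ)) =
      ∫ x : EuclideanSpace ℝ (Fin n), (1 + ‖x‖) ^ (-(n + 1 / 2 : ℝ)) := by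
  have hi : Integrable (fun x : EuclideanSpace ℝ (Fin n) => (1 + ‖x‖) ^ (-(n + 1 / 2 : ℝ))) :=
    integrable_one_add_norm (by simp)
  have e : ∀ x : EuclideanSpace ℝ (Fin n), (1 + R * ‖x‖) ^ (-(n + 1 / 2 : ℝ)) =
      (fun x : EuclideanSpace ℝ (Fin n) => (1 + ‖x‖) ^ (-(n + 1 / 2 : ℝ))) (R • x) := fun x => by
    simp only [norm_smul, Real.norm_eq_abs, abs_of_pos hR]
  simp only [e]
  refine ⟨((integrable_comp_smul_iff volume _ hR.ne').2 hi).const_mul _, ?_⟩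
  rw [integral_const_mul, Measure.integral_comp_smul volume
    (fun x : EuclideanSpace ℝ (Fin n) => (1 + ‖x‖) ^ (-(n + 1 / 2 : ℝ))) R,
    finrank_euclideanSpace, Fintype.card_fin,
    abs_of_pos (by positivity), smul_eq_mul, ← mul_assoc, mul_inv_cancel₀ (by positivity), one_mul]

lemma inverseFourier_sub_translate (g : EuclideanSpace ℝ (Fin n) → ℂ) (hg : Integrable g)
    (x y : EuclideanSpace ℝ (Fin n)) :
    inverseFourier g (x - y) - inverseFourier g x =
      inverseFourier (fun ξ => (Complex.exp (Complex.I * (⟪-y, ξ⟫ : ℝ)) - 1) * g ξ) x := by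
  have hi : ∀ z : EuclideanSpace ℝ (Fin n),
      Integrable fun ξ => Complex.exp (Complex.I * (⟪z, ξ⟫ : ℝ)) * g ξ := fun z => by
    refine hg.bdd_mul (c := 1) (by fun_prop) (Filter.Eventually.of_forall fun ξ => ?_)
    rw [mul_comm, Complex.norm_exp_ofReal_mul_I]
  rw [inverseFourier, inverseFourier, inverseFourier, ← mul_sub, ← integral_sub (hi _) (hi _)]
  congr 2
  funext ξ
  have : Complex.exp (Complex.I * (⟪x - y, ξ⟫ : ℝ)) =
      Complex.exp (Complex.I * (⟪x, ξ⟫ : ℝ)) * Complex.exp (Complex.I * (⟪-y, ξ⟫ : ℝ)) := by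
    rw [← Complex.exp_add, ← mul_add, ← Complex.ofReal_add, ← inner_add_left, sub_eq_add_neg]
  rw [this]
  ring

/-- Size, tail and translation bounds for the kernel of a multiplier localized at scale `R`. The
tail decays only like `(R ρ)^(-1/2)`, since `n + 1` derivatives of the multiplier give the kernel
the decay `(R|x|)^(-n-1)`, of which `n + 1 / 2` powers are spent on integrability. -/
structure IsScaleKernel (K : EuclideanSpace ℝ (Fin n) → ℂ) (R A : ℝ) : Prop where
  continuous : Continuous K
  norm_le : ∀ x, ‖K x‖ ≤ A * R ^ n
  lintegral_le : ∫⁻ x, ‖K x‖ₑ ≤ ENNReal.ofReal A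
  tail : ∀ ρ, 0 < ρ → ∫⁻ x in {x | ρ ≤ ‖x‖}, ‖K x‖ₑ ≤ ENNReal.ofReal (A * (R * ρ) ^ (-(1 / 2) : ℝ))
  translate : ∀ y, R * ‖y‖ ≤ 1 →
    ∫⁻ x, ‖K (x - y) - K x‖ₑ ≤ ENNReal.ofReal (A * (R * ‖y‖))

lemma IsScaleKernel.mono {K : EuclideanSpace ℝ (Fin n) → ℂ} {R A B : ℝ} (hR : 0 < R)
    (h : IsScaleKernel K R A) (hAB : A ≤ B) : IsScaleKernel K R B where
  continuous := h.continuous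
  norm_le x := (h.norm_le x).trans (by gcongr)
  lintegral_le := h.lintegral_le.trans (ENNReal.ofReal_le_ofReal hAB)
  tail ρ hρ := (h.tail ρ hρ).trans (ENNReal.ofReal_le_ofReal (by gcongr))
  translate y hy := (h.translate y hy).trans (ENNReal.ofReal_le_ofReal (by gcongr))

lemma exists_isScaleKernel (n : ℕ) :
    ∃ C, 0 ≤ C ∧ ∀ (g : EuclideanSpace ℝ (Fin n) → ℂ) (R A : ℝ), 0 < R →
      IsLocalizedSymbol (n + 1) g R A → IsScaleKernel (inverseFourier g) R (C * A) := by
  obtain ⟨C, hC, hK⟩ := exists_norm_inverseFourier_le n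
  set J : ℝ := ∫ x : EuclideanSpace ℝ (Fin n), (1 + ‖x‖) ^ (-(n + 1 / 2 : ℝ)) with hJ
  have hJ0 : 0 ≤ J := integral_nonneg fun x => by positivity
  -- The factor `(1 + R‖x‖)^(-1/2)` is set aside to pay for the tail.
  have hK' : ∀ (g : EuclideanSpace ℝ (Fin n) → ℂ) (R A : ℝ), 0 < R →
      IsLocalizedSymbol (n + 1) g R A → ∀ x, ‖inverseFourier g x‖ ≤
        C * A * (R ^ n * (1 + R * ‖x‖) ^ (-(n + 1 / 2 : ℝ))) *
          (1 + R * ‖x‖) ^ (-(1 / 2) : ℝ) := by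
    intro g R A hR h x
    refine (hK g R A hR h x).trans (le_of_eq ?_)
    have hp : 0 < 1 + R * ‖x‖ := by positivity
    have e : ((1 + R * ‖x‖) ^ (n + 1))⁻¹ =
        (1 + R * ‖x‖) ^ (-(n + 1 / 2 : ℝ)) * (1 + R * ‖x‖) ^ (-(1 / 2) : ℝ) := by
      rw [← Real.rpow_add hp, ← Real.rpow_natCast, ← Real.rpow_neg hp.le]
      congr 1
      push_cast
      ring
    rw [e]
    ring
  have hL : ∀ (g : EuclideanSpace ℝ (Fin n) → ℂ) (R A : ℝ), 0 < R →
      IsLocalizedSymbol (n + 1) g R A → ∀ (S : Set (EuclideanSpace ℝ (Fin n))) (b : ℝ),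
      MeasurableSet S → 0 ≤ b → (∀ x ∈ S, (1 + R * ‖x‖) ^ (-(1 / 2) : ℝ) ≤ b) →
      ∫⁻ x in S, ‖inverseFourier g x‖ₑ ≤ ENNReal.ofReal (C * A * J * b) := by
    intro g R A hR h S b hS hb hSb
    have hA := h.nonneg
    obtain ⟨hi, he⟩ := integral_dilated_one_add_norm n hR
    calc ∫⁻ x in S, ‖inverseFourier g x‖ₑ ≤ ∫⁻ x in S, ENNReal.ofReal
          (C * A * b * (R ^ n * (1 + R * ‖x‖) ^ (-(n + 1 / 2 : ℝ)))) := by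
          refine setLIntegral_mono' hS fun x hx => ?_
          rw [← ofReal_norm]
          refine ENNReal.ofReal_le_ofReal ((hK' g R A hR h x).trans ?_)
          calc _ ≤ C * A * (R ^ n * (1 + R * ‖x‖) ^ (-(n + 1 / 2 : ℝ))) * b := by
                gcongr
                exact hSb x hx
            _ = _ := by ring
      _ ≤ ∫⁻ x, ENNReal.ofReal (C * A * b * (R ^ n * (1 + R * ‖x‖) ^ (-(n + 1 / 2 : ℝ)))) :=
          setLIntegral_le_lintegral _ _
      _ = ENNReal.ofReal (C * A * b * J) := by
          rw [← ofReal_integral_eq_lintegral_ofReal (hi.const_mul _)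
            (Filter.Eventually.of_forall fun x => by positivity), integral_const_mul, he]
      _ = _ := by congr 1; ring
  set P : ℝ := 2 ^ (n + 1) * (2 * (n + 1).factorial) with hP
  have hP0 : 0 ≤ P := by positivity
  refine ⟨C + C * J + C * J * P, by positivity, fun g R A hR h => ?_⟩
  have hA := h.nonneg
  have hgi : Integrable g := h.contDiff.continuous.integrable_of_hasCompactSupport
    h.hasCompactSupport
  have hbase : ∀ x : EuclideanSpace ℝ (Fin n), (1 + R * ‖x‖) ^ (-(1 / 2) : ℝ) ≤ 1 := fun x =>
    Real.rpow_le_one_of_one_le_of_nonpos (by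
      have : 0 ≤ R * ‖x‖ := by positivity
      linarith) (by norm_num)
  have hCJ : 0 ≤ C * J := by positivity
  have hCJP : 0 ≤ C * J * P := by positivity
  refine ⟨continuous_inverseFourier hgi, fun x => ?_, ?_, fun ρ hρ => ?_, fun y hy => ?_⟩
  · refine (hK g R A hR h x).trans ?_
    have : ((1 + R * ‖x‖) ^ (n + 1))⁻¹ ≤ 1 := inv_le_one_of_one_le₀ (one_le_pow₀ (by
      have : 0 ≤ R * ‖x‖ := by positivity
      linarith))
    calc _ ≤ C * A * R ^ n * 1 := by gcongr
      _ = C * (A * R ^ n) := by ring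
      _ ≤ (C + C * J + C * J * P) * (A * R ^ n) := by gcongr; linarith
      _ = _ := by ring
  · have := hL g R A hR h Set.univ 1 MeasurableSet.univ zero_le_one fun x _ => hbase x
    rw [Measure.restrict_univ] at this
    refine this.trans (ENNReal.ofReal_le_ofReal ?_)
    calc C * A * J * 1 = C * J * A := by ring
      _ ≤ _ := by gcongr; linarith
  · refine (hL g R A hR h {x | ρ ≤ ‖x‖} ((R * ρ) ^ (-(1 / 2) : ℝ))
      (measurableSet_le measurable_const measurable_norm) (by positivity) fun x hx => ?_).trans
      (ENNReal.ofReal_le_ofReal ?_)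
    · have hx : ρ ≤ ‖x‖ := hx
      refine Real.rpow_le_rpow_of_nonpos (by positivity) ?_ (by norm_num)
      have : R * ρ ≤ R * ‖x‖ := by gcongr
      linarith
    · calc _ = C * J * A * (R * ρ) ^ (-(1 / 2) : ℝ) := by ring
        _ ≤ _ := by gcongr; linarith
  · have h1 := h.cexp_sub_one_mul hR (y := -y) (by simpa using hy)
    have := hL _ R _ hR h1 Set.univ 1 MeasurableSet.univ zero_le_one fun x _ => hbase x
    rw [Measure.restrict_univ] at this
    simp only [inverseFourier_sub_translate g hgi]
    refine this.trans (ENNReal.ofReal_le_ofReal ?_)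
    rw [norm_neg]
    calc _ = C * J * P * A * (R * ‖y‖) := by rw [hP]; ring
      _ ≤ _ := by gcongr; linarith

end Bernstein

/-! ### Convolution inequalities -/

section Convolution

variable {E : Type*} [NormedAddCommGroup E] [InnerProductSpace ℝ E] [FiniteDimensional ℝ E]
  [MeasurableSpace E] [BorelSpace E]

/-- Convolution of complex-valued functions with respect to Lebesgue measure. -/
noncomputable abbrev conv (K f : E → ℂ) : E → ℂ :=
  convolution K f (ContinuousLinearMap.mul ℂ ℂ) volume

lemma conv_apply (K f : E → ℂ) (x : E) : conv K f x = ∫ y, K y * f (x - y) := rfl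

variable {K f : E → ℂ}

lemma aestronglyMeasurable_comp_sub_left (hf : AEStronglyMeasurable f) (x : E) :
    AEStronglyMeasurable fun y => f (x - y) :=
  hf.comp_quasiMeasurePreserving (quasiMeasurePreserving_sub_left volume x)

lemma aestronglyMeasurable_conv_integrand (hK : AEStronglyMeasurable K)
    (hf : AEStronglyMeasurable f) :
    AEStronglyMeasurable (fun z : E × E => K z.2 * f (z.1 - z.2)) (volume.prod volume) :=
  AEStronglyMeasurable.convolution_integrand (ContinuousLinearMap.mul ℂ ℂ) hK hf

lemma aestronglyMeasurable_conv (hK : AEStronglyMeasurable K) (hf : AEStronglyMeasurable f) :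
    AEStronglyMeasurable (conv K f) :=
  (aestronglyMeasurable_conv_integrand hK hf).integral_prod_right'

lemma enorm_conv_le (K f : E → ℂ) (x : E) :
    ‖conv K f x‖ₑ ≤ ∫⁻ y, ‖K y‖ₑ * ‖f (x - y)‖ₑ := by
  rw [conv_apply]
  refine (enorm_integral_le_lintegral_enorm _).trans (le_of_eq ?_)
  simp only [enorm_mul]

/-- Hölder's inequality in the form that gives both Young's inequality with an integrable kernel and
the uniform bound with a bounded kernel. -/
lemma enorm_conv_le_rpow (hK : AEStronglyMeasurable K) (hf : AEStronglyMeasurable f) {p : ℝ}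
    (hp : 1 ≤ p) (x : E) :
    ‖conv K f x‖ₑ ≤ (∫⁻ y, ‖K y‖ₑ) ^ (1 - 1 / p) *
      (∫⁻ y, ‖K y‖ₑ * ‖f (x - y)‖ₑ ^ p) ^ (1 / p) := by
  have hp0 : 0 < p := by linarith
  have h1p : 0 ≤ 1 - 1 / p := by
    rw [sub_nonneg, div_le_one hp0]; exact hp
  have hf' : AEMeasurable fun y => ‖f (x - y)‖ₑ := (aestronglyMeasurable_comp_sub_left hf x).enorm
  refine (enorm_conv_le K f x).trans (le_trans (le_of_eq ?_) (ENNReal.lintegral_mul_norm_pow_le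
    hK.enorm (hK.enorm.mul (hf'.pow_const p)) h1p (by positivity) (by ring)))
  refine lintegral_congr fun y => ?_
  simp only [Pi.mul_apply]
  rw [ENNReal.mul_rpow_of_nonneg _ _ (by positivity), ← ENNReal.rpow_mul,
    mul_one_div_cancel hp0.ne',
    ENNReal.rpow_one, ← mul_assoc, ← ENNReal.rpow_add_of_nonneg _ _ h1p (by positivity)]
  simp

/-- Young's inequality for an integrable kernel. -/
lemma eLpNorm_conv_le (hK : AEStronglyMeasurable K) (hf : AEStronglyMeasurable f) {p : ℝ≥0∞}
    (hp : 1 ≤ p) : eLpNorm (conv K f) p ≤ (∫⁻ y, ‖K y‖ₑ) * eLpNorm f p := by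
  rcases eq_or_ne p ∞ with rfl | hpt
  · refine eLpNormEssSup_le_of_ae_enorm_bound (Filter.Eventually.of_forall fun x => ?_)
    refine (enorm_conv_le K f x).trans ?_
    rw [← lintegral_mul_const'' _ hK.enorm]
    refine lintegral_mono_ae ?_
    have h1 : ∀ᵐ y, ‖f y‖ₑ ≤ eLpNorm f ∞ := ae_le_eLpNormEssSup
    have h2 := (quasiMeasurePreserving_sub_left (volume : Measure E) x).ae h1
    filter_upwards [h2] with y hy
    gcongr
  have hp0 : p ≠ 0 := (zero_lt_one.trans_le hp).ne'
  have hpr : 1 ≤ p.toReal := by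
    rw [← ENNReal.toReal_one]; exact ENNReal.toReal_mono hpt hp
  have hpr0 : 0 < p.toReal := by linarith
  set r := p.toReal with hr
  set I := ∫⁻ y, ‖K y‖ₑ with hI
  have h1p : 0 ≤ 1 - 1 / r := by
    rw [sub_nonneg, div_le_one hpr0]; exact hpr
  rw [eLpNorm_eq_lintegral_rpow_enorm_toReal hp0 hpt,
    eLpNorm_eq_lintegral_rpow_enorm_toReal hp0 hpt,
    ← hr]
  have hmeas : AEMeasurable (fun z : E × E => ‖K z.2‖ₑ * ‖f (z.1 - z.2)‖ₑ ^ r)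
      (volume.prod volume) := by
    have h1 : AEMeasurable (fun z : E × E => ‖K z.2‖ₑ) (volume.prod volume) :=
      hK.enorm.comp_quasiMeasurePreserving Measure.quasiMeasurePreserving_snd
    have h2 : AEMeasurable (fun z : E × E => ‖f (z.1 - z.2)‖ₑ) (volume.prod volume) :=
      (hf.comp_quasiMeasurePreserving (quasiMeasurePreserving_sub volume volume)).enorm
    exact h1.mul (h2.pow_const r)
  have key : ∫⁻ x, ‖conv K f x‖ₑ ^ r ≤ I ^ r * ∫⁻ x, ‖f x‖ₑ ^ r := by
    calc ∫⁻ x, ‖conv K f x‖ₑ ^ r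
        ≤ ∫⁻ x, I ^ (r - 1) * ∫⁻ y, ‖K y‖ₑ * ‖f (x - y)‖ₑ ^ r := by
          refine lintegral_mono fun x => ?_
          calc _ ≤ (I ^ (1 - 1 / r) * (∫⁻ y, ‖K y‖ₑ * ‖f (x - y)‖ₑ ^ r) ^ (1 / r)) ^ r := by
                gcongr
                exact enorm_conv_le_rpow hK hf hpr x
            _ = _ := by
                rw [ENNReal.mul_rpow_of_nonneg _ _ hpr0.le, ← ENNReal.rpow_mul, ← ENNReal.rpow_mul,
                  one_div_mul_cancel hpr0.ne', ENNReal.rpow_one, sub_mul, one_mul,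
                  one_div_mul_cancel hpr0.ne']
      _ = I ^ (r - 1) * ∫⁻ x, ∫⁻ y, ‖K y‖ₑ * ‖f (x - y)‖ₑ ^ r :=
          lintegral_const_mul'' _ hmeas.lintegral_prod_right'
      _ = I ^ (r - 1) * ∫⁻ y, ∫⁻ x, ‖K y‖ₑ * ‖f (x - y)‖ₑ ^ r := by
          rw [lintegral_lintegral_swap hmeas]
      _ = I ^ (r - 1) * ∫⁻ y, ‖K y‖ₑ * ∫⁻ x, ‖f x‖ₑ ^ r := by
          congr 1
          refine lintegral_congr fun y => ?_
          have hm : AEMeasurable fun x => ‖f (x - y)‖ₑ ^ r :=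
            ((hf.comp_quasiMeasurePreserving
              (measurePreserving_sub_right volume y).quasiMeasurePreserving).enorm).pow_const r
          rw [lintegral_const_mul'' _ hm, lintegral_sub_right_eq_self (fun x => ‖f x‖ₑ ^ r) y]
      _ = I ^ (r - 1) * (I ^ (1 : ℝ) * ∫⁻ x, ‖f x‖ₑ ^ r) := by
          rw [lintegral_mul_const'' _ hK.enorm, ENNReal.rpow_one]
      _ = _ := by
          rw [← mul_assoc, ← ENNReal.rpow_add_of_nonneg _ _ (by linarith) zero_le_one]
          congr 2
          ring
  calc _ ≤ (I ^ r * ∫⁻ x, ‖f x‖ₑ ^ r) ^ (1 / r) := by gcongr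
    _ = _ := by
      rw [ENNReal.mul_rpow_of_nonneg _ _ (by positivity), ← ENNReal.rpow_mul,
        mul_one_div_cancel hpr0.ne', ENNReal.rpow_one]

/-- The uniform bound for convolution with a bounded integrable kernel. -/
lemma enorm_conv_le_eLpNorm (hK : AEStronglyMeasurable K) (hf : AEStronglyMeasurable f)
    {p : ℝ≥0∞} (hp : 1 ≤ p) (hpt : p ≠ ∞) {B : ℝ≥0∞} (hB : ∀ x, ‖K x‖ₑ ≤ B) (x : E) :
    ‖conv K f x‖ₑ ≤ (∫⁻ y, ‖K y‖ₑ) ^ (1 - 1 / p.toReal) * B ^ (1 / p.toReal) * eLpNorm f p := by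
  have hp0 : p ≠ 0 := (zero_lt_one.trans_le hp).ne'
  have hpr : 1 ≤ p.toReal := by
    rw [← ENNReal.toReal_one]; exact ENNReal.toReal_mono hpt hp
  have hpr0 : 0 < p.toReal := by linarith
  refine (enorm_conv_le_rpow hK hf hpr x).trans ?_
  rw [eLpNorm_eq_lintegral_rpow_enorm_toReal hp0 hpt, mul_assoc,
    ← ENNReal.mul_rpow_of_nonneg _ _ (by positivity)]
  gcongr
  have hf' : AEMeasurable fun y => ‖f (x - y)‖ₑ ^ p.toReal :=
    (aestronglyMeasurable_comp_sub_left hf x).enorm.pow_const _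
  calc _ ≤ ∫⁻ y, B * ‖f (x - y)‖ₑ ^ p.toReal := by
        refine lintegral_mono fun y => ?_
        gcongr
        exact hB y
    _ = B * ∫⁻ y, ‖f y‖ₑ ^ p.toReal := by
        rw [lintegral_const_mul'' _ hf',
          lintegral_sub_left_eq_self (fun y => ‖f y‖ₑ ^ p.toReal) x]

/-- Interpolation of `L^q` between `L^p` and `L^∞`. -/
lemma eLpNorm_le_rpow_mul_rpow {α : Type*} [MeasurableSpace α] {μ : Measure α} {g : α → ℂ}
    {p q : ℝ≥0∞} (hp : 1 ≤ p) (hpq : p ≤ q) (hq : q ≠ ∞) {M : ℝ≥0∞} (hMt : M ≠ ∞)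
    (hM : ∀ x, ‖g x‖ₑ ≤ M) :
    eLpNorm g q μ ≤ eLpNorm g p μ ^ (p.toReal / q.toReal) * M ^ (1 - p.toReal / q.toReal) := by
  have hpt : p ≠ ∞ := ne_top_of_le_ne_top hq hpq
  have hp0 : p ≠ 0 := (zero_lt_one.trans_le hp).ne'
  have hq0 : q ≠ 0 := (zero_lt_one.trans_le (hp.trans hpq)).ne'
  have hpr : 0 < p.toReal := ENNReal.toReal_pos hp0 hpt
  have hqr : 0 < q.toReal := ENNReal.toReal_pos hq0 hq
  have hle : p.toReal ≤ q.toReal := ENNReal.toReal_mono hq hpq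
  rw [eLpNorm_eq_lintegral_rpow_enorm_toReal hp0 hpt, eLpNorm_eq_lintegral_rpow_enorm_toReal hq0 hq]
  have key : ∫⁻ x, ‖g x‖ₑ ^ q.toReal ∂μ ≤
      (∫⁻ x, ‖g x‖ₑ ^ p.toReal ∂μ) * M ^ (q.toReal - p.toReal) := by
    rw [← lintegral_mul_const' _ _ (ENNReal.rpow_ne_top_of_nonneg (by linarith) hMt)]
    refine lintegral_mono fun x => ?_
    calc ‖g x‖ₑ ^ q.toReal = ‖g x‖ₑ ^ p.toReal * ‖g x‖ₑ ^ (q.toReal - p.toReal) := by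
          rw [← ENNReal.rpow_add_of_nonneg _ _ hpr.le (by linarith)]
          congr 1; ring
      _ ≤ _ := by
          gcongr
          exact hM x
  calc _ ≤ ((∫⁻ x, ‖g x‖ₑ ^ p.toReal ∂μ) * M ^ (q.toReal - p.toReal)) ^ (1 / q.toReal) := by
        gcongr
    _ = _ := by
        rw [ENNReal.mul_rpow_of_nonneg _ _ (by positivity), ← ENNReal.rpow_mul, ← ENNReal.rpow_mul]
        congr 2 <;> field_simp

end Convolution

section ScaleKernel

variable {n : ℕ} {K f : EuclideanSpace ℝ (Fin n) → ℂ}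

/-- Bernstein's inequality: the `L^p` to `L^q` norm of a kernel at frequency scale `R`. -/
lemma IsScaleKernel.eLpNorm_conv_le {R A : ℝ} (hK : IsScaleKernel K R A) (hR : 0 < R) (hA : 0 ≤ A)
    (hf : AEStronglyMeasurable f) {p q : ℝ≥0∞} (hp : 1 ≤ p) (hpq : p ≤ q)
    (hfp : eLpNorm f p ≠ ∞) :
    eLpNorm (conv K f) q ≤ ENNReal.ofReal (A * R ^ scalingGap n p q) * eLpNorm f p := by
  have hKm : AEStronglyMeasurable K := hK.continuous.aestronglyMeasurable
  have h1 := (_root_.eLpNorm_conv_le hKm hf hp).trans (mul_le_mul_left hK.lintegral_le _)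
  rcases eq_or_ne p ∞ with rfl | hpt
  · have : q = ∞ := top_le_iff.1 hpq
    subst this
    simpa [scalingGap] using h1
  have hpr : 1 ≤ p.toReal := by
    rw [← ENNReal.toReal_one]; exact ENNReal.toReal_mono hpt hp
  have hpr0 : 0 < p.toReal := by linarith
  have h1p : 0 ≤ 1 - 1 / p.toReal := by
    rw [sub_nonneg, div_le_one hpr0]; exact hpr
  have hB : ∀ x, ‖K x‖ₑ ≤ ENNReal.ofReal (A * R ^ n) := fun x => by
    rw [← ofReal_norm]; exact ENNReal.ofReal_le_ofReal (hK.norm_le x)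
  have h2 : ∀ x, ‖conv K f x‖ₑ ≤
      ENNReal.ofReal (A * R ^ (n / p.toReal : ℝ)) * eLpNorm f p := fun x => by
    refine (enorm_conv_le_eLpNorm hKm hf hp hpt hB x).trans ?_
    gcongr
    calc _ ≤ ENNReal.ofReal A ^ (1 - 1 / p.toReal) *
          ENNReal.ofReal (A * R ^ n) ^ (1 / p.toReal) := by
            gcongr
            exact hK.lintegral_le
      _ = ENNReal.ofReal (A * R ^ (n / p.toReal : ℝ)) := by
          rw [ENNReal.ofReal_mul hA, ENNReal.mul_rpow_of_nonneg _ _ (by positivity), ← mul_assoc,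
            ← ENNReal.rpow_add_of_nonneg _ _ h1p (by positivity), sub_add_cancel, ENNReal.rpow_one,
            ENNReal.ofReal_rpow_of_nonneg (by positivity) (by positivity), ← ENNReal.ofReal_mul hA,
            ← Real.rpow_natCast, ← Real.rpow_mul hR.le, mul_one_div]
  rcases eq_or_ne q ∞ with rfl | hqt
  · have e : scalingGap n p ∞ = n / p.toReal := by simp [scalingGap, div_eq_mul_inv]
    rw [e]
    exact eLpNormEssSup_le_of_ae_enorm_bound (Filter.Eventually.of_forall h2)
  have hqr0 : 0 < q.toReal := hpr0.trans_le (ENNReal.toReal_mono hqt hpq)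
  have hle : p.toReal / q.toReal ≤ 1 := by
    rw [div_le_one hqr0]; exact ENNReal.toReal_mono hqt hpq
  refine (eLpNorm_le_rpow_mul_rpow hp hpq hqt
    (ENNReal.mul_ne_top ENNReal.ofReal_ne_top hfp) h2).trans ?_
  set s := p.toReal / q.toReal with hs
  have hs0 : 0 ≤ s := by positivity
  have hs1 : 0 ≤ 1 - s := by linarith
  calc _ ≤ (ENNReal.ofReal A * eLpNorm f p) ^ s *
        (ENNReal.ofReal (A * R ^ (n / p.toReal : ℝ)) * eLpNorm f p) ^ (1 - s) := by
        gcongr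
    _ = ENNReal.ofReal A ^ s * ENNReal.ofReal (A * R ^ (n / p.toReal : ℝ)) ^ (1 - s) *
          (eLpNorm f p ^ s * eLpNorm f p ^ (1 - s)) := by
        rw [ENNReal.mul_rpow_of_nonneg _ _ hs0, ENNReal.mul_rpow_of_nonneg _ _ hs1]
        ring
    _ = _ := by
        rw [← ENNReal.rpow_add_of_nonneg _ _ hs0 hs1, add_sub_cancel, ENNReal.rpow_one,
          ENNReal.ofReal_mul hA, ENNReal.mul_rpow_of_nonneg _ _ hs1, ← mul_assoc,
          ← ENNReal.rpow_add_of_nonneg _ _ hs0 hs1, add_sub_cancel, ENNReal.rpow_one,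
          ENNReal.ofReal_rpow_of_nonneg (by positivity) hs1, ← ENNReal.ofReal_mul hA,
          ← Real.rpow_mul hR.le]
        congr 4
        rw [scalingGap, ENNReal.toReal_inv, ENNReal.toReal_inv, hs]
        field_simp

end ScaleKernel

/-! ### Sums over dyadic scales -/

section DyadicSums

/-- The bounded increasing function `u / (1 + u)` turns the sum into a telescoping one. -/
lemma sum_min_inv_le {κ : ℝ} (hκ0 : 0 < κ) (hκ1 : κ < 1) {u : ℝ} (hu : 0 < u) (N : ℕ) :
    ∑ j ∈ Finset.range N, min (u * κ ^ j) (u * κ ^ j)⁻¹ ≤ 4 / (1 - κ) := by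
  have h1κ : 0 < 1 - κ := by linarith
  have step : ∀ v : ℝ, 0 < v → min v v⁻¹ ≤ 4 / (1 - κ) * (v / (1 + v) - v * κ / (1 + v * κ)) := by
    intro v hv
    have hvκ : 0 < v * κ := by positivity
    have e : v / (1 + v) - v * κ / (1 + v * κ) = (1 - κ) * v / ((1 + v) * (1 + v * κ)) := by
      field_simp
      ring
    rw [e]
    have h2 : min v v⁻¹ * (1 + v) ^ 2 ≤ 4 * v := by
      rcases le_total v 1 with h | h
      · calc _ ≤ v * (1 + v) ^ 2 := by gcongr; exact min_le_left _ _
          _ ≤ v * (1 + 1) ^ 2 := by gcongr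
          _ = _ := by ring
      · calc _ ≤ v⁻¹ * (v + v) ^ 2 := by gcongr; exact min_le_right _ _
          _ = _ := by field_simp; ring
    calc min v v⁻¹ ≤ 4 * v / (1 + v) ^ 2 := by rw [le_div_iff₀ (by positivity)]; exact h2
      _ ≤ 4 * v / ((1 + v) * (1 + v * κ)) := by
          rw [pow_two]
          gcongr
          nlinarith
      _ = _ := by field_simp
  calc _ ≤ ∑ j ∈ Finset.range N, 4 / (1 - κ) * (u * κ ^ j / (1 + u * κ ^ j) -
          u * κ ^ (j + 1) / (1 + u * κ ^ (j + 1))) := by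
        refine Finset.sum_le_sum fun j _ => ?_
        have := step (u * κ ^ j) (by positivity)
        rwa [mul_assoc u, ← pow_succ] at this
    _ = 4 / (1 - κ) * (u / (1 + u) - u * κ ^ N / (1 + u * κ ^ N)) := by
        rw [← Finset.mul_sum, Finset.sum_range_sub' (fun j => u * κ ^ j / (1 + u * κ ^ j))]
        simp
    _ ≤ 4 / (1 - κ) * 1 := by
        gcongr
        have h1 : u / (1 + u) ≤ 1 := by rw [div_le_one (by positivity)]; linarith
        have h2 : 0 ≤ u * κ ^ N / (1 + u * κ ^ N) := by positivity
        linarith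
    _ = _ := mul_one _

/-- The function `log (1 + u)` turns the sum into a telescoping one. -/
lemma sum_min_one_le {κ : ℝ} (hκ0 : 0 < κ) (hκ1 : κ < 1) {u : ℝ} (hu : 0 < u) (N : ℕ) :
    ∑ j ∈ Finset.range N, min 1 (u * κ ^ j) ≤ 4 / (1 - κ) * Real.log (1 + u) := by
  have h1κ : 0 < 1 - κ := by linarith
  have step : ∀ v : ℝ, 0 < v →
      min 1 v ≤ 4 / (1 - κ) * (Real.log (1 + v) - Real.log (1 + v * κ)) := by
    intro v hv
    have hvκ : 0 < v * κ := by positivity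
    rw [← Real.log_div (by positivity) (by positivity)]
    have hmin : 0 < min 1 v := lt_min one_pos hv
    have hmin1 : min 1 v ≤ 1 := min_le_left _ _
    have h2 : 1 + (1 - κ) * min 1 v / 2 ≤ (1 + v) / (1 + v * κ) := by
      rw [le_div_iff₀ (by positivity)]
      rcases le_total v 1 with h | h
      · rw [min_eq_right h]
        nlinarith [mul_pos hv h1κ]
      · rw [min_eq_left h]
        nlinarith [mul_pos hv h1κ]
    have h3 : 1 - (1 + (1 - κ) * min 1 v / 2)⁻¹ ≤ Real.log (1 + (1 - κ) * min 1 v / 2) :=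
      Real.one_sub_inv_le_log_of_pos (by positivity)
    have h4 : (1 - κ) * min 1 v / 4 ≤ 1 - (1 + (1 - κ) * min 1 v / 2)⁻¹ := by
      set x := (1 - κ) * min 1 v / 2 with hx
      have hx0 : 0 < x := by positivity
      have hx1 : x ≤ 1 := by nlinarith
      have e : 1 - (1 + x)⁻¹ = x / (1 + x) := by field_simp; ring
      rw [e, le_div_iff₀ (by positivity)]
      nlinarith
    have h5 : Real.log (1 + (1 - κ) * min 1 v / 2) ≤ Real.log ((1 + v) / (1 + v * κ)) :=
      Real.log_le_log (by positivity) h2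
    calc min 1 v = 4 / (1 - κ) * ((1 - κ) * min 1 v / 4) := by field_simp
      _ ≤ _ := by gcongr; linarith
  calc _ ≤ ∑ j ∈ Finset.range N, 4 / (1 - κ) * (Real.log (1 + u * κ ^ j) -
          Real.log (1 + u * κ ^ (j + 1))) := by
        refine Finset.sum_le_sum fun j _ => ?_
        have := step (u * κ ^ j) (by positivity)
        rwa [mul_assoc u, ← pow_succ] at this
    _ = 4 / (1 - κ) * (Real.log (1 + u) - Real.log (1 + u * κ ^ N)) := by
        rw [← Finset.mul_sum, Finset.sum_range_sub' (fun j => Real.log (1 + u * κ ^ j))]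
        simp
    _ ≤ _ := by
        gcongr
        have : 0 ≤ Real.log (1 + u * κ ^ N) := Real.log_nonneg (by
          have : 0 ≤ u * κ ^ N := by positivity
          linarith)
        linarith

/-- Uniform summability over dyadic scales of a quantity decaying in both directions. -/
lemma exists_sum_min_rpow_le {α β : ℝ} (hα : 0 < α) (hβ : 0 < β) :
    ∃ C, 0 ≤ C ∧ ∀ (y : ℝ) (N : ℕ), 0 < y →
      ∑ j ∈ Finset.range N, min ((y * (1 / 2) ^ j) ^ α) ((y * (1 / 2) ^ j) ^ (-β)) ≤ C := by
  set s := min α β with hs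
  have hs0 : 0 < s := lt_min hα hβ
  set κ : ℝ := (1 / 2) ^ s with hκ
  have hκ0 : 0 < κ := by positivity
  have hκ1 : κ < 1 := Real.rpow_lt_one (by norm_num) (by norm_num) hs0
  refine ⟨4 / (1 - κ), div_nonneg (by norm_num) (by linarith), fun y N hy => ?_⟩
  refine le_trans (Finset.sum_le_sum fun j _ => ?_)
    (sum_min_inv_le hκ0 hκ1 (u := y ^ s) (by positivity) N)
  have hz : 0 < y * (1 / 2) ^ j := by positivity
  have e : y ^ s * κ ^ j = (y * (1 / 2) ^ j) ^ s := by
    rw [Real.mul_rpow hy.le (by positivity), hκ, ← Real.rpow_natCast, ← Real.rpow_natCast,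
      ← Real.rpow_mul (by norm_num), ← Real.rpow_mul (by norm_num), mul_comm s]
  rw [e, ← Real.rpow_neg hz.le]
  set z := y * (1 / 2) ^ j
  rcases le_total z 1 with h | h
  · refine le_min ((min_le_left _ _).trans ?_) ((min_le_left _ _).trans ?_)
    · exact Real.rpow_le_rpow_of_exponent_ge hz h (min_le_left _ _)
    · exact Real.rpow_le_rpow_of_exponent_ge hz h (by linarith)
  · refine le_min ((min_le_right _ _).trans ?_) ((min_le_right _ _).trans ?_)
    · exact Real.rpow_le_rpow_of_exponent_le h (by linarith)
    · exact Real.rpow_le_rpow_of_exponent_le h (by linarith [min_le_right α β])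

end DyadicSums

/-! ### Reduction to finitely many dyadic pieces -/

section Reduction

variable {n : ℕ} {χ m : EuclideanSpace ℝ (Fin n) → ℝ} {δ : ℝ}

/-- The kernel of the dyadic piece of the multiplier `m` at scale `R`. -/
noncomputable def dyadicKernel (χ m : EuclideanSpace ℝ (Fin n) → ℝ) (R : ℝ) :
    EuclideanSpace ℝ (Fin n) → ℂ :=
  inverseFourier fun ξ => (dyadicPiece χ m R ξ : ℂ)

lemma exists_isScaleKernel_dyadicKernel (hχ : IsCutoff χ) :
    ∃ C, 0 ≤ C ∧ ∀ (m : EuclideanSpace ℝ (Fin n) → ℝ) (R W : ℝ), 0 < R → 0 ≤ W →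
      (∀ ξ, R / 2 ≤ ‖ξ‖ → ‖ξ‖ ≤ 2 * R → IsSymbolAt (n + 1) m ξ W) →
      IsScaleKernel (dyadicKernel χ m R) R (C * W) := by
  obtain ⟨C₁, hC₁, h₁⟩ := exists_isLocalizedSymbol_dyadicPiece (n + 1) hχ
  obtain ⟨C₂, hC₂, h₂⟩ := exists_isScaleKernel n
  refine ⟨C₂ * C₁, by positivity, fun m R W hR hW hm => ?_⟩
  rw [mul_assoc]
  exact h₂ _ R _ hR (h₁ m R W hR hW hm).ofReal

lemma norm_inverseFourier_le (g : EuclideanSpace ℝ (Fin n) → ℂ) (x : EuclideanSpace ℝ (Fin n)) :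
    ‖inverseFourier g x‖ ≤ ((2 * Real.pi) ^ n)⁻¹ * ∫ ξ, ‖g ξ‖ := by
  have hpi := Real.pi_pos
  rw [inverseFourier, norm_mul, Complex.norm_real, Real.norm_eq_abs, abs_of_pos (by positivity)]
  gcongr
  refine (norm_integral_le_integral_norm _).trans (le_of_eq ?_)
  congr 1
  funext ξ
  rw [norm_mul, mul_comm Complex.I, Complex.norm_exp_ofReal_mul_I, one_mul]

lemma IsCutoff.exists_bound (hχ : IsCutoff χ) : ∃ X, 0 ≤ X ∧ ∀ ξ, |χ ξ| ≤ X := by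
  obtain ⟨C, hC, h⟩ := exists_isSymbolAt_dilation 0 hχ.contDiff hχ.eq_zero
  exact ⟨C, by linarith, fun ξ => by simpa using (h 1 ξ).norm_le⟩

lemma integrable_cutoff_mul (hχ : IsCutoff χ) (hm : Integrable m) (r s : ℝ) :
    Integrable fun ξ => (χ (r • ξ) - χ (s • ξ)) * m ξ := by
  obtain ⟨X, hX, hb⟩ := hχ.exists_bound
  have hc := hχ.contDiff.continuous
  refine hm.bdd_mul (c := X + X) (by fun_prop) (Filter.Eventually.of_forall fun ξ => ?_)
  exact (norm_sub_le _ _).trans (add_le_add (hb _) (hb _))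

lemma sum_dyadicKernel (hχ : IsCutoff χ) (hm : Integrable m) (N : ℕ)
    (x : EuclideanSpace ℝ (Fin n)) :
    ∑ j ∈ Finset.range N, dyadicKernel χ m (δ * (1 / 2) ^ j) x =
      inverseFourier (fun ξ =>
        (((χ (δ⁻¹ • ξ) - χ ((δ * (1 / 2) ^ N)⁻¹ • ξ)) * m ξ : ℝ) : ℂ)) x := by
  simp only [dyadicKernel, inverseFourier]
  rw [← Finset.mul_sum, ← integral_finsetSum]
  · congr 2
    funext ξ
    rw [← Finset.mul_sum, ← Complex.ofReal_sum, sum_dyadicPiece]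
  · intro j _
    refine (integrable_cutoff_mul hχ hm _ _).ofReal.bdd_mul (c := 1) (by fun_prop)
      (Filter.Eventually.of_forall fun ξ => ?_)
    rw [mul_comm, Complex.norm_exp_ofReal_mul_I]

/-- It suffices to bound convolution with finite sums of dyadic kernels. -/
lemma eLpNorm_conv_inverseFourier_le (hn : 1 ≤ n) (hχ : IsCutoff χ) (hδ : 0 < δ)
    (hm : Integrable m) (hm0 : ∀ ξ, δ < ‖ξ‖ → m ξ = 0) {f : EuclideanSpace ℝ (Fin n) → ℂ}
    (hf : Integrable f) {q B : ℝ≥0∞}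
    (hB : ∀ N : ℕ, eLpNorm (conv (fun x => ∑ j ∈ Finset.range N,
      dyadicKernel χ m (δ * (1 / 2) ^ j) x) f) q ≤ B) :
    eLpNorm (conv (inverseFourier fun ξ => (m ξ : ℂ)) f) q ≤ B := by
  have : Nonempty (Fin n) := ⟨⟨0, hn⟩⟩
  have : Nontrivial (EuclideanSpace ℝ (Fin n)) := inferInstance
  obtain ⟨X, hX, hXb⟩ := hχ.exists_bound
  have hc := hχ.contDiff.continuous
  have hpi := Real.pi_pos
  set g : ℕ → EuclideanSpace ℝ (Fin n) → ℂ := fun N ξ =>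
    (((χ (δ⁻¹ • ξ) - χ ((δ * (1 / 2) ^ N)⁻¹ • ξ)) * m ξ : ℝ) : ℂ) with hg
  have hgi : ∀ N, Integrable (g N) := fun N => (integrable_cutoff_mul hχ hm _ _).ofReal
  have hgb : ∀ N ξ, ‖g N ξ‖ ≤ (X + X) * |m ξ| := fun N ξ => by
    rw [hg, Complex.norm_real, norm_mul, Real.norm_eq_abs, Real.norm_eq_abs]
    gcongr
    exact (abs_sub _ _).trans (add_le_add (hXb _) (hXb _))
  have hsum : ∀ N, (fun x => ∑ j ∈ Finset.range N, dyadicKernel χ m (δ * (1 / 2) ^ j) x) =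
      inverseFourier (g N) := fun N => funext fun x => sum_dyadicKernel hχ hm N x
  simp only [hsum] at hB
  -- pointwise convergence of the truncated multipliers away from the origin
  have hlim : ∀ ξ, ξ ≠ 0 → Filter.Tendsto (fun N => g N ξ) Filter.atTop (nhds (m ξ : ℂ)) := by
    intro ξ hξ
    refine tendsto_const_nhds.congr' ?_
    have hr : 0 < ‖ξ‖ := norm_pos_iff.2 hξ
    have h1 : Filter.Tendsto (fun N : ℕ => δ * (1 / 2 : ℝ) ^ N) Filter.atTop (nhds (δ * 0)) :=
      (tendsto_pow_atTop_nhds_zero_of_lt_one (by norm_num) (by norm_num)).const_mul δ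
    rw [mul_zero] at h1
    filter_upwards [h1.eventually (gt_mem_nhds (half_pos hr))] with N hN
    have h2 : χ ((δ * (1 / 2) ^ N)⁻¹ • ξ) = 0 := hχ.eq_zero _ (by
      rw [norm_smul, norm_inv, Real.norm_eq_abs, abs_of_pos (by positivity),
        le_inv_mul_iff₀ (by positivity)]
      linarith)
    rcases le_or_gt ‖ξ‖ δ with h | h
    · have h3 : χ (δ⁻¹ • ξ) = 1 := hχ.eq_one _ (by
        rw [norm_smul, norm_inv, Real.norm_eq_abs, abs_of_pos hδ, inv_mul_le_iff₀ hδ]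
        linarith)
      simp only [hg]
      rw [h2, h3]; simp
    · simp only [hg]
      rw [hm0 ξ h]; simp
  have hTlim : ∀ y, Filter.Tendsto (fun N => inverseFourier (g N) y) Filter.atTop
      (nhds (inverseFourier (fun ξ => (m ξ : ℂ)) y)) := by
    intro y
    refine Filter.Tendsto.const_mul _ (tendsto_integral_of_dominated_convergence
      (fun ξ => (X + X) * |m ξ|) (fun N => ?_) (hm.abs.const_mul _) (fun N => ?_) ?_)
    · have := (hgi N).aestronglyMeasurable
      exact AEStronglyMeasurable.mul (by fun_prop) this
    · refine Filter.Eventually.of_forall fun ξ => ?_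
      rw [norm_mul, mul_comm Complex.I, Complex.norm_exp_ofReal_mul_I, one_mul]
      exact hgb N ξ
    · have h0 : ∀ᵐ ξ : EuclideanSpace ℝ (Fin n), ξ ≠ 0 := by
        rw [ae_iff]; simp
      filter_upwards [h0] with ξ hξ
      exact (hlim ξ hξ).const_mul _
  set C := ((2 * Real.pi) ^ n)⁻¹ * ((X + X) * ∫ ξ, |m ξ|) with hC
  have hTb : ∀ N y, ‖inverseFourier (g N) y‖ ≤ C := fun N y => by
    refine (norm_inverseFourier_le _ _).trans ?_
    have h1 : ∫ ξ, ‖g N ξ‖ ≤ (X + X) * ∫ ξ, |m ξ| := by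
      rw [← integral_const_mul]
      exact integral_mono (hgi N).norm (hm.abs.const_mul _) (hgb N)
    rw [hC]
    gcongr
  have hcont : ∀ N, Continuous (inverseFourier (g N)) := fun N => continuous_inverseFourier (hgi N)
  have hconv : ∀ x, Filter.Tendsto (fun N => conv (inverseFourier (g N)) f x) Filter.atTop
      (nhds (conv (inverseFourier fun ξ => (m ξ : ℂ)) f x)) := by
    intro x
    simp only [conv_apply]
    refine tendsto_integral_of_dominated_convergence (fun y => C * ‖f (x - y)‖) (fun N => ?_)
      ((hf.comp_sub_left x).norm.const_mul _) (fun N => ?_) ?_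
    · exact (hcont N).aestronglyMeasurable.mul (hf.comp_sub_left x).aestronglyMeasurable
    · refine Filter.Eventually.of_forall fun y => ?_
      rw [norm_mul]
      gcongr
      exact hTb N y
    · exact Filter.Eventually.of_forall fun y => (hTlim y).mul_const _
  refine (Lp.eLpNorm_lim_le_liminf_eLpNorm (fun N => aestronglyMeasurable_conv
    (hcont N).aestronglyMeasurable hf.aestronglyMeasurable) _
    (Filter.Eventually.of_forall hconv)).trans ?_
  exact Filter.liminf_le_of_le (by isBoundedDefault) fun b hb => by
    obtain ⟨N, hN⟩ := hb.exists
    exact hN.trans (hB N)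

end Reduction

/-! ### Summing the dyadic pieces -/

section SummableCases

variable {n : ℕ} {a χ m : EuclideanSpace ℝ (Fin n) → ℝ} {θ₀ a₁ C₀ δ : ℝ}

lemma scalingGap_nonneg {p q : ℝ≥0∞} (hp : 1 ≤ p) (hpq : p ≤ q) : 0 ≤ scalingGap n p q := by
  have h1 : (q⁻¹).toReal ≤ (p⁻¹).toReal :=
    ENNReal.toReal_mono (ENNReal.inv_ne_top.2 (zero_lt_one.trans_le hp).ne')
      (ENNReal.inv_le_inv.2 hpq)
  exact mul_nonneg (Nat.cast_nonneg _) (sub_nonneg.2 h1)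

lemma integrable_conv_integrand {E : Type*} [NormedAddCommGroup E] [InnerProductSpace ℝ E]
    [FiniteDimensional ℝ E] [MeasurableSpace E] [BorelSpace E] {K f : E → ℂ} {M : ℝ}
    (hK : AEStronglyMeasurable K) (hM : ∀ x, ‖K x‖ ≤ M) (hf : Integrable f) (x : E) :
    Integrable fun y => K y * f (x - y) :=
  (hf.comp_sub_left x).bdd_mul (c := M) hK (Filter.Eventually.of_forall hM)

lemma conv_sum {k : ℕ → EuclideanSpace ℝ (Fin n) → ℂ} {R A : ℕ → ℝ}
    (hk : ∀ j, IsScaleKernel (k j) (R j) (A j)) {f : EuclideanSpace ℝ (Fin n) → ℂ}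
    (hf : Integrable f) (s : Finset ℕ) :
    conv (fun x => ∑ j ∈ s, k j x) f = ∑ j ∈ s, conv (k j) f := by
  funext x
  rw [Finset.sum_apply]
  simp only [conv_apply]
  rw [← integral_finsetSum]
  · simp only [Finset.sum_mul]
  · exact fun j _ => integrable_conv_integrand (hk j).continuous.aestronglyMeasurable
      (hk j).norm_le hf x

lemma eLpNorm_conv_sum_le {k : ℕ → EuclideanSpace ℝ (Fin n) → ℂ} {R A : ℕ → ℝ}
    (hk : ∀ j, IsScaleKernel (k j) (R j) (A j)) (hR : ∀ j, 0 < R j) (hA : ∀ j, 0 ≤ A j)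
    {f : EuclideanSpace ℝ (Fin n) → ℂ} (hf : Integrable f) {p q : ℝ≥0∞} (hp : 1 ≤ p) (hpq : p ≤ q)
    (hfp : eLpNorm f p ≠ ∞) (s : Finset ℕ) :
    eLpNorm (conv (fun x => ∑ j ∈ s, k j x) f) q ≤
      ENNReal.ofReal (∑ j ∈ s, A j * R j ^ scalingGap n p q) * eLpNorm f p := by
  rw [conv_sum hk hf]
  refine (eLpNorm_sum_le (fun j _ => aestronglyMeasurable_conv
    (hk j).continuous.aestronglyMeasurable hf.aestronglyMeasurable) (hp.trans hpq)).trans ?_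
  rw [ENNReal.ofReal_sum_of_nonneg fun j _ => mul_nonneg (hA j) (Real.rpow_nonneg (hR j).le _),
    Finset.sum_mul]
  exact Finset.sum_le_sum fun j _ =>
    (hk j).eLpNorm_conv_le (hR j) (hA j) hf.aestronglyMeasurable hp hpq hfp

lemma integrable_of_isSymbolAt (hn : 1 ≤ n) {M : ℝ} (hm : ∀ ξ, ξ ≠ 0 → IsSymbolAt (n + 1) m ξ M)
    (hm0 : ∀ ξ, δ < ‖ξ‖ → m ξ = 0) : Integrable m := by
  have : Nonempty (Fin n) := ⟨⟨0, hn⟩⟩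
  have : Nontrivial (EuclideanSpace ℝ (Fin n)) := inferInstance
  have h0 : ∀ᵐ ξ : EuclideanSpace ℝ (Fin n), ξ ≠ 0 := by
    rw [ae_iff]; simp
  have hmeas : AEStronglyMeasurable m := by
    have hc : ContinuousOn m {0}ᶜ := fun ξ hξ =>
      ((hm ξ hξ).contDiffAt.continuousAt).continuousWithinAt
    have h1 := hc.aestronglyMeasurable (μ := volume) (measurableSet_singleton _).compl
    rwa [Measure.restrict_eq_self_of_ae_mem
      (show ∀ᵐ ξ : EuclideanSpace ℝ (Fin n), ξ ∈ ({0}ᶜ : Set _) from h0)] at h1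
  have hint : IntegrableOn m (Metric.closedBall 0 δ) := by
    refine Measure.integrableOn_of_bounded (M := M)
      (measure_closedBall_lt_top (μ := volume)).ne hmeas ?_
    filter_upwards [ae_restrict_of_ae h0] with ξ hξ using (hm ξ hξ).norm_le
  rw [← integrableOn_univ]
  exact hint.of_forall_sdiff_eq_zero MeasurableSet.univ fun ξ hξ =>
    hm0 ξ (by simpa using hξ.2)

/-- The `L^p`–`L^q` bound for a multiplier whose dyadic pieces are summable. -/
lemma exists_eLpNorm_conv_le_of_sum (hn : 1 ≤ n) (hχ : IsCutoff χ) (hδ : 0 < δ) :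
    ∃ C, 0 ≤ C ∧ ∀ (m : EuclideanSpace ℝ (Fin n) → ℝ) (W : ℝ → ℝ) (S : ℝ) (p q : ℝ≥0∞)
      (f : EuclideanSpace ℝ (Fin n) → ℂ), 1 ≤ p → p ≤ q → Integrable m →
      (∀ ξ, δ < ‖ξ‖ → m ξ = 0) → (∀ R, 0 < R → 0 ≤ W R) →
      (∀ R, 0 < R → R ≤ δ → ∀ ξ, R / 2 ≤ ‖ξ‖ → ‖ξ‖ ≤ 2 * R → IsSymbolAt (n + 1) m ξ (W R)) →
      (∀ N, ∑ j ∈ Finset.range N,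
        W (δ * (1 / 2) ^ j) * (δ * (1 / 2) ^ j) ^ scalingGap n p q ≤ S) →
      Integrable f → eLpNorm f p ≠ ∞ →
      eLpNorm (conv (inverseFourier fun ξ => (m ξ : ℂ)) f) q ≤
        ENNReal.ofReal (C * S) * eLpNorm f p := by
  obtain ⟨C, hC, hker⟩ := exists_isScaleKernel_dyadicKernel hχ
  refine ⟨C, hC, fun m W S p q f hp hpq hm hm0 hW hsym hS hf hfp => ?_⟩
  have hRpos : ∀ j : ℕ, 0 < δ * (1 / 2 : ℝ) ^ j := fun j => by positivity
  have hRle : ∀ j : ℕ, δ * (1 / 2 : ℝ) ^ j ≤ δ := fun j =>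
    mul_le_of_le_one_right hδ.le (pow_le_one₀ (by norm_num) (by norm_num))
  refine eLpNorm_conv_inverseFourier_le hn hχ hδ hm hm0 hf fun N => ?_
  refine (eLpNorm_conv_sum_le (R := fun j => δ * (1 / 2 : ℝ) ^ j)
    (A := fun j => C * W (δ * (1 / 2 : ℝ) ^ j))
    (fun j => hker m _ _ (hRpos j) (hW _ (hRpos j)) (hsym _ (hRpos j) (hRle j))) hRpos
    (fun j => mul_nonneg hC (hW _ (hRpos j))) hf hp hpq hfp (Finset.range N)).trans ?_
  gcongr
  simp only [mul_assoc C]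
  rw [← Finset.mul_sum]
  gcongr
  exact hS N

lemma convolutorNorm_le {p q : ℝ≥0∞} {T : EuclideanSpace ℝ (Fin n) → ℂ} {B : ℝ≥0∞}
    (h : ∀ f : 𝓢(EuclideanSpace ℝ (Fin n), ℂ), eLpNorm f p volume = 1 →
      eLpNorm (conv T f) q ≤ B) : convolutorNorm p q T ≤ B :=
  iSup₂_le h

lemma lowFrequencySymbol_eq_zero (hχ : IsCutoff χ) (hδ : 0 < δ) (t : ℝ)
    (ξ : EuclideanSpace ℝ (Fin n)) (hξ : δ < ‖ξ‖) : lowFrequencySymbol a χ δ t ξ = 0 := by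
  have := (hχ.eventuallyEq_zero hδ one_pos (ξ := ξ) (by simpa using hξ)).eq_of_nhds
  rw [mul_one] at this
  rw [lowFrequencySymbol, this, Pi.zero_apply, mul_zero]

/-- The symbol bounds for the multiplier on the annulus of radius `R`, with `1 + t` in place
of `t`. -/
lemma exists_isSymbolAt_annulus (ha : IsOverdampedSymbol n a θ₀ a₁ C₀ δ) (hχ : IsCutoff χ)
    (hθ₀ : 0 ≤ θ₀) (hθ₁ : θ₀ < 1) :
    ∃ C c, 0 ≤ C ∧ 0 < c ∧ ∀ t, 0 ≤ t → ∀ R, 0 < R → R ≤ δ → ∀ ξ, R / 2 ≤ ‖ξ‖ → ‖ξ‖ ≤ 2 * R →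
      IsSymbolAt (n + 1) (lowFrequencySymbol a χ δ t) ξ
        (C * (min (1 + t) (R ^ (-θ₀)) * Real.exp (-(c * ((1 + t) * R ^ (2 - θ₀)))))) := by
  have hδ := ha.δ_pos
  obtain ⟨C, c, hC, hc, h⟩ := exists_isSymbolAt_lowFrequencySymbol ha hχ
  set c' := c * (1 / 2) ^ (2 - θ₀) with hc'
  have hc'0 : 0 < c' := by positivity
  refine ⟨C * (2 ^ θ₀ * Real.exp (c' * δ ^ (2 - θ₀))), c', by positivity, hc'0,
    fun t ht R hR hRδ ξ h1 h2 => ?_⟩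
  have hr : 0 < ‖ξ‖ := by linarith
  refine (h t ht ξ (norm_pos_iff.1 hr)).mono ?_
  have hmin : min t (‖ξ‖ ^ (-θ₀)) ≤ 2 ^ θ₀ * min (1 + t) (R ^ (-θ₀)) := by
    have h2θ : (1 : ℝ) ≤ 2 ^ θ₀ := Real.one_le_rpow (by norm_num) hθ₀
    rw [mul_min_of_nonneg _ _ (by positivity)]
    refine min_le_min (by nlinarith) ?_
    calc ‖ξ‖ ^ (-θ₀) ≤ (R / 2) ^ (-θ₀) :=
          Real.rpow_le_rpow_of_nonpos (by positivity) h1 (by linarith)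
      _ = 2 ^ θ₀ * R ^ (-θ₀) := by
          rw [Real.div_rpow hR.le (by norm_num), Real.rpow_neg (by norm_num : (0 : ℝ) ≤ 2)]
          field_simp
  -- Replacing `t` by `1 + t` costs a bounded factor because `R ≤ δ`.
  have hexp : Real.exp (-(c * t * ‖ξ‖ ^ (2 - θ₀))) ≤
      Real.exp (c' * δ ^ (2 - θ₀)) * Real.exp (-(c' * ((1 + t) * R ^ (2 - θ₀)))) := by
    rw [← Real.exp_add, Real.exp_le_exp]
    have e1 : (R * (1 / 2)) ^ (2 - θ₀) ≤ ‖ξ‖ ^ (2 - θ₀) :=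
      Real.rpow_le_rpow (by positivity) (by linarith) (by linarith)
    rw [Real.mul_rpow hR.le (by norm_num)] at e1
    have e2 : R ^ (2 - θ₀) ≤ δ ^ (2 - θ₀) := Real.rpow_le_rpow hR.le hRδ (by linarith)
    have e3 : c * t * (R ^ (2 - θ₀) * (1 / 2) ^ (2 - θ₀)) ≤ c * t * ‖ξ‖ ^ (2 - θ₀) := by gcongr
    have e4 : c' * R ^ (2 - θ₀) ≤ c' * δ ^ (2 - θ₀) := by gcongr
    have e5 : c * t * (R ^ (2 - θ₀) * (1 / 2) ^ (2 - θ₀)) = c' * (t * R ^ (2 - θ₀)) := by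
      rw [hc']; ring
    nlinarith
  calc _ ≤ C * ((2 ^ θ₀ * min (1 + t) (R ^ (-θ₀))) *
        (Real.exp (c' * δ ^ (2 - θ₀)) * Real.exp (-(c' * ((1 + t) * R ^ (2 - θ₀)))))) := by
        gcongr
    _ = _ := by ring

lemma integrable_lowFrequencySymbol (hn : 1 ≤ n) (ha : IsOverdampedSymbol n a θ₀ a₁ C₀ δ)
    (hχ : IsCutoff χ) {t : ℝ} (ht : 0 ≤ t) : Integrable (lowFrequencySymbol a χ δ t) := by
  obtain ⟨C, c, hC, hc, h⟩ := exists_isSymbolAt_lowFrequencySymbol ha hχ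
  refine integrable_of_isSymbolAt hn (M := C * (t * 1)) (fun ξ hξ => (h t ht ξ hξ).mono ?_)
    (lowFrequencySymbol_eq_zero hχ ha.δ_pos t)
  gcongr
  · exact min_le_left _ _
  · exact Real.exp_le_one_iff.2 (neg_nonpos.2 (by positivity))

/-- Exponential decay beats every power, uniformly on `(0, ∞)`. -/
lemma exists_rpow_mul_exp_le {b c σ : ℝ} (hb : 0 ≤ b) (hc : 0 < c) (hσ : 0 < σ) :
    ∃ C, 0 ≤ C ∧ ∀ z : ℝ, 0 < z → z ^ b * Real.exp (-(c * z ^ σ)) ≤ C := by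
  set k := ⌈b / σ⌉₊ with hk
  refine ⟨1 + k.factorial / c ^ k, by positivity, fun z hz => ?_⟩
  set u := z ^ σ with hu
  have hu0 : 0 < u := by positivity
  have h1 : z ^ b = u ^ (b / σ) := by
    rw [hu, ← Real.rpow_mul hz.le, mul_div_cancel₀ _ hσ.ne']
  have h2 : u ^ (b / σ) ≤ 1 + u ^ k := by
    rcases le_total u 1 with h | h
    · have := Real.rpow_le_one hu0.le h (by positivity : 0 ≤ b / σ)
      have : 0 ≤ u ^ k := by positivity
      linarith
    · have := Real.rpow_le_rpow_of_exponent_le h (Nat.le_ceil (b / σ))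
      rw [Real.rpow_natCast] at this
      linarith
  have h3 := Real.pow_div_factorial_le_exp (c * u) (by positivity) k
  have h4 : Real.exp (-(c * u)) ≤ 1 := Real.exp_le_one_iff.2 (neg_nonpos.2 (by positivity))
  have h5 : u ^ k * Real.exp (-(c * u)) ≤ k.factorial / c ^ k := by
    rw [mul_pow, div_le_iff₀ (by positivity)] at h3
    rw [Real.exp_neg, ← div_eq_mul_inv, div_le_div_iff₀ (by positivity) (by positivity)]
    linarith
  rw [h1]
  calc _ ≤ (1 + u ^ k) * Real.exp (-(c * u)) := by gcongr
    _ = Real.exp (-(c * u)) + u ^ k * Real.exp (-(c * u)) := by ring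
    _ ≤ _ := by gcongr

/-- Decay above the critical scaling gap: the frequencies `|ξ| ~ (1 + t)^(-1/(2-θ₀))` dominate. -/
lemma convolutorNorm_le_of_lt_scalingGap (hn : 1 ≤ n) (hθ₀ : 0 ≤ θ₀) (hθ₁ : θ₀ < 1)
    (ha : IsOverdampedSymbol n a θ₀ a₁ C₀ δ) (hχ : IsCutoff χ) {p q : ℝ≥0∞} (hp : 1 ≤ p)
    (hpq : p ≤ q) (hG : θ₀ < scalingGap n p q) :
    ∃ C : ℝ, 0 < C ∧ ∀ t : ℝ, 0 ≤ t →
      convolutorNorm p q (lowFrequencyKernel a χ δ t) ≤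
        ENNReal.ofReal (C * (1 + t) ^ (-(1 / (2 - θ₀)) * (scalingGap n p q - θ₀))) := by
  have hδ := ha.δ_pos
  set G := scalingGap n p q with hGdef
  set β := G - θ₀ with hβ
  have hβ0 : 0 < β := by linarith
  set σ := 2 - θ₀ with hσ
  have hσ0 : 0 < σ := by linarith
  obtain ⟨C₁, c, hC₁, hc, hsym⟩ := exists_isSymbolAt_annulus ha hχ hθ₀ hθ₁
  obtain ⟨C₂, hC₂, hmul⟩ := exists_eLpNorm_conv_le_of_sum hn hχ hδ
  obtain ⟨C₃, hC₃, hexp⟩ := exists_rpow_mul_exp_le (b := β + 1) (by linarith) hc hσ0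
  obtain ⟨C₄, hC₄, hsum⟩ := exists_sum_min_rpow_le hβ0 one_pos
  refine ⟨C₂ * (C₁ * ((1 + C₃) * C₄)) + 1, by positivity, fun t ht => ?_⟩
  have hτ : 0 < 1 + t := by linarith
  refine convolutorNorm_le fun f hf => ?_
  have hkey := hmul (lowFrequencySymbol a χ δ t)
    (fun R => C₁ * (min (1 + t) (R ^ (-θ₀)) * Real.exp (-(c * ((1 + t) * R ^ σ)))))
    (C₁ * ((1 + C₃) * C₄) * (1 + t) ^ (-(1 / σ) * β)) p q f hp hpq
    (integrable_lowFrequencySymbol hn ha hχ ht) (lowFrequencySymbol_eq_zero hχ hδ t)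
    (fun R hR => by positivity) (hsym t ht) ?_ f.integrable (by rw [hf]; simp)
  · rw [hf, mul_one] at hkey
    refine hkey.trans (ENNReal.ofReal_le_ofReal ?_)
    have : 0 ≤ (1 + t) ^ (-(1 / σ) * β) := by positivity
    nlinarith
  · intro N
    -- In the variable `z = (1 + t) ^ (1 / σ) * R` every dyadic term is the claimed power of `1 + t`
    -- times a profile of `z` that decays at `0` and at `∞`.
    set y := (1 + t) ^ (1 / σ) * δ with hy
    have hterm : ∀ j : ℕ, C₁ * (min (1 + t) ((δ * (1 / 2) ^ j) ^ (-θ₀)) *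
        Real.exp (-(c * ((1 + t) * (δ * (1 / 2) ^ j) ^ σ)))) * (δ * (1 / 2) ^ j) ^ G ≤
        C₁ * (1 + C₃) * (1 + t) ^ (-(1 / σ) * β) *
          min ((y * (1 / 2) ^ j) ^ β) ((y * (1 / 2) ^ j) ^ (-1 : ℝ)) := by
      intro j
      set R := δ * (1 / 2 : ℝ) ^ j with hR
      have hR0 : 0 < R := by positivity
      have ez : y * (1 / 2) ^ j = (1 + t) ^ (1 / σ) * R := by rw [hy, hR]; ring
      rw [ez]
      set z := (1 + t) ^ (1 / σ) * R with hz
      have hz0 : 0 < z := by positivity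
      have e1 : (1 + t) * R ^ σ = z ^ σ := by
        rw [hz, Real.mul_rpow (by positivity) hR0.le, ← Real.rpow_mul hτ.le,
          one_div_mul_cancel hσ0.ne', Real.rpow_one]
      have e2 : R ^ (-θ₀) * R ^ G = (1 + t) ^ (-(1 / σ) * β) * z ^ β := by
        rw [hz, Real.mul_rpow (by positivity) hR0.le, ← Real.rpow_mul hτ.le, ← mul_assoc,
          ← Real.rpow_add hτ, ← Real.rpow_add hR0]
        have : -(1 / σ) * β + 1 / σ * β = 0 := by ring
        rw [this, Real.rpow_zero, one_mul]
        congr 1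
        rw [hβ]; ring
      have e3 : z ^ β * Real.exp (-(c * z ^ σ)) ≤ (1 + C₃) * min (z ^ β) (z ^ (-1 : ℝ)) := by
        rw [mul_min_of_nonneg _ _ (by positivity)]
        refine le_min ?_ ?_
        · have : Real.exp (-(c * z ^ σ)) ≤ 1 := Real.exp_le_one_iff.2 (neg_nonpos.2 (by positivity))
          have : 0 ≤ z ^ β := by positivity
          nlinarith
        · have h1 := hexp z hz0
          rw [Real.rpow_add hz0, Real.rpow_one] at h1
          rw [Real.rpow_neg_one, ← div_eq_mul_inv, le_div_iff₀ hz0]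
          linarith
      rw [e1]
      calc _ ≤ C₁ * (R ^ (-θ₀) * Real.exp (-(c * z ^ σ))) * R ^ G := by
            gcongr
            exact min_le_right _ _
        _ = C₁ * (1 + t) ^ (-(1 / σ) * β) * (z ^ β * Real.exp (-(c * z ^ σ))) := by
            linear_combination (C₁ * Real.exp (-(c * z ^ σ))) * e2
        _ ≤ C₁ * (1 + t) ^ (-(1 / σ) * β) * ((1 + C₃) * min (z ^ β) (z ^ (-1 : ℝ))) := by
            gcongr
        _ = _ := by ring
    refine (Finset.sum_le_sum fun j _ => hterm j).trans ?_
    rw [← Finset.mul_sum]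
    calc _ ≤ C₁ * (1 + C₃) * (1 + t) ^ (-(1 / σ) * β) * C₄ := by
          gcongr
          exact hsum y N (by positivity)
      _ = _ := by ring

/-- At the critical scaling gap the dyadic sum loses a logarithm. -/
lemma convolutorNorm_le_log (hn : 1 ≤ n) (hθ₀ : 0 < θ₀) (hθ₁ : θ₀ < 1)
    (ha : IsOverdampedSymbol n a θ₀ a₁ C₀ δ) (hχ : IsCutoff χ) {p q : ℝ≥0∞} (hp : 1 ≤ p)
    (hpq : p ≤ q) (hG : scalingGap n p q = θ₀) :
    ∃ C : ℝ, 0 < C ∧ ∀ t : ℝ, 0 ≤ t →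
      convolutorNorm p q (lowFrequencyKernel a χ δ t) ≤
        ENNReal.ofReal (C * Real.log (Real.exp 1 + t)) := by
  have hδ := ha.δ_pos
  obtain ⟨C₁, c, hC₁, hc, hsym⟩ := exists_isSymbolAt_annulus ha hχ hθ₀.le hθ₁
  obtain ⟨C₂, hC₂, hmul⟩ := exists_eLpNorm_conv_le_of_sum hn hχ hδ
  set κ : ℝ := (1 / 2) ^ θ₀ with hκ
  have hκ0 : 0 < κ := by positivity
  have hκ1 : κ < 1 := Real.rpow_lt_one (by norm_num) (by norm_num) hθ₀
  have h1κ : 0 < 1 - κ := by linarith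
  have hL0 : 0 ≤ Real.log (1 + δ ^ θ₀) := Real.log_nonneg (by
    have : 0 < δ ^ θ₀ := by positivity
    linarith)
  refine ⟨C₂ * (C₁ * (4 / (1 - κ) * (1 + Real.log (1 + δ ^ θ₀)))) + 1, by positivity,
    fun t ht => ?_⟩
  have hτ : 0 < 1 + t := by linarith
  have he := Real.add_one_le_exp (1 : ℝ)
  have hlog1 : 1 ≤ Real.log (Real.exp 1 + t) := by
    calc (1 : ℝ) = Real.log (Real.exp 1) := (Real.log_exp 1).symm
      _ ≤ _ := Real.log_le_log (Real.exp_pos _) (by linarith)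
  refine convolutorNorm_le fun f hf => ?_
  have hkey := hmul (lowFrequencySymbol a χ δ t)
    (fun R => C₁ * (min (1 + t) (R ^ (-θ₀)) * Real.exp (-(c * ((1 + t) * R ^ (2 - θ₀))))))
    (C₁ * (4 / (1 - κ) * (1 + Real.log (1 + δ ^ θ₀))) * Real.log (Real.exp 1 + t)) p q f hp hpq
    (integrable_lowFrequencySymbol hn ha hχ ht) (lowFrequencySymbol_eq_zero hχ hδ t)
    (fun R hR => by positivity) (hsym t ht) ?_ f.integrable (by rw [hf]; simp)
  · rw [hf, mul_one] at hkey
    refine hkey.trans (ENNReal.ofReal_le_ofReal ?_)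
    nlinarith
  · intro N
    rw [hG]
    -- About `log (1 + t)` scales, those with `(1 + t) * R ^ θ₀ ≥ 1`, contribute a term of size `1`.
    have hterm : ∀ j : ℕ, C₁ * (min (1 + t) ((δ * (1 / 2) ^ j) ^ (-θ₀)) *
        Real.exp (-(c * ((1 + t) * (δ * (1 / 2) ^ j) ^ (2 - θ₀))))) * (δ * (1 / 2) ^ j) ^ θ₀ ≤
        C₁ * min 1 ((1 + t) * δ ^ θ₀ * κ ^ j) := by
      intro j
      set R := δ * (1 / 2 : ℝ) ^ j with hR
      have hR0 : 0 < R := by positivity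
      have e1 : (1 + t) * δ ^ θ₀ * κ ^ j = (1 + t) * R ^ θ₀ := by
        rw [hR, Real.mul_rpow hδ.le (by positivity), hκ, ← Real.rpow_natCast, ← Real.rpow_natCast,
          ← Real.rpow_mul (by norm_num), ← Real.rpow_mul (by norm_num), mul_comm θ₀]
        ring
      have hRθ : 0 < R ^ θ₀ := by positivity
      have e2 : min (1 + t) (R ^ (-θ₀)) * R ^ θ₀ = min 1 ((1 + t) * R ^ θ₀) := by
        rw [min_mul_of_nonneg _ _ hRθ.le, min_comm, Real.rpow_neg hR0.le,
          inv_mul_cancel₀ hRθ.ne']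
      rw [e1, ← e2]
      have h3 : Real.exp (-(c * ((1 + t) * R ^ (2 - θ₀)))) ≤ 1 :=
        Real.exp_le_one_iff.2 (neg_nonpos.2 (by positivity))
      calc _ ≤ C₁ * (min (1 + t) (R ^ (-θ₀)) * 1) * R ^ θ₀ := by gcongr
        _ = _ := by ring
    refine (Finset.sum_le_sum fun j _ => hterm j).trans ?_
    rw [← Finset.mul_sum, mul_assoc C₁]
    gcongr
    refine (sum_min_one_le hκ0 hκ1 (by positivity) N).trans ?_
    rw [mul_assoc (4 / (1 - κ))]
    gcongr
    calc Real.log (1 + (1 + t) * δ ^ θ₀) ≤ Real.log ((1 + δ ^ θ₀) * (Real.exp 1 + t)) := by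
          refine Real.log_le_log (by positivity) ?_
          have : 0 < δ ^ θ₀ := by positivity
          nlinarith
      _ = Real.log (1 + δ ^ θ₀) + Real.log (Real.exp 1 + t) :=
          Real.log_mul (by positivity) (by positivity)
      _ ≤ _ := by nlinarith

/-- Growth below the critical scaling gap: the frequencies `|ξ| ~ (1 + t)^(-1/θ₀)` dominate. -/
lemma convolutorNorm_le_of_scalingGap_lt (hn : 1 ≤ n) (hθ₀ : 0 < θ₀) (hθ₁ : θ₀ < 1)
    (ha : IsOverdampedSymbol n a θ₀ a₁ C₀ δ) (hχ : IsCutoff χ) {p q : ℝ≥0∞} (hp : 1 ≤ p)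
    (hpq : p ≤ q) (hG : scalingGap n p q < θ₀) :
    ∃ C : ℝ, 0 < C ∧ ∀ t : ℝ, 0 ≤ t →
      convolutorNorm p q (lowFrequencyKernel a χ δ t) ≤
        ENNReal.ofReal (C * (1 + t) ^ (1 - scalingGap n p q / θ₀)) := by
  have hδ := ha.δ_pos
  have hG0 : 0 ≤ scalingGap n p q := scalingGap_nonneg hp hpq
  set G := scalingGap n p q with hGdef
  obtain ⟨C₁, hC₁, hsym⟩ := exists_isSymbolAt_lowFrequencySymbol_sub ha hχ hθ₀ hθ₁
  obtain ⟨C₂, hC₂, hmul⟩ := exists_eLpNorm_conv_le_of_sum hn hχ hδ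
  obtain ⟨C₃, hC₃, hloc⟩ := exists_isLocalizedSymbol_cutoff (n + 1) hχ
  obtain ⟨C₄, hC₄, hsum⟩ := exists_sum_min_rpow_le (α := θ₀ + G) (β := θ₀ - G) (by linarith)
    (by linarith)
  obtain ⟨C₅, hC₅, hker⟩ := exists_isScaleKernel n
  set D := C₂ * (C₁ * 2 ^ θ₀ * C₄) + C₅ * C₃ * (δ / 2) ^ G with hD
  have hD0 : 0 ≤ D := by positivity
  refine ⟨D + 1, by positivity, fun t ht => ?_⟩
  have hτ : 0 < 1 + t := by linarith
  set l := (1 + t) ^ (1 / θ₀) with hl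
  have hl0 : 0 < l := by positivity
  have hl1 : 1 ≤ l := Real.one_le_rpow (by linarith) (by positivity)
  -- Without the subtraction the terms with `R → 0` sum only if `G > 0`. The subtracted cut-off is
  -- a single piece at the scale `ρ`, to which Bernstein's inequality applies directly.
  set m : EuclideanSpace ℝ (Fin n) → ℝ :=
    fun y => lowFrequencySymbol a χ δ t y - t * χ ((2 / δ * l) • y) with hm
  set ρ := δ / 2 / l with hρ
  have hρ0 : 0 < ρ := by positivity
  have hρinv : 2 / δ * l = ρ⁻¹ := by rw [hρ]; field_simp
  have hcut : IsLocalizedSymbol (n + 1) (fun y => t * χ ((2 / δ * l) • y)) ρ (t * C₃) := by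
    rw [hρinv]
    have := (hloc ρ hρ0).const_mul t
    rwa [abs_of_nonneg ht] at this
  have hcutK := hker _ _ _ hρ0 hcut.ofReal
  have hcuti : Integrable (fun y => t * χ ((2 / δ * l) • y)) :=
    hcut.contDiff.continuous.integrable_of_hasCompactSupport hcut.hasCompactSupport
  have hlowi := integrable_lowFrequencySymbol hn ha hχ ht
  have hmi : Integrable m := hlowi.sub hcuti
  have hm0 : ∀ ξ, δ < ‖ξ‖ → m ξ = 0 := fun ξ hξ => by
    have h1 := (hχ.eventuallyEq_zero hδ hl0 (ξ := ξ) (by nlinarith)).eq_of_nhds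
    simp only [hm]
    rw [h1, lowFrequencySymbol_eq_zero hχ hδ t ξ hξ]
    simp
  refine convolutorNorm_le fun f hf => ?_
  have hfne : eLpNorm f p volume ≠ ∞ := by rw [hf]; simp
  have hsplit : conv (lowFrequencyKernel a χ δ t) f =
      conv (inverseFourier fun ξ => (m ξ : ℂ)) f +
        conv (inverseFourier fun ξ => ((t * χ ((2 / δ * l) • ξ) : ℝ) : ℂ)) f := by
    have hi : ∀ g : EuclideanSpace ℝ (Fin n) → ℝ, Integrable g → ∀ x,
        Integrable fun y => inverseFourier (fun ξ => (g ξ : ℂ)) y * f (x - y) := fun g hg x =>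
      integrable_conv_integrand (continuous_inverseFourier hg.ofReal).aestronglyMeasurable
        (norm_inverseFourier_le _) f.integrable x
    have hb : ∀ g : EuclideanSpace ℝ (Fin n) → ℝ, Integrable g → ∀ y : EuclideanSpace ℝ (Fin n),
        Integrable fun ξ => Complex.exp (Complex.I * (⟪y, ξ⟫ : ℝ)) * (g ξ : ℂ) := fun g hg y => by
      refine hg.ofReal.bdd_mul (c := 1) (by fun_prop) (Filter.Eventually.of_forall fun ξ => ?_)
      rw [mul_comm, Complex.norm_exp_ofReal_mul_I]
    have hK : ∀ y, lowFrequencyKernel a χ δ t y = inverseFourier (fun ξ => (m ξ : ℂ)) y +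
        inverseFourier (fun ξ => ((t * χ ((2 / δ * l) • ξ) : ℝ) : ℂ)) y := fun y => by
      rw [lowFrequencyKernel]
      simp only [inverseFourier]
      rw [← mul_add, ← integral_add (hb _ hmi y) (hb _ hcuti y)]
      congr 2
      funext ξ
      rw [← mul_add, ← Complex.ofReal_add]
      simp only [hm, lowFrequencySymbol]
      congr 2
      ring
    funext x
    rw [Pi.add_apply]
    simp only [conv_apply]
    rw [← integral_add (hi _ hmi x) (hi _ hcuti x)]
    congr 1
    funext y
    rw [hK, add_mul]
  rw [hsplit]
  refine (eLpNorm_add_le (aestronglyMeasurable_conv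
    (continuous_inverseFourier hmi.ofReal).aestronglyMeasurable f.integrable.aestronglyMeasurable)
    (aestronglyMeasurable_conv hcutK.continuous.aestronglyMeasurable
      f.integrable.aestronglyMeasurable) (hp.trans hpq)).trans ?_
  have h2 := hcutK.eLpNorm_conv_le hρ0 (by positivity) f.integrable.aestronglyMeasurable hp hpq hfne
  rw [hf, mul_one, ← hGdef] at h2
  have h1 := hmul m (fun R => C₁ * (2 ^ θ₀ * min ((1 + t) ^ (2 : ℝ) * R ^ θ₀) (R ^ (-θ₀))))
    (C₁ * 2 ^ θ₀ * C₄ * (1 + t) ^ (1 - G / θ₀)) p q f hp hpq hmi hm0 (fun R hR => by positivity)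
    ?_ ?_ f.integrable hfne
  · rw [hf, mul_one] at h1
    refine (add_le_add h1 h2).trans ?_
    rw [← ENNReal.ofReal_add (by positivity) (by positivity)]
    refine ENNReal.ofReal_le_ofReal ?_
    have hpow : ρ ^ G = (δ / 2) ^ G * (1 + t) ^ (-(G / θ₀)) := by
      rw [hρ, Real.div_rpow (by positivity) hl0.le, hl, ← Real.rpow_mul hτ.le, div_eq_mul_inv,
        ← Real.rpow_neg hτ.le]
      congr 3
      ring
    have hle : t * (1 + t) ^ (-(G / θ₀)) ≤ (1 + t) ^ (1 - G / θ₀) := by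
      rw [sub_eq_add_neg, Real.rpow_add hτ, Real.rpow_one]
      gcongr
      linarith
    have hpos : 0 ≤ (1 + t) ^ (1 - G / θ₀) := by positivity
    calc _ = C₂ * (C₁ * 2 ^ θ₀ * C₄) * (1 + t) ^ (1 - G / θ₀) +
          C₅ * C₃ * (δ / 2) ^ G * (t * (1 + t) ^ (-(G / θ₀))) := by rw [hpow]; ring
      _ ≤ C₂ * (C₁ * 2 ^ θ₀ * C₄) * (1 + t) ^ (1 - G / θ₀) +
          C₅ * C₃ * (δ / 2) ^ G * (1 + t) ^ (1 - G / θ₀) := by gcongr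
      _ = D * (1 + t) ^ (1 - G / θ₀) := by rw [hD]; ring
      _ ≤ _ := by nlinarith
  · intro R hR hRδ ξ h3 h4
    have hr : 0 < ‖ξ‖ := by linarith
    refine (hsym t ht ξ (norm_pos_iff.1 hr)).mono ?_
    gcongr
    rw [mul_min_of_nonneg _ _ (by positivity)]
    refine min_le_min ?_ ?_
    · calc (1 + t) ^ (2 : ℝ) * ‖ξ‖ ^ θ₀ ≤ (1 + t) ^ (2 : ℝ) * (2 * R) ^ θ₀ := by gcongr
        _ = _ := by rw [Real.mul_rpow (by norm_num) hR.le]; ring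
    · calc ‖ξ‖ ^ (-θ₀) ≤ (R / 2) ^ (-θ₀) :=
            Real.rpow_le_rpow_of_nonpos (by positivity) h3 (by linarith)
        _ = 2 ^ θ₀ * R ^ (-θ₀) := by
            rw [Real.div_rpow hR.le (by norm_num), Real.rpow_neg (by norm_num : (0 : ℝ) ≤ 2)]
            field_simp
  · intro N
    set y := l * δ with hy
    have hterm : ∀ j : ℕ, C₁ * (2 ^ θ₀ * min ((1 + t) ^ (2 : ℝ) * (δ * (1 / 2) ^ j) ^ θ₀)
        ((δ * (1 / 2) ^ j) ^ (-θ₀))) * (δ * (1 / 2) ^ j) ^ G =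
        C₁ * 2 ^ θ₀ * (1 + t) ^ (1 - G / θ₀) *
          min ((y * (1 / 2) ^ j) ^ (θ₀ + G)) ((y * (1 / 2) ^ j) ^ (-(θ₀ - G))) := by
      intro j
      set R := δ * (1 / 2 : ℝ) ^ j with hR
      have hR0 : 0 < R := by positivity
      have ez : y * (1 / 2) ^ j = l * R := by rw [hy, hR]; ring
      have hlpow : ∀ s : ℝ, l ^ s = (1 + t) ^ (s / θ₀) := fun s => by
        rw [hl, ← Real.rpow_mul hτ.le]; congr 1; ring
      have e1 : (1 + t) ^ (1 - G / θ₀) * (l * R) ^ (θ₀ + G) =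
          (1 + t) ^ (2 : ℝ) * R ^ θ₀ * R ^ G := by
        rw [Real.mul_rpow hl0.le hR0.le, hlpow, ← mul_assoc, ← Real.rpow_add hτ,
          Real.rpow_add hR0, mul_assoc]
        congr 2
        field_simp
        ring
      have e2 : (1 + t) ^ (1 - G / θ₀) * (l * R) ^ (-(θ₀ - G)) = R ^ (-θ₀) * R ^ G := by
        rw [Real.mul_rpow hl0.le hR0.le, hlpow, ← mul_assoc, ← Real.rpow_add hτ,
          ← Real.rpow_add hR0]
        have : 1 - G / θ₀ + -(θ₀ - G) / θ₀ = 0 := by field_simp; ring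
        rw [this, Real.rpow_zero, one_mul]
        congr 1
        ring
      rw [ez, mul_assoc (C₁ * 2 ^ θ₀),
        mul_min_of_nonneg _ _ (by positivity : 0 ≤ (1 + t) ^ (1 - G / θ₀)),
        e1, e2, ← min_mul_of_nonneg _ _ (by positivity : 0 ≤ R ^ G)]
      ring
    refine (Finset.sum_le_sum fun j _ => (hterm j).le).trans ?_
    rw [← Finset.mul_sum]
    calc _ ≤ C₁ * 2 ^ θ₀ * (1 + t) ^ (1 - G / θ₀) * C₄ := by
          gcongr
          exact hsum y N (by positivity)
      _ = _ := by ring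

end SummableCases

/-! ### Distribution functions -/

section Distribution

/-- The layer-cake formula for the measure with density `‖f‖`. -/
lemma lintegral_setLIntegral_lt_enorm_mul {α : Type*} [MeasurableSpace α] {μ : Measure α}
    {f : α → ℂ} (hf : Measurable f) {p σ b : ℝ} (hp : 1 < p) (hσ : 0 < σ) (hb : 0 < b) :
    ∫⁻ t in Set.Ioi (0 : ℝ), (∫⁻ x in {x | b * t ^ σ < ‖f x‖}, ‖f x‖ₑ ∂μ) *
        ENNReal.ofReal (t ^ (σ * (p - 1) - 1)) =
      ENNReal.ofReal (b ^ (-(p - 1)) / (σ * (p - 1))) * ∫⁻ x, ‖f x‖ₑ ^ p ∂μ := by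
  have hp1 : 0 < p - 1 := by linarith
  set m := σ * (p - 1) with hm
  have hm0 : 0 < m := by positivity
  set ν := μ.withDensity fun x => ‖f x‖ₑ with hν
  set h : α → ℝ := fun x => (‖f x‖ / b) ^ (1 / σ) with hh
  have hhm : Measurable h := (hf.norm.div_const b).pow_const _
  have key := lintegral_rpow_eq_lintegral_meas_lt_mul ν (f := h)
    (Filter.Eventually.of_forall fun x => by simp only [hh]; positivity) hhm.aemeasurable hm0
  have e1 : ∫⁻ t in Set.Ioi (0 : ℝ), (∫⁻ x in {x | b * t ^ σ < ‖f x‖}, ‖f x‖ₑ ∂μ) *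
        ENNReal.ofReal (t ^ (m - 1)) =
      ∫⁻ t in Set.Ioi (0 : ℝ), ν {x | t < h x} * ENNReal.ofReal (t ^ (m - 1)) := by
    refine setLIntegral_congr_fun measurableSet_Ioi fun t (ht : 0 < t) => ?_
    have e : {x | b * t ^ σ < ‖f x‖} = {x | t < h x} := by
      ext x
      simp only [Set.mem_ofPred_eq, hh]
      rw [mul_comm, ← lt_div_iff₀ hb, one_div,
        Real.lt_rpow_inv_iff_of_pos ht.le (by positivity) hσ]
    rw [e, hν, withDensity_apply _ (measurableSet_lt measurable_const hhm)]
  have e2 : ∫⁻ x, ENNReal.ofReal (h x ^ m) ∂ν =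
      ENNReal.ofReal (b ^ (-(p - 1))) * ∫⁻ x, ‖f x‖ₑ ^ p ∂μ := by
    rw [hν, lintegral_withDensity_eq_lintegral_mul _ hf.enorm
      ((hhm.pow_const m).ennreal_ofReal), ← lintegral_const_mul _ (hf.enorm.pow_const p)]
    refine lintegral_congr fun x => ?_
    have e3 : h x ^ m = b ^ (-(p - 1)) * ‖f x‖ ^ (p - 1) := by
      simp only [hh]
      rw [← Real.rpow_mul (by positivity), hm]
      have : 1 / σ * (σ * (p - 1)) = p - 1 := by field_simp
      rw [this, Real.div_rpow (norm_nonneg _) hb.le, Real.rpow_neg hb.le, div_eq_inv_mul]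
    rw [Pi.mul_apply, e3, ENNReal.ofReal_mul (by positivity),
      ← ENNReal.ofReal_rpow_of_nonneg (norm_nonneg _) hp1.le, ofReal_norm, mul_left_comm]
    congr 1
    nth_rw 1 [← ENNReal.rpow_one ‖f x‖ₑ]
    rw [← ENNReal.rpow_add_of_nonneg _ _ zero_le_one hp1.le]
    congr 1
    ring
  rw [e1]
  rw [e2] at key
  have hmt : ENNReal.ofReal m ≠ 0 := by simpa using hm0
  rw [ENNReal.ofReal_div_of_pos hm0, div_eq_mul_inv, mul_right_comm, key, mul_comm, ← mul_assoc,
    ENNReal.inv_mul_cancel hmt ENNReal.ofReal_ne_top, one_mul]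

end Distribution

/-! ### The critical scaling gap -/

section Critical

variable {n : ℕ} {a χ m : EuclideanSpace ℝ (Fin n) → ℝ} {θ₀ a₁ C₀ δ : ℝ}

/-- A weak-type bound at every level. The dyadic sum is split at the frequency `ρ` for which the low
frequencies contribute at most `lam / 4` uniformly; in the high-frequency part the function is
truncated at the height `b * lam ^ (q / p)`. -/
lemma exists_volume_lt_conv_sum_le (hn : 1 ≤ n) (hδ : 0 < δ) {p q : ℝ≥0∞} (hp : 1 < p)
    (hpq : p < q) (hq : q ≠ ∞) {B : ℝ} (hB : 0 < B) :
    ∃ b c, 0 < b ∧ 0 < c ∧ ∀ (k : ℕ → EuclideanSpace ℝ (Fin n) → ℂ),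
      (∀ j, IsScaleKernel (k j) (δ * (1 / 2) ^ j)
        (B * (δ * (1 / 2) ^ j) ^ (-scalingGap n p q))) →
      ∀ (N : ℕ) (f : EuclideanSpace ℝ (Fin n) → ℂ), Measurable f → Integrable f →
      eLpNorm f p = 1 → ∀ lam : ℝ, 0 < lam →
        volume {x | lam < ‖conv (fun x => ∑ j ∈ Finset.range N, k j x) f x‖} ≤
          ENNReal.ofReal (c * lam ^ (-(q.toReal / p.toReal))) *
            ∫⁻ x in {x | b * lam ^ (q.toReal / p.toReal) < ‖f x‖}, ‖f x‖ₑ := by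
  have hpt : p ≠ ∞ := (hpq.trans_le le_top).ne
  have hpr0 : 1 < p.toReal := by
    rw [← ENNReal.toReal_one]; exact (ENNReal.toReal_lt_toReal (by simp) hpt).2 hp
  have hqr : p.toReal < q.toReal := (ENNReal.toReal_lt_toReal hpt hq).2 hpq
  have hn0 : (0 : ℝ) < n := by exact_mod_cast hn
  set P := p.toReal with hP
  set Q := q.toReal with hQ
  have hP0 : 0 < P := by linarith
  have hQ0 : 0 < Q := by linarith
  set θ := scalingGap n p q with hθ
  have hθe : θ = n / P - n / Q := by
    rw [hθ, scalingGap, ENNReal.toReal_inv, ENNReal.toReal_inv]; ring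
  have hθ0 : 0 < θ := by
    rw [hθe, sub_pos]
    gcongr
  have hnQ : 0 < n / Q := by positivity
  obtain ⟨D, hD, hsum⟩ := exists_sum_min_rpow_le hnQ hθ0
  set c₁ := 4 * (B * D) + 1 with hc₁
  have hc₁0 : 0 < c₁ := by positivity
  -- `b * lam ^ (Q / P) = lam * ρ ^ θ / c₁` for `ρ ^ (n / Q) = lam / c₁`
  refine ⟨c₁ ^ (-(Q / P)), c₁ ^ (Q / P), by positivity, by positivity,
    fun k hk N f hfm hf hf1 lam hlam => ?_⟩
  have hR : ∀ j : ℕ, 0 < δ * (1 / 2 : ℝ) ^ j := fun j => by positivity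
  set R : ℕ → ℝ := fun j => δ * (1 / 2 : ℝ) ^ j with hRdef
  have hA : ∀ j, 0 ≤ B * R j ^ (-θ) := fun j => mul_nonneg hB.le (Real.rpow_nonneg (hR j).le _)
  set ρ := (lam / c₁) ^ (Q / n) with hρ
  have hρ0 : 0 < ρ := by positivity
  have hρ1 : ρ ^ (n / Q : ℝ) = lam / c₁ := by
    rw [hρ, ← Real.rpow_mul (by positivity)]
    have : Q / n * (n / Q) = 1 := by field_simp
    rw [this, Real.rpow_one]
  have hρ2 : lam / c₁ * ρ ^ θ = (lam / c₁) ^ (Q / P) := by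
    rw [hρ, ← Real.rpow_mul (by positivity)]
    nth_rw 1 [← Real.rpow_one (lam / c₁)]
    rw [← Real.rpow_add (by positivity), hθe]
    congr 1
    field_simp
    ring
  set s := (lam / c₁) ^ (Q / P) with hs
  have hs0 : 0 < s := by positivity
  have hse : c₁ ^ (-(Q / P)) * lam ^ (Q / P) = s := by
    rw [hs, Real.div_rpow hlam.le hc₁0.le, Real.rpow_neg hc₁0.le]; ring
  have hse' : c₁ ^ (Q / P) * lam ^ (-(Q / P)) = s⁻¹ := by
    rw [hs, Real.div_rpow hlam.le hc₁0.le, Real.rpow_neg hlam.le]; field_simp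
  rw [hse, hse']
  have hterm : ∀ j, min ((δ / ρ * (1 / 2) ^ j) ^ (n / Q : ℝ)) ((δ / ρ * (1 / 2) ^ j) ^ (-θ)) =
      min ((R j / ρ) ^ (n / Q : ℝ)) ((R j / ρ) ^ (-θ)) := fun j => by
    have : δ / ρ * (1 / 2) ^ j = R j / ρ := by simp only [hRdef]; ring
    rw [this]
  have hsumN : ∑ j ∈ Finset.range N, min ((R j / ρ) ^ (n / Q : ℝ)) ((R j / ρ) ^ (-θ)) ≤ D := by
    have := hsum (δ / ρ) N (by positivity)
    simpa only [hterm] using this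
  -- `K₀` collects the low frequencies, `K₁` the high ones.
  set L := (Finset.range N).filter fun j => R j ≤ ρ with hL
  set H := (Finset.range N).filter fun j => ¬ R j ≤ ρ with hH
  set K₀ : EuclideanSpace ℝ (Fin n) → ℂ := fun x => ∑ j ∈ L, k j x with hK₀
  set K₁ : EuclideanSpace ℝ (Fin n) → ℂ := fun x => ∑ j ∈ H, k j x with hK₁
  have hK₁c : Continuous K₁ := continuous_finsetSum _ fun j _ => (hk j).continuous
  have hnn : ∀ j, 0 ≤ min ((R j / ρ) ^ (n / Q : ℝ)) ((R j / ρ) ^ (-θ)) := fun j => by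
    have := hR j
    have : 0 < R j / ρ := by positivity
    positivity
  have hlowsum : ∑ j ∈ L, B * R j ^ (-θ) * R j ^ scalingGap n p ∞ ≤ lam / 4 := by
    have hb : ∀ j ∈ L, B * R j ^ (-θ) * R j ^ scalingGap n p ∞ ≤
        B * ρ ^ (n / Q : ℝ) * min ((R j / ρ) ^ (n / Q : ℝ)) ((R j / ρ) ^ (-θ)) := by
      intro j hj
      have hRj := hR j
      have hz : 0 < R j / ρ := by positivity
      have hz1 : R j / ρ ≤ 1 := by
        rw [div_le_one hρ0]; exact (Finset.mem_filter.1 hj).2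
      have e1 : scalingGap n p ∞ = n / P := by simp [scalingGap, div_eq_mul_inv, hP]
      rw [min_eq_left (Real.rpow_le_rpow_of_exponent_ge hz hz1 (by linarith)), mul_assoc,
        mul_assoc, ← Real.rpow_add hRj, ← Real.mul_rpow hρ0.le hz.le, mul_div_cancel₀ _ hρ0.ne',
        e1, hθe]
      apply le_of_eq
      congr 2
      ring
    calc _ ≤ ∑ j ∈ L, B * ρ ^ (n / Q : ℝ) * min ((R j / ρ) ^ (n / Q : ℝ)) ((R j / ρ) ^ (-θ)) :=
          Finset.sum_le_sum hb
      _ ≤ B * ρ ^ (n / Q : ℝ) * D := by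
          rw [← Finset.mul_sum]
          gcongr
          exact (Finset.sum_le_sum_of_subset_of_nonneg (Finset.filter_subset _ _)
            fun j _ _ => hnn j).trans hsumN
      _ = lam * (B * D / c₁) := by rw [hρ1]; ring
      _ ≤ lam * (1 / 4) := by
          refine mul_le_mul_of_nonneg_left ?_ hlam.le
          rw [div_le_div_iff₀ hc₁0 (by norm_num), hc₁]
          linarith
      _ = _ := by ring
  have hhighsum : ∑ j ∈ H, B * R j ^ (-θ) ≤ B * D * ρ ^ (-θ) := by
    have hb : ∀ j ∈ H, B * R j ^ (-θ) ≤
        B * ρ ^ (-θ) * min ((R j / ρ) ^ (n / Q : ℝ)) ((R j / ρ) ^ (-θ)) := by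
      intro j hj
      have hRj := hR j
      have hz : 0 < R j / ρ := by positivity
      have hz1 : 1 ≤ R j / ρ := by
        rw [one_le_div hρ0]; exact (not_le.1 (Finset.mem_filter.1 hj).2).le
      rw [min_eq_right (Real.rpow_le_rpow_of_exponent_le hz1 (by linarith)), mul_assoc,
        ← Real.mul_rpow hρ0.le hz.le, mul_div_cancel₀ _ hρ0.ne']
    calc _ ≤ ∑ j ∈ H, B * ρ ^ (-θ) * min ((R j / ρ) ^ (n / Q : ℝ)) ((R j / ρ) ^ (-θ)) :=
          Finset.sum_le_sum hb
      _ ≤ B * ρ ^ (-θ) * D := by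
          rw [← Finset.mul_sum]
          gcongr
          exact (Finset.sum_le_sum_of_subset_of_nonneg (Finset.filter_subset _ _)
            fun j _ _ => hnn j).trans hsumN
      _ = _ := by ring
  have hlow : ∀ᵐ x, ‖conv K₀ f x‖ ≤ lam / 4 := by
    have h1 := eLpNorm_conv_sum_le hk hR hA hf hp.le le_top (by rw [hf1]; simp) L
    rw [hf1, mul_one, eLpNorm_exponent_top] at h1
    filter_upwards [ae_le_eLpNormEssSup (f := conv K₀ f) (μ := volume)] with x hx
    have h2 := hx.trans (h1.trans (ENNReal.ofReal_le_ofReal hlowsum))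
    rw [← ofReal_norm] at h2
    exact (ENNReal.ofReal_le_ofReal_iff (by positivity)).1 h2
  have hK₁1 : ∫⁻ x, ‖K₁ x‖ₑ ≤ ENNReal.ofReal (B * D * ρ ^ (-θ)) := by
    calc ∫⁻ x, ‖K₁ x‖ₑ ≤ ∫⁻ x, ∑ j ∈ H, ‖k j x‖ₑ :=
          lintegral_mono fun x => enorm_sum_le _ _
      _ = ∑ j ∈ H, ∫⁻ x, ‖k j x‖ₑ :=
          lintegral_finsetSum' _ fun j _ => (hk j).continuous.aestronglyMeasurable.enorm
      _ ≤ ∑ j ∈ H, ENNReal.ofReal (B * R j ^ (-θ)) := Finset.sum_le_sum fun j _ =>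
          (hk j).lintegral_le
      _ = ENNReal.ofReal (∑ j ∈ H, B * R j ^ (-θ)) :=
          (ENNReal.ofReal_sum_of_nonneg fun j _ => hA j).symm
      _ ≤ _ := ENNReal.ofReal_le_ofReal hhighsum
  have hS : MeasurableSet {x | s < ‖f x‖} := measurableSet_lt measurable_const hfm.norm
  -- Truncation at the height `s` keeps the image of the bounded part `f₀` under `K₁` below
  -- `lam / 4`, so that only the `L¹` norm of `f₁` enters Chebyshev's inequality.
  set f₁ := {x | s < ‖f x‖}.indicator f with hf₁
  set f₀ := {x | s < ‖f x‖}ᶜ.indicator f with hf₀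
  have hf₁i : Integrable f₁ := hf.indicator hS
  have hf₀i : Integrable f₀ := hf.indicator hS.compl
  have hf₀b : ∀ x, ‖f₀ x‖ₑ ≤ ENNReal.ofReal s := fun x => by
    rw [← ofReal_norm]
    refine ENNReal.ofReal_le_ofReal ?_
    simp only [hf₀]
    by_cases hx : s < ‖f x‖
    · simp [hx, hs0.le]
    · simp only [Set.indicator, Set.mem_compl_iff, Set.mem_ofPred_eq, hx, not_false_eq_true,
        if_true]
      exact not_lt.1 hx
  have hK₁b : ∃ M, ∀ x, ‖K₁ x‖ ≤ M :=
    ⟨_, fun x => norm_sum_le_of_le H fun j _ => (hk j).norm_le x⟩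
  obtain ⟨M, hM⟩ := hK₁b
  have hmid : ∀ x, ‖conv K₁ f₀ x‖ ≤ lam / 4 := by
    intro x
    have h1 : ‖conv K₁ f₀ x‖ₑ ≤ ENNReal.ofReal (lam / 4) := by
      refine (enorm_conv_le K₁ f₀ x).trans ?_
      calc _ ≤ ∫⁻ y, ‖K₁ y‖ₑ * ENNReal.ofReal s := by
            refine lintegral_mono fun y => ?_
            gcongr
            exact hf₀b _
        _ = (∫⁻ y, ‖K₁ y‖ₑ) * ENNReal.ofReal s :=
            lintegral_mul_const'' _ hK₁c.aestronglyMeasurable.enorm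
        _ ≤ ENNReal.ofReal (B * D * ρ ^ (-θ)) * ENNReal.ofReal s := by gcongr
        _ = ENNReal.ofReal (lam * (B * D / c₁)) := by
            rw [← ENNReal.ofReal_mul (by positivity), ← hρ2, Real.rpow_neg hρ0.le]
            congr 1
            have : ρ ^ θ ≠ 0 := by positivity
            field_simp
        _ ≤ _ := by
            refine ENNReal.ofReal_le_ofReal ?_
            rw [div_eq_mul_one_div lam 4]
            refine mul_le_mul_of_nonneg_left ?_ hlam.le
            rw [div_le_div_iff₀ hc₁0 (by norm_num), hc₁]
            linarith
    rw [← ofReal_norm] at h1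
    exact (ENNReal.ofReal_le_ofReal_iff (by positivity)).1 h1
  have hdec : ∀ x, conv (fun x => ∑ j ∈ Finset.range N, k j x) f x =
      conv K₀ f x + (conv K₁ f₀ x + conv K₁ f₁ x) := by
    intro x
    have e1 : conv (fun x => ∑ j ∈ Finset.range N, k j x) f = conv K₀ f + conv K₁ f := by
      rw [hK₀, hK₁, conv_sum hk hf, conv_sum hk hf, conv_sum hk hf]
      exact (Finset.sum_filter_add_sum_filter_not _ _ _).symm
    rw [e1, Pi.add_apply]
    congr 1
    simp only [conv_apply]
    rw [← integral_add (integrable_conv_integrand hK₁c.aestronglyMeasurable hM hf₀i x)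
      (integrable_conv_integrand hK₁c.aestronglyMeasurable hM hf₁i x)]
    congr 1
    funext y
    rw [← mul_add]
    congr 1
    exact (congrFun (Set.indicator_compl_add_self {x | s < ‖f x‖} f) (x - y)).symm
  have hsub : ∀ᵐ x, x ∈ {x | lam < ‖conv (fun x => ∑ j ∈ Finset.range N, k j x) f x‖} →
      x ∈ {x | ENNReal.ofReal (lam / 2) ≤ ‖conv K₁ f₁ x‖ₑ} := by
    filter_upwards [hlow] with x hx h1
    rw [hdec x] at h1
    rw [← ofReal_norm]
    refine ENNReal.ofReal_le_ofReal ?_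
    have h2 := norm_add_le (conv K₀ f x) (conv K₁ f₀ x + conv K₁ f₁ x)
    have h3 := norm_add_le (conv K₁ f₀ x) (conv K₁ f₁ x)
    have h4 := hmid x
    linarith
  refine (measure_mono_ae hsub).trans ?_
  have hcheb := meas_ge_le_lintegral_div (μ := volume) (f := fun x => ‖conv K₁ f₁ x‖ₑ)
    (aestronglyMeasurable_conv hK₁c.aestronglyMeasurable hf₁i.aestronglyMeasurable).enorm
    (ε := ENNReal.ofReal (lam / 2)) (by simpa using hlam) ENNReal.ofReal_ne_top
  refine hcheb.trans ?_
  have hY : ∫⁻ x, ‖conv K₁ f₁ x‖ₑ ≤ ENNReal.ofReal (B * D * ρ ^ (-θ)) *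
      ∫⁻ x in {x | s < ‖f x‖}, ‖f x‖ₑ := by
    have h1 := eLpNorm_conv_le hK₁c.aestronglyMeasurable hf₁i.aestronglyMeasurable (le_refl 1)
    rw [eLpNorm_one_eq_lintegral_enorm, eLpNorm_one_eq_lintegral_enorm] at h1
    have e : ∫⁻ x, ‖f₁ x‖ₑ = ∫⁻ x in {x | s < ‖f x‖}, ‖f x‖ₑ := by
      rw [← lintegral_indicator hS]
      refine lintegral_congr fun x => ?_
      simp only [hf₁]
      exact enorm_indicator_eq_indicator_enorm _ _
    rw [e] at h1
    exact h1.trans (by gcongr)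
  calc _ ≤ (ENNReal.ofReal (B * D * ρ ^ (-θ)) * ∫⁻ x in {x | s < ‖f x‖}, ‖f x‖ₑ) /
        ENNReal.ofReal (lam / 2) := by gcongr
    _ = ENNReal.ofReal (B * D * ρ ^ (-θ) / (lam / 2)) * ∫⁻ x in {x | s < ‖f x‖}, ‖f x‖ₑ := by
        rw [ENNReal.ofReal_div_of_pos (y := lam / 2) (by positivity), ENNReal.div_eq_inv_mul,
          ENNReal.div_eq_inv_mul, ← mul_assoc]
    _ ≤ _ := by
        gcongr
        have hρθ : 0 < ρ ^ θ := by positivity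
        rw [← hρ2, Real.rpow_neg hρ0.le]
        have e : B * D * (ρ ^ θ)⁻¹ / (lam / 2) = 2 * (B * D) * (lam * ρ ^ θ)⁻¹ := by
          field_simp
        have e' : (lam / c₁ * ρ ^ θ)⁻¹ = c₁ * (lam * ρ ^ θ)⁻¹ := by
          field_simp
        rw [e, e']
        gcongr
        rw [hc₁]
        nlinarith [mul_nonneg hB.le hD]

/-- The Hardy–Littlewood–Sobolev inequality for dyadic sums of kernels of critical size. -/
lemma exists_eLpNorm_conv_sum_le_of_critical (hn : 1 ≤ n) (hδ : 0 < δ) {p q : ℝ≥0∞} (hp : 1 < p)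
    (hpq : p < q) (hq : q ≠ ∞) {B : ℝ} (hB : 0 < B) :
    ∃ C, 0 < C ∧ ∀ (k : ℕ → EuclideanSpace ℝ (Fin n) → ℂ),
      (∀ j, IsScaleKernel (k j) (δ * (1 / 2) ^ j)
        (B * (δ * (1 / 2) ^ j) ^ (-scalingGap n p q))) →
      ∀ (N : ℕ) (f : EuclideanSpace ℝ (Fin n) → ℂ), Measurable f → Integrable f →
      eLpNorm f p = 1 →
        eLpNorm (conv (fun x => ∑ j ∈ Finset.range N, k j x) f) q ≤ ENNReal.ofReal C := by
  have hpt : p ≠ ∞ := (hpq.trans_le le_top).ne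
  have hpr0 : 1 < p.toReal := by
    rw [← ENNReal.toReal_one]; exact (ENNReal.toReal_lt_toReal (by simp) hpt).2 hp
  have hqr : p.toReal < q.toReal := (ENNReal.toReal_lt_toReal hpt hq).2 hpq
  obtain ⟨b, c, hb, hc, hweak⟩ := exists_volume_lt_conv_sum_le hn hδ hp hpq hq hB
  set P := p.toReal with hP
  set Q := q.toReal with hQ
  have hP0 : 0 < P := by linarith
  have hQ0 : 0 < Q := by linarith
  have hP1 : 0 < P - 1 := by linarith
  set σ := Q / P with hσ
  have hσ0 : 0 < σ := by positivity
  set D := Q * (c * (b ^ (-(P - 1)) / (σ * (P - 1)))) with hD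
  have hD0 : 0 < D := by positivity
  refine ⟨D ^ (1 / Q), by positivity, fun k hk N f hfm hf hf1 => ?_⟩
  set F := conv (fun x => ∑ j ∈ Finset.range N, k j x) f with hF
  have hFm : AEStronglyMeasurable F := aestronglyMeasurable_conv
    (continuous_finsetSum _ fun j _ => (hk j).continuous).aestronglyMeasurable
    hf.aestronglyMeasurable
  have hp0 : p ≠ 0 := (zero_lt_one.trans hp).ne'
  have hq0 : q ≠ 0 := (zero_lt_one.trans (hp.trans hpq)).ne'
  have hfint : ∫⁻ x, ‖f x‖ₑ ^ P = 1 := by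
    rw [eLpNorm_eq_lintegral_rpow_enorm_toReal hp0 hpt, ← hP] at hf1
    have := congrArg (· ^ P) hf1
    simpa [← ENNReal.rpow_mul, hP0.ne'] using this
  have hcake := lintegral_rpow_eq_lintegral_meas_lt_mul volume (f := fun x => ‖F x‖)
    (Filter.Eventually.of_forall fun x => norm_nonneg _) hFm.norm.aemeasurable hQ0
  have hle : ∫⁻ x, ‖F x‖ₑ ^ Q ≤ ENNReal.ofReal D := by
    calc ∫⁻ x, ‖F x‖ₑ ^ Q = ∫⁻ x, ENNReal.ofReal (‖F x‖ ^ Q) := by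
          refine lintegral_congr fun x => ?_
          rw [← ENNReal.ofReal_rpow_of_nonneg (norm_nonneg _) hQ0.le, ofReal_norm]
      _ = _ := hcake
      _ ≤ ENNReal.ofReal Q * ∫⁻ t in Set.Ioi (0 : ℝ), ENNReal.ofReal c *
            ((∫⁻ x in {x | b * t ^ σ < ‖f x‖}, ‖f x‖ₑ) *
              ENNReal.ofReal (t ^ (σ * (P - 1) - 1))) := by
          refine mul_le_mul' le_rfl ?_
          refine setLIntegral_mono' measurableSet_Ioi fun t (ht : 0 < t) => ?_
          calc _ ≤ (ENNReal.ofReal (c * t ^ (-σ)) * ∫⁻ x in {x | b * t ^ σ < ‖f x‖}, ‖f x‖ₑ) *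
                ENNReal.ofReal (t ^ (Q - 1)) := by
                gcongr
                exact hweak k hk N f hfm hf hf1 t ht
            _ = ENNReal.ofReal (c * t ^ (-σ)) * ENNReal.ofReal (t ^ (Q - 1)) *
                ∫⁻ x in {x | b * t ^ σ < ‖f x‖}, ‖f x‖ₑ := by ring
            _ = ENNReal.ofReal c * ENNReal.ofReal (t ^ (σ * (P - 1) - 1)) *
                ∫⁻ x in {x | b * t ^ σ < ‖f x‖}, ‖f x‖ₑ := by
                rw [← ENNReal.ofReal_mul (by positivity), mul_assoc, ← Real.rpow_add ht,
                  ENNReal.ofReal_mul hc.le]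
                congr 4
                rw [hσ]
                field_simp
                ring
            _ = _ := by ring
      _ = _ := by
          rw [lintegral_const_mul' _ _ ENNReal.ofReal_ne_top,
            lintegral_setLIntegral_lt_enorm_mul hfm hpr0 hσ0 hb, hfint, mul_one,
            ← ENNReal.ofReal_mul hc.le, ← ENNReal.ofReal_mul hQ0.le]
  rw [eLpNorm_eq_lintegral_rpow_enorm_toReal hq0 hq, ← hQ,
    ← ENNReal.ofReal_rpow_of_pos hD0]
  gcongr

/-- At the critical scaling gap, away from the endpoint exponents, there is no loss. -/
lemma convolutorNorm_le_of_scalingGap_eq (hn : 1 ≤ n) (hθ₀ : 0 < θ₀) (hθ₁ : θ₀ < 1)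
    (ha : IsOverdampedSymbol n a θ₀ a₁ C₀ δ) (hχ : IsCutoff χ) {p q : ℝ≥0∞} (hp : 1 < p)
    (hpq : p ≤ q) (hq : q ≠ ∞) (hG : scalingGap n p q = θ₀) :
    ∃ C : ℝ, 0 < C ∧ ∀ t : ℝ, 0 ≤ t →
      convolutorNorm p q (lowFrequencyKernel a χ δ t) ≤ ENNReal.ofReal C := by
  have hδ := ha.δ_pos
  have hpq' : p < q := by
    refine lt_of_le_of_ne hpq ?_
    rintro rfl
    simp [scalingGap] at hG
    linarith
  obtain ⟨C₁, c, hC₁, hc, hsym⟩ := exists_isSymbolAt_annulus ha hχ hθ₀.le hθ₁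
  obtain ⟨C₂, hC₂, hker⟩ := exists_isScaleKernel_dyadicKernel hχ
  obtain ⟨C, hC, hHLS⟩ := exists_eLpNorm_conv_sum_le_of_critical hn hδ hp hpq' hq
    (B := C₂ * C₁ + 1) (by positivity)
  refine ⟨C, hC, fun t ht => convolutorNorm_le fun f hf => ?_⟩
  refine eLpNorm_conv_inverseFourier_le hn hχ hδ (integrable_lowFrequencySymbol hn ha hχ ht)
    (lowFrequencySymbol_eq_zero hχ hδ t) f.integrable fun N => ?_
  refine hHLS _ (fun j => ?_) N f f.continuous.measurable f.integrable hf
  have hR : 0 < δ * (1 / 2 : ℝ) ^ j := by positivity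
  have hRle : δ * (1 / 2 : ℝ) ^ j ≤ δ :=
    mul_le_of_le_one_right hδ.le (pow_le_one₀ (by norm_num) (by norm_num))
  rw [hG]
  set R := δ * (1 / 2 : ℝ) ^ j with hRdef
  refine (hker (lowFrequencySymbol a χ δ t) R (C₁ * R ^ (-θ₀)) hR (by positivity)
    fun ξ h1 h2 => (hsym t ht R hR hRle ξ h1 h2).mono ?_).mono hR ?_
  · gcongr
    calc _ ≤ R ^ (-θ₀) * 1 := by
          gcongr
          · exact min_le_right _ _
          · exact Real.exp_le_one_iff.2 (neg_nonpos.2 (by positivity))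
      _ = _ := mul_one _
  · have : 0 < R ^ (-θ₀) := by positivity
    nlinarith

end Critical

/-! ### Fourier multipliers on `L²` -/

section LTwo

open scoped FourierTransform

variable {n : ℕ} {K f : EuclideanSpace ℝ (Fin n) → ℂ}

lemma ENNReal.le_of_forall_le_add_mul_ofReal {x y c : ℝ≥0∞} (hc : c ≠ ∞)
    (h : ∀ ε : ℝ, 0 < ε → x ≤ y + c * ENNReal.ofReal ε) : x ≤ y := by
  have h1 : Filter.Tendsto (fun ε : ℝ => y + c * ENNReal.ofReal ε) (nhdsWithin 0 (Set.Ioi 0))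
      (nhds (y + c * ENNReal.ofReal 0)) := by
    refine Filter.Tendsto.mono_left ?_ nhdsWithin_le_nhds
    refine tendsto_const_nhds.add (ENNReal.Tendsto.const_mul ?_ (Or.inr hc))
    exact ENNReal.continuous_ofReal.tendsto 0
  rw [ENNReal.ofReal_zero, mul_zero, add_zero] at h1
  exact ge_of_tendsto h1 (by filter_upwards [self_mem_nhdsWithin] with ε hε using h ε hε)

lemma conv_sub_left {E : Type*} [NormedAddCommGroup E] [InnerProductSpace ℝ E]
    [FiniteDimensional ℝ E] [MeasurableSpace E] [BorelSpace E] {K L f : E → ℂ} {x : E}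
    (hK : Integrable fun y => K y * f (x - y)) (hL : Integrable fun y => L y * f (x - y)) :
    conv (K - L) f x = conv K f x - conv L f x := by
  simp only [conv_apply]
  rw [← integral_sub hK hL]
  simp only [Pi.sub_apply, sub_mul]

lemma conv_sub_right {E : Type*} [NormedAddCommGroup E] [InnerProductSpace ℝ E]
    [FiniteDimensional ℝ E] [MeasurableSpace E] [BorelSpace E] {K f g : E → ℂ} {x : E}
    (hf : Integrable fun y => K y * f (x - y)) (hg : Integrable fun y => K y * g (x - y)) :
    conv K (f - g) x = conv K f x - conv K g x := by
  simp only [conv_apply]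
  rw [← integral_sub hf hg]
  simp only [Pi.sub_apply, mul_sub]

lemma MeasureTheory.MemLp.exists_schwartzMap_eLpNorm_sub_le {p : ℝ≥0∞} (hp : p ≠ ∞) (hp1 : 1 ≤ p)
    (hf : MemLp f p) {ε : ℝ} (hε : 0 < ε) :
    ∃ g : 𝓢(EuclideanSpace ℝ (Fin n), ℂ), eLpNorm (f - ⇑g) p volume ≤ ENNReal.ofReal ε := by
  obtain ⟨g, hg₁, hg₂, hg₃⟩ := MemLp.exist_eLpNorm_sub_le hp hp1 hf hε
  exact ⟨hg₁.toSchwartzMap hg₂, hg₃⟩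

lemma SchwartzMap.eLpNorm_two_fourier (u : 𝓢(EuclideanSpace ℝ (Fin n), ℂ)) :
    eLpNorm (⇑(𝓕 u : 𝓢(EuclideanSpace ℝ (Fin n), ℂ))) 2 volume = eLpNorm u 2 volume := by
  have h := SchwartzMap.norm_fourier_toL2_eq u
  rw [SchwartzMap.norm_toLp, SchwartzMap.norm_toLp] at h
  exact (ENNReal.toReal_eq_toReal_iff' ((𝓕 u).memLp 2 volume).eLpNorm_ne_top
    (u.memLp 2 volume).eLpNorm_ne_top).1 h

/-- The `L²` bound of a Fourier multiplier on Schwartz functions, by Plancherel's theorem. -/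
lemma SchwartzMap.eLpNorm_two_conv_le (k g : 𝓢(EuclideanSpace ℝ (Fin n), ℂ)) {M : ℝ}
    (hM : ∀ ξ, ‖𝓕 (⇑k) ξ‖ ≤ M) :
    eLpNorm (conv k g) 2 volume ≤ ENNReal.ofReal M * eLpNorm g 2 volume := by
  have e : conv k g = ⇑(SchwartzMap.convolution (ContinuousLinearMap.mul ℂ ℂ) k g) :=
    funext fun x => (SchwartzMap.convolution_apply _ k g x).symm
  rw [e, ← eLpNorm_two_fourier, ← eLpNorm_two_fourier g]
  refine eLpNorm_le_mul_eLpNorm_of_ae_le_mul (Filter.Eventually.of_forall fun ξ => ?_) 2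
  rw [SchwartzMap.fourier_convolution_apply, Real.fourier_bilin_convolution_eq _ k.integrable
    g.integrable, SchwartzMap.fourier_coe, ContinuousLinearMap.mul_apply', norm_mul]
  gcongr
  exact hM ξ

lemma SchwartzMap.eLpNorm_two_conv_le_of_memLp (k : 𝓢(EuclideanSpace ℝ (Fin n), ℂ)) {M : ℝ}
    (hM : ∀ ξ, ‖𝓕 (⇑k) ξ‖ ≤ M) (hf : Integrable f) (hf2 : MemLp f 2) :
    eLpNorm (conv k f) 2 volume ≤ ENNReal.ofReal M * eLpNorm f 2 := by
  have h12 : (1 : ℝ≥0∞) ≤ 2 := by norm_num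
  have hkb : ∀ x, ‖k x‖ ≤ SchwartzMap.seminorm ℝ 0 0 k := k.norm_le_seminorm ℝ
  have hkm : AEStronglyMeasurable k volume := k.integrable.aestronglyMeasurable
  have hk1 : ∫⁻ x, ‖k x‖ₑ ≠ ∞ := k.integrable.2.ne
  refine ENNReal.le_of_forall_le_add_mul_ofReal (c := ENNReal.ofReal M + ∫⁻ x, ‖k x‖ₑ)
    (ENNReal.add_ne_top.2 ⟨ENNReal.ofReal_ne_top, hk1⟩) fun ε hε => ?_
  obtain ⟨g, hg⟩ := hf2.exists_schwartzMap_eLpNorm_sub_le (by simp) h12 hε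
  have hgi : Integrable (f - ⇑g) := hf.sub g.integrable
  have hdec : conv k f = conv k g + conv k (f - ⇑g) := by
    funext x
    rw [Pi.add_apply, conv_sub_right (integrable_conv_integrand hkm hkb hf x)
      (integrable_conv_integrand hkm hkb g.integrable x), add_sub_cancel]
  have h1 := eLpNorm_conv_le hkm hgi.aestronglyMeasurable h12
  have h2 := SchwartzMap.eLpNorm_two_conv_le k g hM
  have h3 : eLpNorm g 2 volume ≤ eLpNorm f 2 + ENNReal.ofReal ε := by
    have h := eLpNorm_sub_le (μ := volume) hf.aestronglyMeasurable hgi.aestronglyMeasurable h12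
    rw [sub_sub_cancel] at h
    exact h.trans (by gcongr)
  rw [hdec]
  refine (eLpNorm_add_le (aestronglyMeasurable_conv hkm g.integrable.aestronglyMeasurable)
    (aestronglyMeasurable_conv hkm hgi.aestronglyMeasurable) h12).trans ?_
  calc _ ≤ ENNReal.ofReal M * (eLpNorm f 2 + ENNReal.ofReal ε) +
        (∫⁻ x, ‖k x‖ₑ) * ENNReal.ofReal ε := by
        refine add_le_add (h2.trans ?_) (h1.trans ?_) <;> gcongr
    _ = _ := by ring

lemma norm_fourier_le_of_sub {K L : EuclideanSpace ℝ (Fin n) → ℂ} (hK : Integrable K)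
    (hL : Integrable L) {M ε : ℝ} (hε : 0 ≤ ε) (hM : ∀ ξ, ‖𝓕 K ξ‖ ≤ M)
    (hKL : ∫⁻ x, ‖(K - L) x‖ₑ ≤ ENNReal.ofReal ε) (ξ : EuclideanSpace ℝ (Fin n)) :
    ‖𝓕 L ξ‖ ≤ M + ε := by
  have hki : Integrable (K - L) := hK.sub hL
  have e : 𝓕 L ξ = 𝓕 K ξ - 𝓕 (K - L) ξ := by
    rw [Real.fourier_eq, Real.fourier_eq, Real.fourier_eq, ← integral_sub]
    · congr 1
      funext x
      rw [← smul_sub, Pi.sub_apply, sub_sub_cancel]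
    · exact (Real.fourierIntegral_convergent_iff ξ).2 hK
    · exact (Real.fourierIntegral_convergent_iff ξ).2 hki
  have h1 : ‖𝓕 (K - L) ξ‖ ≤ ε := by
    have h2 : ‖𝓕 (K - L) ξ‖ ≤ ∫ x, ‖(K - L) x‖ :=
      VectorFourier.norm_fourierIntegral_le_integral_norm _ _ _ _ _
    refine h2.trans ?_
    rw [← ofReal_integral_norm_eq_lintegral_enorm hki] at hKL
    exact (ENNReal.ofReal_le_ofReal_iff hε).1 hKL
  rw [e]
  exact (norm_sub_le _ _).trans (add_le_add (hM ξ) h1)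

/-- The `L²` bound of a Fourier multiplier, by approximation of the kernel in `L¹` and of the
function in `L²`. -/
lemma eLpNorm_conv_le_of_norm_fourier_le (hK : Integrable K) {B : ℝ} (hKB : ∀ x, ‖K x‖ ≤ B)
    {M : ℝ} (hM0 : 0 ≤ M)
    (hM : ∀ ξ, ‖𝓕 K ξ‖ ≤ M) (hf : Integrable f) (hf2 : MemLp f 2) :
    eLpNorm (conv K f) 2 ≤ ENNReal.ofReal M * eLpNorm f 2 := by
  have h12 : (1 : ℝ≥0∞) ≤ 2 := by norm_num
  have hc : eLpNorm f 2 + eLpNorm f 2 ≠ ∞ :=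
    ENNReal.add_ne_top.2 ⟨hf2.eLpNorm_ne_top, hf2.eLpNorm_ne_top⟩
  refine ENNReal.le_of_forall_le_add_mul_ofReal hc fun ε hε => ?_
  obtain ⟨k, hk⟩ := (memLp_one_iff_integrable.2 hK).exists_schwartzMap_eLpNorm_sub_le
    (by simp) le_rfl hε
  rw [eLpNorm_one_eq_lintegral_enorm] at hk
  have hki : Integrable (K - ⇑k) := hK.sub k.integrable
  have hkb : ∀ x, ‖k x‖ ≤ SchwartzMap.seminorm ℝ 0 0 k := k.norm_le_seminorm ℝ
  have hdec : conv K f = conv k f + conv (K - ⇑k) f := by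
    funext x
    rw [Pi.add_apply, conv_sub_left (integrable_conv_integrand hK.aestronglyMeasurable hKB hf x)
      (integrable_conv_integrand k.integrable.aestronglyMeasurable hkb hf x),
      add_sub_cancel]
  rw [hdec]
  refine (eLpNorm_add_le (aestronglyMeasurable_conv k.integrable.aestronglyMeasurable
    hf.aestronglyMeasurable) (aestronglyMeasurable_conv hki.aestronglyMeasurable
    hf.aestronglyMeasurable) h12).trans ?_
  have h1 := eLpNorm_conv_le hki.aestronglyMeasurable hf.aestronglyMeasurable h12
  have h2 := SchwartzMap.eLpNorm_two_conv_le_of_memLp k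
    (norm_fourier_le_of_sub hK k.integrable hε.le hM hk) hf hf2
  refine (add_le_add h2 (h1.trans (mul_le_mul_left hk _))).trans (le_of_eq ?_)
  rw [ENNReal.ofReal_add hM0 hε.le, add_mul, add_mul, mul_comm (ENNReal.ofReal ε), add_assoc]

/-- The kernel `inverseFourier g`, when integrable, has the Fourier transform `g`, up to the
normalization of the frequency variable. -/
lemma fourier_inverseFourier {g : EuclideanSpace ℝ (Fin n) → ℂ} (hg : Continuous g)
    (hgi : Integrable g) (hi : Integrable (inverseFourier g)) (η : EuclideanSpace ℝ (Fin n)) :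
    𝓕 (inverseFourier g) η = g ((2 * Real.pi) • η) := by
  have hpi := Real.pi_pos
  have h2pi : (-(2 * Real.pi)⁻¹ : ℝ) ≠ 0 := by
    rw [neg_ne_zero]; positivity
  have hc : (((2 * Real.pi) ^ n)⁻¹ : ℝ) ≠ 0 := by positivity
  have e : inverseFourier g =
      fun x => (((2 * Real.pi) ^ n)⁻¹ : ℝ) * 𝓕 g (-(2 * Real.pi)⁻¹ • x) :=
    funext (inverseFourier_eq_fourier g)
  have hFi : Integrable (𝓕 g) := by
    rw [e] at hi
    have h1 : Integrable fun x => 𝓕 g (-(2 * Real.pi)⁻¹ • x) :=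
      (integrable_const_mul_iff (by simp [hpi.ne']) _).1 hi
    exact (integrable_comp_smul_iff volume (𝓕 g) h2pi).1 h1
  have hinv := congrFun (hg.fourierInv_fourier_eq hgi hFi) ((2 * Real.pi) • η)
  rw [← hinv, Real.fourier_eq, Real.fourierInv_eq, e]
  have hsub := Measure.integral_comp_smul (μ := (volume : Measure (EuclideanSpace ℝ (Fin n))))
    (fun v => Real.fourierChar ⟪v, (2 * Real.pi) • η⟫ • 𝓕 g v) (-(2 * Real.pi)⁻¹)
  rw [finrank_euclideanSpace_fin] at hsub
  have habs : |((-(2 * Real.pi)⁻¹ : ℝ) ^ n)⁻¹| = (2 * Real.pi) ^ n := by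
    rw [abs_inv, abs_pow, abs_neg, abs_of_pos (by positivity), inv_pow, inv_inv]
  rw [habs] at hsub
  have hsub' : ∫ v, Real.fourierChar ⟪v, (2 * Real.pi) • η⟫ • 𝓕 g v =
      ((((2 * Real.pi) ^ n)⁻¹ : ℝ) : ℂ) * ∫ x, Real.fourierChar
        ⟪-(2 * Real.pi)⁻¹ • x, (2 * Real.pi) • η⟫ • 𝓕 g (-(2 * Real.pi)⁻¹ • x) := by
    rw [hsub, Complex.real_smul, ← mul_assoc, ← Complex.ofReal_mul, inv_mul_cancel₀ (by positivity),
      Complex.ofReal_one, one_mul]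
  rw [hsub', ← integral_const_mul]
  congr 1
  funext x
  rw [Circle.smul_def, Circle.smul_def, smul_eq_mul, smul_eq_mul, inner_smul_left, inner_smul_right]
  have : (starRingEnd ℝ) (-(2 * Real.pi)⁻¹) * (2 * Real.pi * ⟪x, η⟫) = -⟪x, η⟫ := by
    simp only [conj_trivial]
    field_simp
  rw [this]
  ring

end LTwo

/-! ### Calderón–Zygmund kernels -/

section Hormander

variable {n : ℕ} {k : ℕ → EuclideanSpace ℝ (Fin n) → ℂ} {K : EuclideanSpace ℝ (Fin n) → ℂ}
  {R A δ : ℝ}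

lemma IsScaleKernel.hormander {K : EuclideanSpace ℝ (Fin n) → ℂ} (hR : 0 < R) (hA : 0 ≤ A)
    (hK : IsScaleKernel K R A) {y : EuclideanSpace ℝ (Fin n)} (hy : y ≠ 0) :
    ∫⁻ x in {x | 2 * ‖y‖ ≤ ‖x‖}, ‖K (x - y) - K x‖ₑ ≤
      ENNReal.ofReal (2 * A * min ((R * ‖y‖) ^ (1 : ℝ)) ((R * ‖y‖) ^ (-(1 / 2) : ℝ))) := by
  have hy0 : 0 < ‖y‖ := norm_pos_iff.2 hy
  have hz : 0 < R * ‖y‖ := by positivity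
  rcases le_total (R * ‖y‖) 1 with h | h
  · rw [min_eq_left (Real.rpow_le_rpow_of_exponent_ge hz h (by norm_num)), Real.rpow_one]
    refine (setLIntegral_le_lintegral _ _).trans ((hK.translate y h).trans ?_)
    refine ENNReal.ofReal_le_ofReal ?_
    nlinarith [mul_nonneg hA hz.le]
  · rw [min_eq_right (Real.rpow_le_rpow_of_exponent_le h (by norm_num))]
    have hS : MeasurableSet {x : EuclideanSpace ℝ (Fin n) | 2 * ‖y‖ ≤ ‖x‖} :=
      measurableSet_le measurable_const measurable_norm
    have hS' : MeasurableSet {x : EuclideanSpace ℝ (Fin n) | ‖y‖ ≤ ‖x‖} :=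
      measurableSet_le measurable_const measurable_norm
    have hm : Measurable fun x => ‖K x‖ₑ := hK.continuous.measurable.enorm
    have h1 : ∫⁻ x in {x | 2 * ‖y‖ ≤ ‖x‖}, ‖K (x - y)‖ₑ ≤ ∫⁻ x in {x | ‖y‖ ≤ ‖x‖}, ‖K x‖ₑ := by
      rw [← lintegral_indicator hS, ← lintegral_indicator hS',
        ← lintegral_sub_right_eq_self ({x | ‖y‖ ≤ ‖x‖}.indicator fun x => ‖K x‖ₑ) y]
      refine lintegral_mono fun x => ?_
      by_cases hx : 2 * ‖y‖ ≤ ‖x‖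
      · have hx' : ‖y‖ ≤ ‖x - y‖ := by
          have := norm_sub_norm_le x y
          linarith
        simp [Set.indicator, hx, hx']
      · simp [Set.indicator, hx]
    have h2 : ∫⁻ x in {x | 2 * ‖y‖ ≤ ‖x‖}, ‖K x‖ₑ ≤ ∫⁻ x in {x | ‖y‖ ≤ ‖x‖}, ‖K x‖ₑ :=
      lintegral_mono_set fun x (hx : 2 * ‖y‖ ≤ ‖x‖) => by
        change ‖y‖ ≤ ‖x‖
        linarith
    have h3 := hK.tail ‖y‖ hy0
    calc _ ≤ ∫⁻ x in {x | 2 * ‖y‖ ≤ ‖x‖}, (‖K (x - y)‖ₑ + ‖K x‖ₑ) :=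
          lintegral_mono fun x => enorm_sub_le
      _ = (∫⁻ x in {x | 2 * ‖y‖ ≤ ‖x‖}, ‖K (x - y)‖ₑ) + ∫⁻ x in {x | 2 * ‖y‖ ≤ ‖x‖}, ‖K x‖ₑ :=
          lintegral_add_right _ hm
      _ ≤ ENNReal.ofReal (A * (R * ‖y‖) ^ (-(1 / 2) : ℝ)) +
          ENNReal.ofReal (A * (R * ‖y‖) ^ (-(1 / 2) : ℝ)) :=
          add_le_add (h1.trans h3) (h2.trans h3)
      _ = _ := by
          rw [← ENNReal.ofReal_add (by positivity) (by positivity)]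
          congr 1
          ring

/-- A kernel that satisfies Hörmander's condition and is bounded on `L²` with constant `A`. The
boundedness and integrability of `K` are qualitative: they make all convolutions absolutely
convergent. -/
structure IsCalderonZygmundKernel (K : EuclideanSpace ℝ (Fin n) → ℂ) (A : ℝ) : Prop where
  continuous : Continuous K
  integrable : Integrable K
  bounded : ∃ B, ∀ x, ‖K x‖ ≤ B
  eLpNorm_two_le : ∀ f : EuclideanSpace ℝ (Fin n) → ℂ, Integrable f → MemLp f 2 →
    eLpNorm (conv K f) 2 ≤ ENNReal.ofReal A * eLpNorm f 2
  hormander : ∀ y, ∫⁻ x in {x | 2 * ‖y‖ ≤ ‖x‖}, ‖K (x - y) - K x‖ₑ ≤ ENNReal.ofReal A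

lemma IsScaleKernel.integrable (hK : IsScaleKernel K R A) : Integrable K :=
  ⟨hK.continuous.aestronglyMeasurable, hK.lintegral_le.trans_lt ENNReal.ofReal_lt_top⟩

/-- Hörmander's condition for a sum of dyadic kernels: the scales `R ≤ ‖y‖⁻¹` are controlled by the
translation bound and the others by the tail, which leaves a convergent sum on both sides. -/
lemma exists_hormander_sum_le (hδ : 0 < δ) :
    ∃ C, 0 ≤ C ∧ ∀ (k : ℕ → EuclideanSpace ℝ (Fin n) → ℂ) (A : ℝ), 0 ≤ A →
      (∀ j, IsScaleKernel (k j) (δ * (1 / 2) ^ j) A) → ∀ (N : ℕ) (y : EuclideanSpace ℝ (Fin n)),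
        ∫⁻ x in {x | 2 * ‖y‖ ≤ ‖x‖},
          ‖∑ j ∈ Finset.range N, k j (x - y) - ∑ j ∈ Finset.range N, k j x‖ₑ ≤
            ENNReal.ofReal (C * A) := by
  obtain ⟨C, hC, hsum⟩ := exists_sum_min_rpow_le (α := 1) (β := 1 / 2) one_pos (by norm_num)
  refine ⟨2 * C, by positivity, fun k A hA hk N y => ?_⟩
  rcases eq_or_ne y 0 with rfl | hy
  · simp
  have hy0 : 0 < ‖y‖ := norm_pos_iff.2 hy
  have hR : ∀ j : ℕ, 0 < δ * (1 / 2 : ℝ) ^ j := fun j => by positivity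
  calc _ ≤ ∫⁻ x in {x | 2 * ‖y‖ ≤ ‖x‖}, ∑ j ∈ Finset.range N, ‖k j (x - y) - k j x‖ₑ := by
        refine lintegral_mono fun x => ?_
        rw [← Finset.sum_sub_distrib]
        exact enorm_sum_le _ _
    _ = ∑ j ∈ Finset.range N, ∫⁻ x in {x | 2 * ‖y‖ ≤ ‖x‖}, ‖k j (x - y) - k j x‖ₑ := by
        refine lintegral_finsetSum _ fun j _ => ?_
        have := (hk j).continuous
        exact (by fun_prop : Continuous fun x => k j (x - y) - k j x).measurable.enorm
    _ ≤ ∑ j ∈ Finset.range N, ENNReal.ofReal (2 * A * min ((δ * ‖y‖ * (1 / 2) ^ j) ^ (1 : ℝ))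
          ((δ * ‖y‖ * (1 / 2) ^ j) ^ (-(1 / 2) : ℝ))) := by
        refine Finset.sum_le_sum fun j _ => ?_
        have := (hk j).hormander (hR j) hA hy
        rwa [mul_right_comm δ] at this
    _ = ENNReal.ofReal (2 * A * ∑ j ∈ Finset.range N, min ((δ * ‖y‖ * (1 / 2) ^ j) ^ (1 : ℝ))
          ((δ * ‖y‖ * (1 / 2) ^ j) ^ (-(1 / 2) : ℝ))) := by
        rw [Finset.mul_sum, ENNReal.ofReal_sum_of_nonneg fun j _ => by positivity]
    _ ≤ ENNReal.ofReal (2 * A * C) := by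
        refine ENNReal.ofReal_le_ofReal ?_
        gcongr
        exact hsum (δ * ‖y‖) N (by positivity)
    _ = _ := by congr 1; ring

/-- A multiplier that satisfies Mikhlin's condition has Calderón–Zygmund truncations, uniformly in
the number of dyadic pieces. -/
lemma exists_isCalderonZygmundKernel_sum {χ : EuclideanSpace ℝ (Fin n) → ℝ} (hχ : IsCutoff χ)
    (hδ : 0 < δ) :
    ∃ C, 0 ≤ C ∧ ∀ (m : EuclideanSpace ℝ (Fin n) → ℝ) (W : ℝ), 0 ≤ W → Integrable m →
      (∀ R, 0 < R → R ≤ δ → ∀ ξ, R / 2 ≤ ‖ξ‖ → ‖ξ‖ ≤ 2 * R → IsSymbolAt (n + 1) m ξ W) →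
      ∀ N : ℕ, IsCalderonZygmundKernel
        (fun x => ∑ j ∈ Finset.range N, dyadicKernel χ m (δ * (1 / 2) ^ j) x) (C * W) := by
  obtain ⟨C₁, hC₁, hker⟩ := exists_isScaleKernel_dyadicKernel hχ
  obtain ⟨C₂, hC₂, hhor⟩ := exists_hormander_sum_le (n := n) hδ
  obtain ⟨C₃, hC₃, hloc⟩ := exists_isLocalizedSymbol_dyadicPiece (n + 1) hχ
  obtain ⟨X, hX, hXb⟩ := hχ.exists_bound
  refine ⟨C₂ * C₁ + (X + X), by positivity, fun m W hW hm hsym N => ?_⟩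
  have hR : ∀ j : ℕ, 0 < δ * (1 / 2 : ℝ) ^ j := fun j => by positivity
  have hRle : ∀ j : ℕ, δ * (1 / 2 : ℝ) ^ j ≤ δ := fun j =>
    mul_le_of_le_one_right hδ.le (pow_le_one₀ (by norm_num) (by norm_num))
  have hk : ∀ j, IsScaleKernel (dyadicKernel χ m (δ * (1 / 2) ^ j)) (δ * (1 / 2) ^ j) (C₁ * W) :=
    fun j => hker m _ W (hR j) hW (hsym _ (hR j) (hRle j))
  set K : EuclideanSpace ℝ (Fin n) → ℂ :=
    fun x => ∑ j ∈ Finset.range N, dyadicKernel χ m (δ * (1 / 2) ^ j) x with hK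
  have hKi : Integrable K := integrable_finsetSum _ fun j _ => (hk j).integrable
  have hKb : ∀ x, ‖K x‖ ≤ ∑ j ∈ Finset.range N, C₁ * W * (δ * (1 / 2) ^ j) ^ n :=
    fun x => norm_sum_le_of_le _ fun j _ => (hk j).norm_le x
  set g : EuclideanSpace ℝ (Fin n) → ℝ := fun ξ =>
    (χ (δ⁻¹ • ξ) - χ ((δ * (1 / 2) ^ N)⁻¹ • ξ)) * m ξ with hg
  have hgK : K = inverseFourier fun ξ => (g ξ : ℂ) := funext fun x => sum_dyadicKernel hχ hm N x
  have hgc : Continuous fun ξ => (g ξ : ℂ) := by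
    have e : g = fun ξ => ∑ j ∈ Finset.range N, dyadicPiece χ m (δ * (1 / 2) ^ j) ξ :=
      funext fun ξ => (sum_dyadicPiece m δ N ξ).symm
    rw [e]
    exact Complex.continuous_ofReal.comp (continuous_finsetSum _ fun j _ =>
      (hloc m _ W (hR j) hW (hsym _ (hR j) (hRle j))).contDiff.continuous)
  have hgb : ∀ ξ, |g ξ| ≤ (X + X) * W := by
    intro ξ
    rcases eq_or_ne ξ 0 with rfl | hξ
    · simp only [hg, smul_zero, sub_self, zero_mul, abs_zero]
      positivity
    have hξ0 : 0 < ‖ξ‖ := norm_pos_iff.2 hξ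
    rcases lt_or_ge (2 * δ) ‖ξ‖ with h | h
    · have hz : ∀ r, 0 < r → r ≤ δ → χ (r⁻¹ • ξ) = 0 := fun r hr hrδ => hχ.eq_zero _ (by
        rw [norm_smul, norm_inv, Real.norm_eq_abs, abs_of_pos hr, le_inv_mul_iff₀ hr]
        linarith)
      simp only [hg]
      rw [hz δ hδ le_rfl, hz _ (hR N) (hRle N), sub_zero, zero_mul, abs_zero]
      positivity
    · have hmb : |m ξ| ≤ W := (hsym (min δ ‖ξ‖) (lt_min hδ hξ0) (min_le_left _ _) ξ
        (by linarith [min_le_right δ ‖ξ‖]) (by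
          rcases min_choice δ ‖ξ‖ with h' | h' <;> rw [h'] <;> linarith)).norm_le
      simp only [hg, abs_mul]
      gcongr
      exact (abs_sub _ _).trans (add_le_add (hXb _) (hXb _))
  refine ⟨continuous_finsetSum _ fun j _ => (hk j).continuous, hKi, ⟨_, hKb⟩,
    fun f hf hf2 => ?_, fun y => ?_⟩
  · refine (eLpNorm_conv_le_of_norm_fourier_le hKi hKb (M := (X + X) * W) (by positivity)
      (fun η => ?_) hf hf2).trans ?_
    · rw [hgK, fourier_inverseFourier hgc (integrable_cutoff_mul hχ hm _ _).ofReal (hgK ▸ hKi),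
        Complex.norm_real]
      exact hgb _
    · refine mul_le_mul_left (ENNReal.ofReal_le_ofReal ?_) _
      have : 0 ≤ C₂ * C₁ * W := by positivity
      linarith
  · refine (hhor _ (C₁ * W) (by positivity) hk N y).trans (ENNReal.ofReal_le_ofReal ?_)
    nlinarith [mul_nonneg (add_nonneg hX hX) hW]

end Hormander

/-! ### The Calderón–Zygmund decomposition -/

section Covering

variable {n : ℕ} {f : EuclideanSpace ℝ (Fin n) → ℂ} {lam : ℝ}

lemma volume_closedBall_eq (x : EuclideanSpace ℝ (Fin n)) {r : ℝ} (hr : 0 ≤ r) :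
    volume (Metric.closedBall x r) =
      ENNReal.ofReal (r ^ n) * volume (Metric.ball (0 : EuclideanSpace ℝ (Fin n)) 1) := by
  rw [Measure.addHaar_closedBall _ _ hr, finrank_euclideanSpace_fin]

lemma volume_closedBall_mul (x : EuclideanSpace ℝ (Fin n)) {r c : ℝ} (hr : 0 ≤ r) (hc : 0 ≤ c) :
    volume (Metric.closedBall x (c * r)) =
      ENNReal.ofReal (c ^ n) * volume (Metric.closedBall x r) := by
  rw [volume_closedBall_eq x hr, volume_closedBall_eq x (by positivity), mul_pow,
    ENNReal.ofReal_mul (by positivity), mul_assoc]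

lemma exists_volume_ball_one :
    ∃ v : ℝ, 0 < v ∧ volume (Metric.ball (0 : EuclideanSpace ℝ (Fin n)) 1) = ENNReal.ofReal v := by
  have h0 : 0 < volume (Metric.ball (0 : EuclideanSpace ℝ (Fin n)) 1) :=
    Metric.measure_ball_pos _ _ one_pos
  have ht : volume (Metric.ball (0 : EuclideanSpace ℝ (Fin n)) 1) ≠ ∞ := measure_ball_lt_top.ne
  exact ⟨_, ENNReal.toReal_pos h0.ne' ht, (ENNReal.ofReal_toReal ht).symm⟩

/-- Almost every point at which `‖f‖` exceeds `lam` is the centre of a ball on which the average of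
`‖f‖` exceeds `lam`, while it does not on the ball enlarged five times. -/
lemma ae_exists_stopping_radius (hn : 1 ≤ n) (hf : Integrable f) (hlam : 0 < lam) :
    ∀ᵐ x, lam < ‖f x‖ → ∃ r, 0 < r ∧
      ENNReal.ofReal lam * volume (Metric.closedBall x r) < ∫⁻ y in Metric.closedBall x r, ‖f y‖ₑ ∧
      ∫⁻ y in Metric.closedBall x (5 * r), ‖f y‖ₑ ≤
        ENNReal.ofReal lam * volume (Metric.closedBall x (5 * r)) := by
  obtain ⟨v, hv, hve⟩ := exists_volume_ball_one (n := n)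
  have hI : ∫⁻ y, ‖f y‖ₑ ≠ ∞ := hf.2.ne
  filter_upwards [(Besicovitch.vitaliFamily volume).ae_tendsto_lintegral_div
    hf.aestronglyMeasurable.enorm hI] with x hx hfx
  have h1 := hx.comp (Besicovitch.tendsto_filterAt volume x)
  have h2 : ENNReal.ofReal lam < ‖f x‖ₑ := by
    rw [← ofReal_norm]
    exact (ENNReal.ofReal_lt_ofReal_iff (hlam.trans hfx)).2 hfx
  -- A small ball at a Lebesgue point has a large average. Its radius is multiplied by `5` until the
  -- average drops, which happens because the total mass is finite.
  obtain ⟨r₀, hr₀, hr₀pos⟩ := ((h1.eventually (lt_mem_nhds h2)).and self_mem_nhdsWithin).exists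
  have hr₀pos : 0 < r₀ := hr₀pos
  simp only [Function.comp_apply] at hr₀
  set P : ℕ → Prop := fun k => ∫⁻ y in Metric.closedBall x (5 ^ k * r₀), ‖f y‖ₑ ≤
    ENNReal.ofReal lam * volume (Metric.closedBall x (5 ^ k * r₀)) with hP
  have hex : ∃ k, P k := by
    obtain ⟨k, hk⟩ := pow_unbounded_of_one_lt ((∫⁻ y, ‖f y‖ₑ).toReal / (lam * (r₀ ^ n * v)))
      (by norm_num : (1 : ℝ) < 5)
    refine ⟨k, (setLIntegral_le_lintegral _ _).trans ?_⟩
    rw [volume_closedBall_eq x (by positivity), hve, ← ENNReal.ofReal_mul (by positivity),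
      ← ENNReal.ofReal_mul hlam.le, ← ENNReal.ofReal_toReal hI]
    refine ENNReal.ofReal_le_ofReal ?_
    rw [div_lt_iff₀ (by positivity)] at hk
    have h5 : (5 : ℝ) ^ k ≤ (5 ^ k) ^ n :=
      le_self_pow₀ (one_le_pow₀ (by norm_num)) (by omega)
    calc _ ≤ 5 ^ k * (lam * (r₀ ^ n * v)) := hk.le
      _ ≤ (5 ^ k) ^ n * (lam * (r₀ ^ n * v)) := by gcongr
      _ = _ := by rw [mul_pow]; ring
  classical
  have hk := Nat.find_spec hex
  have hmin : ∀ m < Nat.find hex, ¬ P m := fun m hm => Nat.find_min hex hm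
  set k := Nat.find hex
  have hP0 : ¬ P 0 := by
    simp only [hP, pow_zero, one_mul, not_le]
    have := (ENNReal.lt_div_iff_mul_lt (Or.inl (Metric.measure_closedBall_pos volume x hr₀pos).ne')
      (Or.inl measure_closedBall_lt_top.ne)).1 hr₀
    exact this
  have hk0 : k ≠ 0 := fun h => hP0 (h ▸ hk)
  obtain ⟨m, hm⟩ := Nat.exists_eq_succ_of_ne_zero hk0
  refine ⟨5 ^ m * r₀, by positivity, not_le.1 (hmin m (by omega)), ?_⟩
  have e : 5 * (5 ^ m * r₀) = 5 ^ k * r₀ := by rw [hm, pow_succ]; ring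
  rw [e]
  exact hk

/-- The balls of the Calderón–Zygmund decomposition at height `lam`. -/
lemma exists_stopping_balls (hn : 1 ≤ n) (hf : Integrable f) (hlam : 0 < lam) :
    ∃ (u : Set (EuclideanSpace ℝ (Fin n))) (r : EuclideanSpace ℝ (Fin n) → ℝ), u.Countable ∧
      (∀ b ∈ u, 0 < r b) ∧ u.PairwiseDisjoint (fun b => Metric.closedBall b (r b)) ∧
      (∀ b ∈ u, ENNReal.ofReal lam * volume (Metric.closedBall b (r b)) ≤
        ∫⁻ y in Metric.closedBall b (r b), ‖f y‖ₑ) ∧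
      (∀ b ∈ u, ∫⁻ y in Metric.closedBall b (5 * r b), ‖f y‖ₑ ≤
        ENNReal.ofReal lam * volume (Metric.closedBall b (5 * r b))) ∧
      ∀ᵐ x, x ∉ ⋃ b ∈ u, Metric.closedBall b (5 * r b) → ‖f x‖ ≤ lam := by
  classical
  obtain ⟨v, hv, hve⟩ := exists_volume_ball_one (n := n)
  have hI : ∫⁻ y, ‖f y‖ₑ ≠ ∞ := hf.2.ne
  set Q : EuclideanSpace ℝ (Fin n) → ℝ → Prop := fun x r => 0 < r ∧
      ENNReal.ofReal lam * volume (Metric.closedBall x r) < ∫⁻ y in Metric.closedBall x r, ‖f y‖ₑ ∧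
      ∫⁻ y in Metric.closedBall x (5 * r), ‖f y‖ₑ ≤
        ENNReal.ofReal lam * volume (Metric.closedBall x (5 * r)) with hQ
  set t : Set (EuclideanSpace ℝ (Fin n)) := {x | ∃ r, Q x r} with ht
  choose! r hr using fun x (hx : x ∈ t) => (hx : ∃ r, Q x r)
  -- A bound for the radii, as the Vitali covering lemma requires.
  have hbd : ∀ b ∈ t, r b ≤ max 1 ((∫⁻ y, ‖f y‖ₑ).toReal / (lam * v)) := fun b hb => by
    obtain ⟨hpos, hlt, -⟩ := hr b hb
    rcases le_total (r b) 1 with h | h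
    · exact h.trans (le_max_left _ _)
    · refine le_max_of_le_right ?_
      have h1 := hlt.le.trans (setLIntegral_le_lintegral _ _)
      rw [volume_closedBall_eq b hpos.le, hve, ← ENNReal.ofReal_mul (by positivity),
        ← ENNReal.ofReal_mul hlam.le, ← ENNReal.ofReal_toReal hI,
        ENNReal.ofReal_le_ofReal_iff ENNReal.toReal_nonneg] at h1
      rw [le_div_iff₀ (by positivity)]
      have h2 : r b ≤ r b ^ n := le_self_pow₀ h (by omega)
      calc _ ≤ r b ^ n * (lam * v) := by gcongr
        _ = lam * (r b ^ n * v) := by ring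
        _ ≤ _ := h1
  obtain ⟨u, hut, hud, huc⟩ := Vitali.exists_disjoint_subfamily_covering_enlargement_closedBall t
    (fun x => x) r _ hbd 5 (by norm_num)
  refine ⟨u, r, ?_, fun b hb => (hr b (hut hb)).1, hud, fun b hb => (hr b (hut hb)).2.1.le,
    fun b hb => (hr b (hut hb)).2.2, ?_⟩
  · refine hud.countable_of_nonempty_interior fun b hb => ?_
    refine ⟨b, Metric.ball_subset_interior_closedBall ?_⟩
    exact Metric.mem_ball_self (hr b (hut hb)).1
  · filter_upwards [ae_exists_stopping_radius hn hf hlam] with x hx hxu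
    by_contra! h
    obtain ⟨b, hb, hsub⟩ := huc x (hx h)
    refine hxu (Set.mem_biUnion hb (hsub ?_))
    exact Metric.mem_closedBall_self (hr x (hx h)).1.le

/-- A countable family of measurable sets can be made disjoint without changing its union. -/
lemma exists_disjoint_measurable_subset {α ι : Type*} [MeasurableSpace α] [Countable ι]
    (S : ι → Set α) (hS : ∀ i, MeasurableSet (S i)) :
    ∃ D : ι → Set α, (∀ i, MeasurableSet (D i)) ∧ (∀ i, D i ⊆ S i) ∧
      Pairwise (Function.onFun Disjoint D) ∧ ⋃ i, D i = ⋃ i, S i := by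
  obtain ⟨e, he⟩ := exists_injective_nat ι
  refine ⟨fun i => S i \ ⋃ j ∈ {j | e j < e i}, S j, fun i => ?_, fun i => Set.sdiff_subset,
    fun i j hij => ?_, ?_⟩
  · exact (hS i).diff (MeasurableSet.biUnion (Set.to_countable _) fun j _ => hS j)
  · have key : ∀ i j, e i < e j → Disjoint (S i \ ⋃ k ∈ {k | e k < e i}, S k)
        (S j \ ⋃ k ∈ {k | e k < e j}, S k) := fun i j h =>
      Set.disjoint_left.2 fun x hx hy => hy.2 (Set.mem_biUnion h hx.1)
    rcases lt_or_gt_of_ne (he.ne hij) with h | h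
    · exact key i j h
    · exact (key j i h).symm
  · refine Set.Subset.antisymm (Set.iUnion_mono fun i => Set.sdiff_subset) fun x hx => ?_
    classical
    obtain ⟨i, hi⟩ := Set.mem_iUnion.1 hx
    have hex : ∃ m, ∃ i, e i = m ∧ x ∈ S i := ⟨_, i, rfl, hi⟩
    obtain ⟨j, hj, hxj⟩ := Nat.find_spec hex
    refine Set.mem_iUnion.2 ⟨j, hxj, fun hmem => ?_⟩
    obtain ⟨k, hk, hxk⟩ := Set.mem_iUnion₂.1 hmem
    exact Nat.find_min hex (m := e k) (hj ▸ hk) ⟨k, rfl, hxk⟩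

end Covering

/-! ### The weak type `(1,1)` bound -/

section WeakType

variable {n : ℕ} {K f : EuclideanSpace ℝ (Fin n) → ℂ} {A lam : ℝ}

lemma conv_apply_swap {E : Type*} [NormedAddCommGroup E] [InnerProductSpace ℝ E]
    [FiniteDimensional ℝ E] [MeasurableSpace E] [BorelSpace E] (K f : E → ℂ) (x : E) :
    conv K f x = ∫ y, K (x - y) * f y := by
  rw [conv_apply, ← integral_sub_left_eq_self (fun y => K (x - y) * f y) volume x]
  simp only [sub_sub_cancel]

/-- Hörmander's condition makes the image of a function with vanishing integral integrable away from
its support. -/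
lemma IsCalderonZygmundKernel.lintegral_compl_le (hK : IsCalderonZygmundKernel K A)
    {h : EuclideanSpace ℝ (Fin n) → ℂ} (hh : Integrable h) (h0 : ∫ y, h y = 0)
    {b : EuclideanSpace ℝ (Fin n)} {ρ : ℝ} (hsupp : ∀ y, y ∉ Metric.closedBall b ρ → h y = 0) :
    ∫⁻ x in (Metric.closedBall b (2 * ρ))ᶜ, ‖conv K h x‖ₑ ≤ ENNReal.ofReal A * ∫⁻ y, ‖h y‖ₑ := by
  obtain ⟨B, hB⟩ := hK.bounded
  have hKc := hK.continuous
  set S := (Metric.closedBall b (2 * ρ))ᶜ with hS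
  have hSm : MeasurableSet S := Metric.isClosed_closedBall.measurableSet.compl
  have hpt : ∀ x, ‖conv K h x‖ₑ ≤ ∫⁻ y, ‖K (x - y) - K (x - b)‖ₑ * ‖h y‖ₑ := fun x => by
    have hi : Integrable fun y => K (x - y) * h y :=
      hh.bdd_mul (c := B) (by fun_prop) (Filter.Eventually.of_forall fun y => hB _)
    have e : conv K h x = ∫ y, (K (x - y) - K (x - b)) * h y := by
      simp only [sub_mul]
      rw [integral_sub hi (hh.const_mul _), integral_const_mul, h0, mul_zero, sub_zero,
        conv_apply_swap]
    rw [e]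
    refine (enorm_integral_le_lintegral_enorm _).trans (le_of_eq ?_)
    simp only [enorm_mul]
  have hhm : AEMeasurable fun y => ‖h y‖ₑ := hh.aestronglyMeasurable.enorm
  have hKm : Measurable fun z : EuclideanSpace ℝ (Fin n) × EuclideanSpace ℝ (Fin n) =>
      ‖K (z.1 - z.2) - K (z.1 - b)‖ₑ :=
    (by fun_prop : Continuous fun z : EuclideanSpace ℝ (Fin n) × EuclideanSpace ℝ (Fin n) =>
      K (z.1 - z.2) - K (z.1 - b)).measurable.enorm
  have hhor : ∀ y, y ∈ Metric.closedBall b ρ →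
      ∫⁻ x in S, ‖K (x - y) - K (x - b)‖ₑ ≤ ENNReal.ofReal A := fun y hy => by
    rw [mem_closedBall_iff_norm] at hy
    refine le_trans (le_of_eq_of_le ?_ (lintegral_mono_set (μ := volume)
      (s := {z | 2 * ρ < ‖z‖}) fun z (hz : 2 * ρ < ‖z‖) => ?_)) (hK.hormander (y - b))
    · have hSm' : MeasurableSet {z : EuclideanSpace ℝ (Fin n) | 2 * ρ < ‖z‖} :=
        measurableSet_lt measurable_const measurable_norm
      rw [← lintegral_indicator hSm, ← lintegral_indicator hSm',
        ← lintegral_sub_right_eq_self ({z | 2 * ρ < ‖z‖}.indicator fun z =>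
          ‖K (z - (y - b)) - K z‖ₑ) b]
      refine lintegral_congr fun x => ?_
      by_cases hx : 2 * ρ < ‖x - b‖
      · have : x ∈ S := by
          rw [hS, Set.mem_compl_iff, mem_closedBall_iff_norm]; exact not_le.2 hx
        rw [Set.indicator_of_mem this, Set.indicator_of_mem (by exact hx)]
        congr 3
        abel_nf
      · have : x ∉ S := by
          rw [hS, Set.notMem_compl_iff, mem_closedBall_iff_norm]; exact not_lt.1 hx
        rw [Set.indicator_of_notMem this, Set.indicator_of_notMem (by exact hx)]
    · change 2 * ‖y - b‖ ≤ ‖z‖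
      linarith
  calc _ ≤ ∫⁻ x in S, ∫⁻ y, ‖K (x - y) - K (x - b)‖ₑ * ‖h y‖ₑ := lintegral_mono fun x => hpt x
    _ = ∫⁻ y, ∫⁻ x in S, ‖K (x - y) - K (x - b)‖ₑ * ‖h y‖ₑ := by
        refine lintegral_lintegral_swap ?_
        exact hKm.aemeasurable.mul (hhm.comp_quasiMeasurePreserving
          Measure.quasiMeasurePreserving_snd)
    _ ≤ ∫⁻ y, ENNReal.ofReal A * ‖h y‖ₑ := by
        refine lintegral_mono fun y => ?_
        simp only
        rw [lintegral_mul_const' _ _ enorm_ne_top]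
        by_cases hy : y ∈ Metric.closedBall b ρ
        · gcongr
          exact hhor y hy
        · rw [hsupp y hy]; simp
    _ = _ := lintegral_const_mul'' _ hhm

end WeakType

section Decomposition

variable {n : ℕ} {K f : EuclideanSpace ℝ (Fin n) → ℂ} {A lam : ℝ}

/-- The Calderón–Zygmund decomposition at height `lam` into a bounded part `g`, finitely many
functions `h i` with vanishing integral, and a remainder `e` that is small in `L¹`. -/
lemma exists_calderonZygmund_decomposition (hn : 1 ≤ n) (hf : Integrable f) (hlam : 0 < lam)
    {ε : ℝ} (hε : 0 < ε) :
    ∃ (ι : Type) (s : Finset ι) (b : ι → EuclideanSpace ℝ (Fin n)) (r : ι → ℝ)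
      (g e : EuclideanSpace ℝ (Fin n) → ℂ) (h : ι → EuclideanSpace ℝ (Fin n) → ℂ),
      (∀ x, f x = g x + ∑ i ∈ s, h i x + e x) ∧
      Integrable g ∧ (∀ᵐ x, ‖g x‖ₑ ≤ ENNReal.ofReal (5 ^ n * lam)) ∧ ∫⁻ x, ‖g x‖ₑ ≤ ∫⁻ x, ‖f x‖ₑ ∧
      (∀ i, Integrable (h i)) ∧ (∀ i, ∫ x, h i x = 0) ∧
      (∀ i, ∀ x, x ∉ Metric.closedBall (b i) (5 * r i) → h i x = 0) ∧
      ∑ i ∈ s, ∫⁻ x, ‖h i x‖ₑ ≤ 2 * ∫⁻ x, ‖f x‖ₑ ∧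
      Integrable e ∧ ∫⁻ x, ‖e x‖ₑ ≤ ENNReal.ofReal ε ∧ (∀ i, 0 < r i) ∧
      ∑ i ∈ s, ENNReal.ofReal lam * volume (Metric.closedBall (b i) (r i)) ≤ ∫⁻ x, ‖f x‖ₑ := by
  classical
  obtain ⟨u, r, huc, hr, hud, hlow, hup, hgood⟩ := exists_stopping_balls hn hf hlam
  have hcount : Countable u := huc.to_subtype
  have hI : ∫⁻ y, ‖f y‖ₑ ≠ ∞ := hf.2.ne
  have hfm : AEMeasurable fun x => ‖f x‖ₑ := hf.aestronglyMeasurable.enorm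
  -- The sets `D i` partition the union of the enlarged balls. Each `f` on `D i` is replaced by a
  -- constant `c i` with the same integral on the original ball `B i`; as these balls are disjoint,
  -- the sum of the replacements stays bounded.
  obtain ⟨D, hDm, hDS, hDd, hDU⟩ := exists_disjoint_measurable_subset
    (fun i : u => Metric.closedBall (i : EuclideanSpace ℝ (Fin n)) (5 * r i))
    fun i => Metric.isClosed_closedBall.measurableSet
  set Ω := ⋃ i, D i with hΩ
  have hΩm : MeasurableSet Ω := MeasurableSet.iUnion hDm
  set B : u → Set (EuclideanSpace ℝ (Fin n)) :=
    fun i => Metric.closedBall (i : EuclideanSpace ℝ (Fin n)) (r i) with hB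
  have hBm : ∀ i, MeasurableSet (B i) := fun i => Metric.isClosed_closedBall.measurableSet
  have hBd : Pairwise (Function.onFun Disjoint B) := fun i j hij =>
    hud i.2 j.2 fun h => hij (Subtype.ext h)
  have hBt : ∀ i, volume (B i) ≠ ∞ := fun i => measure_closedBall_lt_top.ne
  have hB0 : ∀ i, volume (B i) ≠ 0 := fun i =>
    (Metric.measure_closedBall_pos volume _ (hr i i.2)).ne'
  set I : u → ℝ≥0∞ := fun i => ∫⁻ x in D i, ‖f x‖ₑ with hIdef
  have hIsum : ∑' i, I i = ∫⁻ x in Ω, ‖f x‖ₑ := (lintegral_iUnion hDm hDd _).symm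
  have hΩt : ∫⁻ x in Ω, ‖f x‖ₑ ≠ ∞ := ne_top_of_le_ne_top hI (setLIntegral_le_lintegral _ _)
  -- Only finitely many pieces are kept; the rest is the remainder of `L¹` norm at most `ε`.
  obtain ⟨s, hs⟩ : ∃ s : Finset u, ∫⁻ x in Ω, ‖f x‖ₑ < ∑ i ∈ s, I i + ENNReal.ofReal ε := by
    have h0 : Filter.Tendsto (fun s : Finset u => ∑ i ∈ s, I i) Filter.atTop
        (nhds (∑' i, I i)) := ENNReal.summable.hasSum
    have h1 := h0.add (tendsto_const_nhds (x := ENNReal.ofReal ε))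
    refine (h1.eventually (lt_mem_nhds ?_)).exists
    rw [hIsum]
    exact ENNReal.lt_add_right hΩt (by simpa using hε)
  set c : u → ℂ := fun i => (∫ x in D i, f x) / (volume.real (B i) : ℂ) with hc
  have hcB : ∀ i, ‖c i‖ₑ * volume (B i) ≤ I i := fun i => by
    have h1 : ‖c i‖ₑ * volume (B i) = ‖∫ x in D i, f x‖ₑ := by
      rw [← ofReal_measureReal (hBt i), ← ofReal_norm, ← ofReal_norm,
        ← ENNReal.ofReal_mul (norm_nonneg _)]
      congr 1
      have : volume.real (B i) ≠ 0 := (measureReal_ne_zero_iff (hBt i)).2 (hB0 i)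
      simp only [hc, norm_div, Complex.norm_real, Real.norm_eq_abs,
        abs_of_nonneg measureReal_nonneg]
      field_simp
    rw [h1]
    exact enorm_integral_le_lintegral_enorm _
  have hcle : ∀ i, ‖c i‖ₑ ≤ ENNReal.ofReal (5 ^ n * lam) := fun i => by
    have h1 : ‖c i‖ₑ * volume (B i) ≤ ENNReal.ofReal (5 ^ n * lam) * volume (B i) := by
      refine (hcB i).trans ((lintegral_mono_set (hDS i)).trans ((hup i i.2).trans (le_of_eq ?_)))
      rw [volume_closedBall_mul _ (hr i i.2).le (by norm_num), ← mul_assoc,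
        ← ENNReal.ofReal_mul hlam.le, mul_comm lam]
    exact (ENNReal.mul_le_mul_iff_left (hB0 i) (hBt i)).1 h1
  have hBi : ∀ i, Integrable ((B i).indicator fun _ => c i) := fun i =>
    (integrable_indicator_iff (hBm i)).2 (integrableOn_const (hBt i))
  have hBint : ∀ i, ∫⁻ x, ‖(B i).indicator (fun _ => c i) x‖ₑ = ‖c i‖ₑ * volume (B i) := fun i => by
    simp only [enorm_indicator_eq_indicator_enorm]
    rw [lintegral_indicator (hBm i), setLIntegral_const]
  have hDint : ∀ S : Set (EuclideanSpace ℝ (Fin n)), MeasurableSet S →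
      ∫⁻ x, ‖S.indicator f x‖ₑ = ∫⁻ x in S, ‖f x‖ₑ := fun S hS => by
    simp only [enorm_indicator_eq_indicator_enorm]
    rw [lintegral_indicator hS]
  set U := ⋃ i ∈ s, D i with hU
  have hUm : MeasurableSet U := Finset.measurableSet_biUnion _ fun i _ => hDm i
  have hUΩ : U ⊆ Ω := Set.iUnion₂_subset fun i _ => Set.subset_iUnion D i
  have hUsum : ∑ i ∈ s, I i = ∫⁻ x in U, ‖f x‖ₑ :=
    (lintegral_biUnion_finset (fun i _ j _ hij => hDd hij) (fun i _ => hDm i) _).symm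
  refine ⟨u, s, fun i => i, fun i => r i,
    fun x => Ωᶜ.indicator f x + ∑ i ∈ s, (B i).indicator (fun _ => c i) x,
    (Ω \ U).indicator f, fun i x => (D i).indicator f x - (B i).indicator (fun _ => c i) x,
    fun x => ?_, ?_, ?_, ?_, fun i => ?_, fun i => ?_, fun i x hx => ?_, ?_, ?_, ?_,
    fun i => hr i i.2, ?_⟩
  · rw [Finset.sum_sub_distrib]
    have h1 : ∑ i ∈ s, (D i).indicator f x = U.indicator f x :=
      (Finset.indicator_biUnion_apply s D (fun i _ j _ hij => hDd hij) x).symm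
    rw [h1]
    by_cases hxU : x ∈ U
    · simp [hxU, hUΩ hxU]
    · by_cases hxΩ : x ∈ Ω <;> simp [hxU, hxΩ]
  · exact (hf.indicator hΩm.compl).add (integrable_finsetSum _ fun i _ => hBi i)
  · filter_upwards [hgood] with x hx
    by_cases hxB : ∃ i ∈ s, x ∈ B i
    · obtain ⟨i, his, hxi⟩ := hxB
      have hxΩ : x ∈ Ω := by
        rw [hDU]
        refine Set.mem_iUnion.2 ⟨i, Metric.closedBall_subset_closedBall ?_ hxi⟩
        linarith [hr i i.2]
      have h2 : ∑ j ∈ s, (B j).indicator (fun _ => c j) x = c i := by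
        rw [Finset.sum_eq_single_of_mem i his fun j _ hji => Set.indicator_of_notMem
          (Set.disjoint_left.1 (hBd hji.symm) hxi) _, Set.indicator_of_mem hxi]
      rw [h2, Set.indicator_of_notMem (by simpa using hxΩ), zero_add]
      exact hcle i
    · push Not at hxB
      rw [Finset.sum_eq_zero fun i his => Set.indicator_of_notMem (hxB i his) _, add_zero]
      by_cases hxΩ : x ∈ Ω
      · rw [Set.indicator_of_notMem (by simpa using hxΩ)]; simp
      · rw [Set.indicator_of_mem (by simpa using hxΩ), ← ofReal_norm]
        refine ENNReal.ofReal_le_ofReal ((hx ?_).trans ?_)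
        · rw [hDU] at hxΩ
          simpa using hxΩ
        · exact le_mul_of_one_le_left hlam.le (one_le_pow₀ (by norm_num))
  · calc _ ≤ ∫⁻ x, (‖Ωᶜ.indicator f x‖ₑ + ∑ i ∈ s, ‖(B i).indicator (fun _ => c i) x‖ₑ) :=
          lintegral_mono fun x => (enorm_add_le _ _).trans (by gcongr; exact enorm_sum_le _ _)
      _ = (∫⁻ x in Ωᶜ, ‖f x‖ₑ) + ∑ i ∈ s, ‖c i‖ₑ * volume (B i) := by
          rw [lintegral_add_left' (hf.indicator hΩm.compl).aestronglyMeasurable.enorm,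
            lintegral_finsetSum' _ fun i _ => (hBi i).aestronglyMeasurable.enorm,
            hDint _ hΩm.compl]
          simp only [hBint]
      _ ≤ (∫⁻ x in Ωᶜ, ‖f x‖ₑ) + ∫⁻ x in Ω, ‖f x‖ₑ := by
          gcongr
          refine (Finset.sum_le_sum fun i _ => hcB i).trans ?_
          rw [hUsum]
          exact lintegral_mono_set hUΩ
      _ = _ := by rw [add_comm, lintegral_add_compl _ hΩm]
  · exact (hf.indicator (hDm i)).sub (hBi i)
  · rw [integral_sub (hf.indicator (hDm i)) (hBi i), integral_indicator (hDm i),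
      integral_indicator (hBm i), setIntegral_const, hc, Complex.real_smul]
    have : (volume.real (B i) : ℂ) ≠ 0 := by
      exact_mod_cast (measureReal_ne_zero_iff (hBt i)).2 (hB0 i)
    simp only
    field_simp
    ring
  · change (D i).indicator f x - (B i).indicator (fun _ => c i) x = 0
    rw [Set.indicator_of_notMem fun h => hx (hDS i h), Set.indicator_of_notMem fun h => hx
      (Metric.closedBall_subset_closedBall (by linarith [hr i i.2]) h), sub_zero]
  · calc _ ≤ ∑ i ∈ s, (I i + I i) := by
          refine Finset.sum_le_sum fun i _ => ?_
          calc _ ≤ ∫⁻ x, (‖(D i).indicator f x‖ₑ + ‖(B i).indicator (fun _ => c i) x‖ₑ) :=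
                lintegral_mono fun x => enorm_sub_le
            _ = I i + ‖c i‖ₑ * volume (B i) := by
                rw [lintegral_add_left' (hf.indicator (hDm i)).aestronglyMeasurable.enorm,
                  hDint _ (hDm i), hBint]
            _ ≤ _ := by gcongr; exact hcB i
      _ = 2 * ∑ i ∈ s, I i := by rw [Finset.sum_add_distrib, two_mul]
      _ ≤ _ := by
          gcongr
          rw [hUsum]
          exact setLIntegral_le_lintegral _ _
  · exact hf.indicator (hΩm.diff hUm)
  · rw [hDint _ (hΩm.diff hUm)]
    have h1 : (∫⁻ x in U, ‖f x‖ₑ) + ∫⁻ x in Ω \ U, ‖f x‖ₑ = ∫⁻ x in Ω, ‖f x‖ₑ := by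
      rw [← lintegral_inter_add_sdiff (fun x => ‖f x‖ₑ) Ω hUm, Set.inter_eq_right.2 hUΩ]
    have h2 : (∫⁻ x in U, ‖f x‖ₑ) ≠ ∞ := ne_top_of_le_ne_top hI (setLIntegral_le_lintegral _ _)
    rw [hUsum, ← h1] at hs
    exact ((ENNReal.add_lt_add_iff_left h2).1 hs).le
  · calc _ ≤ ∑ i ∈ s, ∫⁻ x in B i, ‖f x‖ₑ := Finset.sum_le_sum fun i _ => hlow i i.2
      _ = ∫⁻ x in ⋃ i ∈ s, B i, ‖f x‖ₑ :=
          (lintegral_biUnion_finset (fun i _ j _ hij => hBd hij) (fun i _ => hBm i) _).symm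
      _ ≤ _ := setLIntegral_le_lintegral _ _

/-- A Calderón–Zygmund operator is of weak type `(1,1)`. -/
lemma IsCalderonZygmundKernel.volume_lt_conv_le (hn : 1 ≤ n) (hK : IsCalderonZygmundKernel K A)
    (hA : 0 ≤ A) (hf : Integrable f) (hlam : 0 < lam) :
    volume {x | 2 * lam < ‖conv K f x‖} ≤
      ENNReal.ofReal ((4 * A ^ 2 * 5 ^ n + 10 ^ n + 4 * A) / lam) * ∫⁻ x, ‖f x‖ₑ := by
  obtain ⟨M, hM⟩ := hK.bounded
  have hM0 : 0 ≤ M := (norm_nonneg _).trans (hM 0)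
  -- Since `‖K‖ ≤ M`, the choice `ε = lam / (M + 1)` bounds the image of the
  -- remainder by `lam` everywhere.
  obtain ⟨ι, s, b, r, g, e, h, hdec, hgi, hgb, hg1, hhi, hh0, hhs, hh1, hei, he1, hr, hball⟩ :=
    exists_calderonZygmund_decomposition hn hf hlam (ε := lam / (M + 1)) (by positivity)
  have hKm := hK.integrable.aestronglyMeasurable
  set F := ∫⁻ x, ‖f x‖ₑ with hF
  have hi : ∀ {v : EuclideanSpace ℝ (Fin n) → ℂ}, Integrable v → ∀ x,
      Integrable fun y => K y * v (x - y) := fun hv x => integrable_conv_integrand hKm hM hv x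
  have hTf : ∀ x, conv K f x = conv K g x + ∑ i ∈ s, conv K (h i) x + conv K e x := fun x => by
    have h1 : Integrable fun y => ∑ i ∈ s, K y * h i (x - y) :=
      integrable_finsetSum _ fun i _ => hi (hhi i) x
    have h2 : Integrable fun y => K y * g (x - y) + ∑ i ∈ s, K y * h i (x - y) :=
      (hi hgi x).add h1
    simp only [conv_apply]
    rw [← integral_finsetSum _ fun i _ => hi (hhi i) x, ← integral_add (hi hgi x) h1,
      ← integral_add h2 (hi hei x)]
    congr 1
    funext y
    rw [hdec, mul_add, mul_add, Finset.mul_sum]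
  have hTe : ∀ x, ‖conv K e x‖ ≤ lam := fun x => by
    have h1 : ‖conv K e x‖ₑ ≤ ENNReal.ofReal lam := by
      calc ‖conv K e x‖ₑ ≤ ∫⁻ y, ‖K y‖ₑ * ‖e (x - y)‖ₑ := enorm_conv_le K e x
        _ ≤ ∫⁻ y, ENNReal.ofReal M * ‖e (x - y)‖ₑ := by
            refine lintegral_mono fun y => ?_
            gcongr
            rw [← ofReal_norm]
            exact ENNReal.ofReal_le_ofReal (hM y)
        _ = ENNReal.ofReal M * ∫⁻ y, ‖e y‖ₑ := by
            rw [lintegral_const_mul' _ _ ENNReal.ofReal_ne_top,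
              lintegral_sub_left_eq_self (fun y => ‖e y‖ₑ) x]
        _ ≤ ENNReal.ofReal M * ENNReal.ofReal (lam / (M + 1)) := by gcongr
        _ ≤ _ := by
            rw [← ENNReal.ofReal_mul hM0]
            refine ENNReal.ofReal_le_ofReal ?_
            rw [mul_div_assoc', div_le_iff₀ (by positivity)]
            nlinarith
    rw [← ofReal_norm] at h1
    exact (ENNReal.ofReal_le_ofReal_iff hlam.le).1 h1
  set S₁ := {x | ENNReal.ofReal (lam / 2) ≤ ‖conv K g x‖ₑ} with hS₁
  -- Hörmander's condition applies outside of the set `S₂`, whose measure is controlled.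
  set S₂ := ⋃ i ∈ s, Metric.closedBall (b i) (2 * (5 * r i)) with hS₂
  have hS₂m : MeasurableSet S₂ :=
    Finset.measurableSet_biUnion _ fun i _ => Metric.isClosed_closedBall.measurableSet
  set H : EuclideanSpace ℝ (Fin n) → ℝ≥0∞ := fun x => ∑ i ∈ s, ‖conv K (h i) x‖ₑ with hH
  set S₃ := {x | ENNReal.ofReal (lam / 2) ≤ S₂ᶜ.indicator H x} with hS₃
  have hHm : AEMeasurable H := Finset.aemeasurable_fun_sum _ fun i _ =>
    (aestronglyMeasurable_conv hKm (hhi i).aestronglyMeasurable).enorm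
  have hsub : {x | 2 * lam < ‖conv K f x‖} ⊆ S₁ ∪ (S₂ ∪ S₃) := by
    intro x hx
    have hx : 2 * lam < ‖conv K f x‖ := hx
    by_contra hcon
    simp only [Set.mem_union, not_or] at hcon
    obtain ⟨h1, h2, h3⟩ := hcon
    have h1 : ‖conv K g x‖ < lam / 2 := by
      have := not_le.1 (show ¬ ENNReal.ofReal (lam / 2) ≤ ‖conv K g x‖ₑ from h1)
      rw [← ofReal_norm] at this
      exact (ENNReal.ofReal_lt_ofReal_iff (by positivity)).1 this
    have h3 : ‖∑ i ∈ s, conv K (h i) x‖ < lam / 2 := by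
      have h4 := not_le.1 (show ¬ ENNReal.ofReal (lam / 2) ≤ S₂ᶜ.indicator H x from h3)
      rw [Set.indicator_of_mem (by exact h2)] at h4
      have h5 := (enorm_sum_le s fun i => conv K (h i) x).trans_lt h4
      rw [← ofReal_norm] at h5
      exact (ENNReal.ofReal_lt_ofReal_iff (by positivity)).1 h5
    have h4 := hTe x
    rw [hTf] at hx
    have h5 := norm_add_le (conv K g x + ∑ i ∈ s, conv K (h i) x) (conv K e x)
    have h6 := norm_add_le (conv K g x) (∑ i ∈ s, conv K (h i) x)
    linarith
  have hl2 : ENNReal.ofReal (lam / 2) ≠ 0 := by simpa using hlam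
  have hinv : ∀ a : ℝ≥0∞, a / ENNReal.ofReal (lam / 2) = ENNReal.ofReal (2 / lam) * a := fun a => by
    rw [ENNReal.div_eq_inv_mul, ← ENNReal.ofReal_inv_of_pos (by positivity), inv_div]
  have hV₁ : volume S₁ ≤ ENNReal.ofReal (4 * A ^ 2 * 5 ^ n / lam) * F := by
    have hg2sq : ∫⁻ x, ‖g x‖ₑ ^ (2 : ℝ) ≤ ENNReal.ofReal (5 ^ n * lam) * F := by
      calc _ ≤ ∫⁻ x, ENNReal.ofReal (5 ^ n * lam) * ‖g x‖ₑ := by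
            refine lintegral_mono_ae ?_
            filter_upwards [hgb] with x hx
            rw [ENNReal.rpow_two, sq]
            gcongr
        _ = ENNReal.ofReal (5 ^ n * lam) * ∫⁻ x, ‖g x‖ₑ :=
            lintegral_const_mul' _ _ ENNReal.ofReal_ne_top
        _ ≤ _ := by gcongr
    have hgsq : eLpNorm g 2 volume ^ (2 : ℝ) = ∫⁻ x, ‖g x‖ₑ ^ (2 : ℝ) := by
      rw [eLpNorm_eq_lintegral_rpow_enorm_toReal (by norm_num) (by simp), ENNReal.toReal_ofNat,
        ← ENNReal.rpow_mul]
      norm_num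
    have hg2 : MemLp g 2 := by
      refine ⟨hgi.aestronglyMeasurable, ?_⟩
      have h1 : eLpNorm g 2 volume ^ (2 : ℝ) < ∞ := by
        rw [hgsq]
        exact hg2sq.trans_lt (ENNReal.mul_lt_top ENNReal.ofReal_lt_top hf.2)
      exact (ENNReal.rpow_lt_top_iff_of_pos (by norm_num)).1 h1
    have hcheb := meas_ge_le_mul_pow_eLpNorm_enorm volume (p := 2) (by norm_num) (by simp)
      (aestronglyMeasurable_conv hKm hgi.aestronglyMeasurable) hl2 (by simp)
    rw [ENNReal.toReal_ofNat] at hcheb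
    refine hcheb.trans ?_
    calc _ ≤ (ENNReal.ofReal (lam / 2))⁻¹ ^ (2 : ℝ) *
          (ENNReal.ofReal A * eLpNorm g 2 volume) ^ (2 : ℝ) := by
          gcongr
          exact hK.eLpNorm_two_le g hgi hg2
      _ = (ENNReal.ofReal (lam / 2))⁻¹ ^ (2 : ℝ) * (ENNReal.ofReal A ^ (2 : ℝ) *
            ∫⁻ x, ‖g x‖ₑ ^ (2 : ℝ)) := by
          rw [ENNReal.mul_rpow_of_nonneg _ _ (by norm_num), hgsq]
      _ ≤ (ENNReal.ofReal (lam / 2))⁻¹ ^ (2 : ℝ) * (ENNReal.ofReal A ^ (2 : ℝ) *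
            (ENNReal.ofReal (5 ^ n * lam) * F)) := by gcongr
      _ = ENNReal.ofReal ((2 / lam) ^ (2 : ℝ) * (A ^ (2 : ℝ) * (5 ^ n * lam))) * F := by
          rw [← ENNReal.ofReal_inv_of_pos (by positivity), inv_div,
            ENNReal.ofReal_rpow_of_nonneg (by positivity) (by norm_num),
            ENNReal.ofReal_rpow_of_nonneg hA (by norm_num),
            ENNReal.ofReal_mul (p := (2 / lam) ^ (2 : ℝ)) (by positivity),
            ENNReal.ofReal_mul (p := A ^ (2 : ℝ)) (by positivity)]
          simp only [mul_assoc]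
      _ = _ := by
          congr 2
          rw [Real.rpow_two, Real.rpow_two]
          field_simp
          ring
  have hV₂ : volume S₂ ≤ ENNReal.ofReal (10 ^ n / lam) * F := by
    calc volume S₂ ≤ ∑ i ∈ s, volume (Metric.closedBall (b i) (2 * (5 * r i))) :=
          measure_biUnion_finset_le _ _
      _ = ∑ i ∈ s, ENNReal.ofReal (10 ^ n / lam) *
            (ENNReal.ofReal lam * volume (Metric.closedBall (b i) (r i))) := by
          refine Finset.sum_congr rfl fun i _ => ?_
          rw [← mul_assoc 2 5, volume_closedBall_mul _ (hr i).le (by norm_num), ← mul_assoc,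
            ← ENNReal.ofReal_mul (by positivity), div_mul_cancel₀ _ hlam.ne']
          norm_num
      _ ≤ _ := by
          rw [← Finset.mul_sum]
          gcongr
  have hV₃ : volume S₃ ≤ ENNReal.ofReal (4 * A / lam) * F := by
    have hcheb := meas_ge_le_lintegral_div (μ := volume) (hHm.indicator hS₂m.compl) hl2
      ENNReal.ofReal_ne_top
    refine hcheb.trans ?_
    rw [hinv, lintegral_indicator hS₂m.compl]
    calc _ = ENNReal.ofReal (2 / lam) * ∑ i ∈ s, ∫⁻ x in S₂ᶜ, ‖conv K (h i) x‖ₑ := by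
          congr 1
          exact lintegral_finsetSum' _ fun i _ =>
            (aestronglyMeasurable_conv hKm (hhi i).aestronglyMeasurable).enorm.restrict
      _ ≤ ENNReal.ofReal (2 / lam) * ∑ i ∈ s, ENNReal.ofReal A * ∫⁻ x, ‖h i x‖ₑ := by
          gcongr with i hi
          refine (lintegral_mono_set (Set.compl_subset_compl.2 ?_)).trans
            (hK.lintegral_compl_le (hhi i) (hh0 i) (hhs i))
          exact Set.subset_biUnion_of_mem (u := fun i => Metric.closedBall (b i) (2 * (5 * r i))) hi
      _ ≤ ENNReal.ofReal (2 / lam) * (ENNReal.ofReal A * (2 * F)) := by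
          rw [← Finset.mul_sum]
          gcongr
      _ = ENNReal.ofReal (2 / lam * (A * 2)) * F := by
          rw [ENNReal.ofReal_mul (by positivity), ENNReal.ofReal_mul hA, ENNReal.ofReal_ofNat]
          simp only [mul_assoc]
      _ = _ := by
          congr 2
          ring
  calc _ ≤ volume S₁ + (volume S₂ + volume S₃) :=
        (measure_mono hsub).trans ((measure_union_le _ _).trans
          (add_le_add le_rfl (measure_union_le _ _)))
    _ ≤ ENNReal.ofReal (4 * A ^ 2 * 5 ^ n / lam) * F + (ENNReal.ofReal (10 ^ n / lam) * F +
          ENNReal.ofReal (4 * A / lam) * F) := add_le_add hV₁ (add_le_add hV₂ hV₃)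
    _ = _ := by
        rw [← add_mul, ← add_mul, ← ENNReal.ofReal_add (by positivity) (by positivity),
          ← ENNReal.ofReal_add (by positivity) (by positivity)]
        congr 2
        ring

end Decomposition

/-! ### `L^p` bounds for Calderón–Zygmund operators -/

section Marcinkiewicz

variable {n : ℕ} {K : EuclideanSpace ℝ (Fin n) → ℂ} {A : ℝ}

lemma lintegral_Ioi_rpow {s c : ℝ} (hs : s < -1) (hc : 0 < c) :
    ∫⁻ t in Set.Ioi c, ENNReal.ofReal (t ^ s) = ENNReal.ofReal (c ^ (s + 1) / (-(s + 1))) := by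
  rw [← ofReal_integral_eq_lintegral_ofReal (integrableOn_Ioi_rpow_of_lt hs hc),
    integral_Ioi_rpow_of_lt hs hc]
  · congr 1
    rw [neg_div, div_neg]
  · filter_upwards [self_mem_ae_restrict measurableSet_Ioi] with t ht
    exact Real.rpow_nonneg (hc.trans ht).le _

/-- The companion of `lintegral_setLIntegral_lt_enorm_mul` for the bounded part of `f` in `L²`. -/
lemma lintegral_setLIntegral_compl_lt_enorm_sq_mul_le {α : Type*} [MeasurableSpace α]
    {μ : Measure α} [SFinite μ] {f : α → ℂ} (hf : Measurable f) {p : ℝ} (hp2 : p < 2) :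
    ∫⁻ t in Set.Ioi (0 : ℝ), (∫⁻ x in {x | t < ‖f x‖}ᶜ, ‖f x‖ₑ ^ (2 : ℝ) ∂μ) *
        ENNReal.ofReal (t ^ (p - 3)) ≤
      ENNReal.ofReal (1 / (2 - p)) * ∫⁻ x, ‖f x‖ₑ ^ p ∂μ := by
  have hm : MeasurableSet {z : ℝ × α | ¬ z.1 < ‖f z.2‖} :=
    (measurableSet_lt measurable_fst (hf.norm.comp measurable_snd)).compl
  have hS : ∀ t : ℝ, MeasurableSet {x | t < ‖f x‖}ᶜ := fun t =>
    (measurableSet_lt measurable_const hf.norm).compl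
  set G : ℝ × α → ℝ≥0∞ := {z : ℝ × α | ¬ z.1 < ‖f z.2‖}.indicator
    fun z => ‖f z.2‖ₑ ^ (2 : ℝ) * ENNReal.ofReal (z.1 ^ (p - 3)) with hG
  have hGm : Measurable G := by
    refine Measurable.indicator ?_ hm
    exact ((hf.enorm.comp measurable_snd).pow_const _).mul
      (measurable_fst.pow_const _).ennreal_ofReal
  calc _ = ∫⁻ t in Set.Ioi (0 : ℝ), ∫⁻ x, G (t, x) ∂μ := by
        refine lintegral_congr fun t => ?_
        rw [← lintegral_mul_const' _ _ ENNReal.ofReal_ne_top, ← lintegral_indicator (hS t)]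
        rfl
    _ = ∫⁻ x, (∫⁻ t in Set.Ioi (0 : ℝ), G (t, x)) ∂μ :=
        lintegral_lintegral_swap hGm.aemeasurable
    _ ≤ ∫⁻ x, ENNReal.ofReal (1 / (2 - p)) * ‖f x‖ₑ ^ p ∂μ := by
        refine lintegral_mono fun x => ?_
        simp only
        rcases (norm_nonneg (f x)).eq_or_lt with h | h
        · have h0 : f x = 0 := norm_eq_zero.1 h.symm
          have : ∀ t, G (t, x) = 0 := fun t => by
            simp [hG, Set.indicator, h0]
          simp [this]
        · calc _ ≤ ∫⁻ t in Set.Ici ‖f x‖, ‖f x‖ₑ ^ (2 : ℝ) * ENNReal.ofReal (t ^ (p - 3)) := by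
                rw [← lintegral_indicator measurableSet_Ici]
                refine (setLIntegral_le_lintegral _ _).trans (lintegral_mono fun t => ?_)
                simp only [hG, Set.indicator, Set.mem_ofPred_eq, not_lt, Set.mem_Ici]
                exact le_rfl
            _ = ‖f x‖ₑ ^ (2 : ℝ) * ENNReal.ofReal (‖f x‖ ^ (p - 2) / (2 - p)) := by
                rw [lintegral_const_mul' _ _ (ENNReal.rpow_ne_top_of_nonneg (by norm_num)
                  enorm_ne_top), setLIntegral_congr Ioi_ae_eq_Ici.symm,
                  lintegral_Ioi_rpow (by linarith) h]
                congr 3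
                · congr 1; ring
                · ring
            _ = _ := by
                rw [← ofReal_norm, ENNReal.ofReal_rpow_of_pos h, ENNReal.ofReal_rpow_of_pos h,
                  ← ENNReal.ofReal_mul (by positivity), ← ENNReal.ofReal_mul (by
                    have : 0 < 2 - p := by linarith
                    positivity)]
                congr 1
                rw [← mul_div_assoc, ← Real.rpow_add h]
                have : 2 + (p - 2) = p := by ring
                rw [this]
                ring
    _ = _ := lintegral_const_mul _ (hf.enorm.pow_const p)

/-- Marcinkiewicz interpolation between weak type `(1,1)` and the `L²` bound. -/
lemma IsCalderonZygmundKernel.lintegral_rpow_conv_le (hn : 1 ≤ n)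
    (hK : IsCalderonZygmundKernel K A) (hA : 0 ≤ A) {p : ℝ} (hp : 1 < p) (hp2 : p < 2)
    {f : EuclideanSpace ℝ (Fin n) → ℂ} (hfm : Measurable f) (hf : Integrable f) :
    ∫⁻ x, ‖conv K f x‖ₑ ^ p ≤
      ENNReal.ofReal (4 ^ p * p * ((4 * A ^ 2 * 5 ^ n + 10 ^ n + 4 * A) / (p - 1) +
        A ^ 2 / (2 - p))) * ∫⁻ x, ‖f x‖ₑ ^ p := by
  obtain ⟨M, hM⟩ := hK.bounded
  have hKm := hK.integrable.aestronglyMeasurable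
  have hp0 : 0 < p := by linarith
  have hp1 : 0 < p - 1 := by linarith
  have h2p : 0 < 2 - p := by linarith
  set c := 4 * A ^ 2 * 5 ^ n + 10 ^ n + 4 * A with hc
  have hc0 : 0 ≤ c := by positivity
  set F := conv K f with hF
  have hFm : AEStronglyMeasurable F := aestronglyMeasurable_conv hKm hf.aestronglyMeasurable
  -- The factor `4` leaves room for the level `2 t` of the weak-type bound and the level `t` of the
  -- bounded part. The exponents `1 * t ^ 1` match `lintegral_setLIntegral_lt_enorm_mul`.
  have hweak : ∀ t : ℝ, 0 < t → volume {x | t < ‖F x‖ / 4} ≤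
      ENNReal.ofReal (c / t) * (∫⁻ x in {x | 1 * t ^ (1 : ℝ) < ‖f x‖}, ‖f x‖ₑ) +
      ENNReal.ofReal (A ^ 2 / t ^ 2) * ∫⁻ x in {x | t < ‖f x‖}ᶜ, ‖f x‖ₑ ^ (2 : ℝ) := by
    intro t ht
    have hS : MeasurableSet {x | t < ‖f x‖} := measurableSet_lt measurable_const hfm.norm
    set f₁ := {x | t < ‖f x‖}.indicator f with hf₁
    set f₀ := {x | t < ‖f x‖}ᶜ.indicator f with hf₀
    have hf₁i : Integrable f₁ := hf.indicator hS
    have hf₀i : Integrable f₀ := hf.indicator hS.compl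
    have hf₀b : ∀ x, ‖f₀ x‖ ≤ t := fun x => by
      simp only [hf₀]
      by_cases hx : t < ‖f x‖
      · simp [hx, ht.le]
      · simp only [Set.indicator, Set.mem_compl_iff, Set.mem_ofPred_eq, hx, not_false_eq_true,
          if_true]
        exact not_lt.1 hx
    have hf₀2 : MemLp f₀ 2 := by
      refine ⟨hf₀i.aestronglyMeasurable, (eLpNorm_le_rpow_mul_rpow (M := ENNReal.ofReal t) le_rfl
        one_le_two (by simp) ENNReal.ofReal_ne_top fun x => ?_).trans_lt ?_⟩
      · rw [← ofReal_norm]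
        exact ENNReal.ofReal_le_ofReal (hf₀b x)
      · exact ENNReal.mul_lt_top
          (ENNReal.rpow_lt_top_of_nonneg (by simp) (memLp_one_iff_integrable.2 hf₀i).2.ne)
          (ENNReal.rpow_lt_top_of_nonneg (by norm_num) ENNReal.ofReal_ne_top)
    have hdec : ∀ x, F x = conv K f₁ x + conv K f₀ x := fun x => by
      simp only [hF, conv_apply]
      rw [← integral_add (integrable_conv_integrand hKm hM hf₁i x)
        (integrable_conv_integrand hKm hM hf₀i x)]
      congr 1
      funext y
      rw [← mul_add]
      congr 1
      exact (congrFun (Set.indicator_self_add_compl {x | t < ‖f x‖} f) (x - y)).symm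
    have hsub : {x | t < ‖F x‖ / 4} ⊆ {x | 2 * t < ‖conv K f₁ x‖} ∪
        {x | ENNReal.ofReal t ≤ ‖conv K f₀ x‖ₑ} := by
      intro x hx
      have hx : t < ‖F x‖ / 4 := hx
      by_contra hcon
      simp only [Set.mem_union, not_or] at hcon
      have h1 : ‖conv K f₁ x‖ ≤ 2 * t := not_lt.1 hcon.1
      have h2 : ‖conv K f₀ x‖ < t := by
        have := not_le.1 (show ¬ ENNReal.ofReal t ≤ ‖conv K f₀ x‖ₑ from hcon.2)
        rw [← ofReal_norm] at this
        exact (ENNReal.ofReal_lt_ofReal_iff ht).1 this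
      have h3 := norm_add_le (conv K f₁ x) (conv K f₀ x)
      rw [← hdec] at h3
      linarith
    refine (measure_mono hsub).trans ((measure_union_le _ _).trans (add_le_add ?_ ?_))
    · refine (hK.volume_lt_conv_le hn hA hf₁i ht).trans ?_
      rw [one_mul, Real.rpow_one, ← lintegral_indicator hS]
      gcongr with x
      simp only [hf₁]
      exact (enorm_indicator_eq_indicator_enorm _ _).le
    · have hcheb := meas_ge_le_mul_pow_eLpNorm_enorm volume (p := 2) (by norm_num) (by simp)
        (aestronglyMeasurable_conv hKm hf₀i.aestronglyMeasurable)
        (ε := ENNReal.ofReal t) (by simpa using ht) (by simp)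
      rw [ENNReal.toReal_ofNat] at hcheb
      have hsq : eLpNorm f₀ 2 volume ^ (2 : ℝ) = ∫⁻ x in {x | t < ‖f x‖}ᶜ, ‖f x‖ₑ ^ (2 : ℝ) := by
        rw [eLpNorm_eq_lintegral_rpow_enorm_toReal (by norm_num) (by simp), ENNReal.toReal_ofNat,
          ← ENNReal.rpow_mul, ← lintegral_indicator hS.compl]
        norm_num
        refine lintegral_congr fun x => ?_
        by_cases hx : t < ‖f x‖ <;> simp [hf₀, hx]
      refine hcheb.trans ?_
      calc _ ≤ (ENNReal.ofReal t)⁻¹ ^ (2 : ℝ) *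
            (ENNReal.ofReal A * eLpNorm f₀ 2 volume) ^ (2 : ℝ) := by
            gcongr
            exact hK.eLpNorm_two_le f₀ hf₀i hf₀2
        _ = _ := by
            rw [ENNReal.mul_rpow_of_nonneg _ _ (by norm_num), hsq, ← mul_assoc]
            congr 1
            rw [← ENNReal.ofReal_inv_of_pos ht,
              ENNReal.ofReal_rpow_of_nonneg (by positivity) (by norm_num),
              ENNReal.ofReal_rpow_of_nonneg hA (by norm_num), ← ENNReal.ofReal_mul (by positivity)]
            congr 1
            rw [Real.rpow_two, Real.rpow_two]
            field_simp
  have hcake := lintegral_rpow_eq_lintegral_meas_lt_mul volume (f := fun x => ‖F x‖ / 4)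
    (Filter.Eventually.of_forall fun x => by positivity) (hFm.norm.aemeasurable.div_const 4) hp0
  have h1 := lintegral_setLIntegral_lt_enorm_mul (μ := volume) hfm hp one_pos one_pos
  have h2 := lintegral_setLIntegral_compl_lt_enorm_sq_mul_le (μ := volume) hfm hp2
  set N := ∫⁻ x, ‖f x‖ₑ ^ p with hN
  set I₁ : ℝ → ℝ≥0∞ := fun t => (∫⁻ x in {x | 1 * t ^ (1 : ℝ) < ‖f x‖}, ‖f x‖ₑ) *
    ENNReal.ofReal (t ^ (1 * (p - 1) - 1)) with hI₁
  set I₂ : ℝ → ℝ≥0∞ := fun t => (∫⁻ x in {x | t < ‖f x‖}ᶜ, ‖f x‖ₑ ^ (2 : ℝ)) *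
    ENNReal.ofReal (t ^ (p - 3)) with hI₂
  have hI₁m : Measurable I₁ := by
    refine Measurable.mul ?_ (by fun_prop)
    have : Antitone fun t : ℝ => ∫⁻ x in {x | 1 * t ^ (1 : ℝ) < ‖f x‖}, ‖f x‖ₑ := by
      intro s t hst
      refine lintegral_mono_set fun x hx => ?_
      simp only [one_mul, Real.rpow_one, Set.mem_ofPred_eq] at hx ⊢
      exact hst.trans_lt hx
    exact this.measurable
  calc ∫⁻ x, ‖F x‖ₑ ^ p = ENNReal.ofReal (4 ^ p) * ∫⁻ x, ENNReal.ofReal ((‖F x‖ / 4) ^ p) := by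
        rw [← lintegral_const_mul' _ _ ENNReal.ofReal_ne_top]
        refine lintegral_congr fun x => ?_
        rw [← ENNReal.ofReal_mul (by positivity), ← Real.mul_rpow (by norm_num) (by positivity),
          mul_div_cancel₀ _ (by norm_num), ← ENNReal.ofReal_rpow_of_nonneg (norm_nonneg _) hp0.le,
          ofReal_norm]
    _ ≤ ENNReal.ofReal (4 ^ p) * (ENNReal.ofReal p * ∫⁻ t in Set.Ioi (0 : ℝ),
          (ENNReal.ofReal c * I₁ t + ENNReal.ofReal (A ^ 2) * I₂ t)) := by
        rw [hcake]
        refine mul_le_mul' le_rfl (mul_le_mul' le_rfl ?_)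
        refine setLIntegral_mono' measurableSet_Ioi fun t (ht : 0 < t) => ?_
        refine (mul_le_mul_left (hweak t ht) _).trans (le_of_eq ?_)
        have e1 : t ^ (1 * (p - 1) - 1) = t ^ (p - 1) / t := by
          rw [one_mul, Real.rpow_sub_one ht.ne']
        have e2 : t ^ (p - 3) = t ^ (p - 1) / t ^ 2 := by
          rw [← Real.rpow_two, ← Real.rpow_sub ht]
          congr 1
          ring
        simp only [hI₁, hI₂]
        rw [e1, e2, add_mul, mul_right_comm, mul_right_comm (ENNReal.ofReal (A ^ 2 / t ^ 2)),
          ← ENNReal.ofReal_mul (by positivity), ← ENNReal.ofReal_mul (by positivity),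
          mul_comm _ (ENNReal.ofReal (t ^ (p - 1) / t)),
          mul_comm _ (ENNReal.ofReal (t ^ (p - 1) / t ^ 2)),
          ← mul_assoc, ← mul_assoc, ← ENNReal.ofReal_mul hc0, ← ENNReal.ofReal_mul (by positivity)]
        congr 3
        · ring
        · ring
    _ ≤ ENNReal.ofReal (4 ^ p) * (ENNReal.ofReal p * (ENNReal.ofReal c *
          (ENNReal.ofReal (1 / (p - 1)) * N) +
          ENNReal.ofReal (A ^ 2) * (ENNReal.ofReal (1 / (2 - p)) * N))) := by
        refine mul_le_mul' le_rfl (mul_le_mul' le_rfl ?_)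
        rw [lintegral_add_left (hI₁m.const_mul _), lintegral_const_mul' _ _ ENNReal.ofReal_ne_top,
          lintegral_const_mul' _ _ ENNReal.ofReal_ne_top, h1, Real.one_rpow, one_mul]
        gcongr
    _ = _ := by
        rw [← mul_assoc (ENNReal.ofReal c), ← mul_assoc (ENNReal.ofReal (A ^ 2)), ← add_mul,
          ← ENNReal.ofReal_mul hc0, ← ENNReal.ofReal_mul (by positivity),
          ← ENNReal.ofReal_add (by positivity) (by positivity), ← mul_assoc, ← mul_assoc,
          ← ENNReal.ofReal_mul (by positivity), ← ENNReal.ofReal_mul (by positivity)]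
        simp only [mul_one_div]

end Marcinkiewicz

section Duality

variable {n : ℕ} {K : EuclideanSpace ℝ (Fin n) → ℂ} {A : ℝ}

/-- The class of Calderón–Zygmund kernels is invariant under reflection, that is, under passing to
the transposed operator. -/
lemma IsCalderonZygmundKernel.comp_neg (hK : IsCalderonZygmundKernel K A) :
    IsCalderonZygmundKernel (fun x => K (-x)) A where
  continuous := hK.continuous.comp continuous_neg
  integrable := hK.integrable.comp_neg
  bounded := hK.bounded.imp fun _ h x => h (-x)
  eLpNorm_two_le f hf hf2 := by
    have hmp : MeasurePreserving (fun x : EuclideanSpace ℝ (Fin n) => -x) volume volume :=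
      Measure.measurePreserving_neg volume
    have e : conv (fun x => K (-x)) f = fun x => conv K (fun y => f (-y)) (-x) := by
      funext x
      simp only [conv_apply]
      rw [← integral_neg_eq_self]
      congr 1
      funext y
      rw [neg_neg]
      congr 2
      abel
    have hm : AEStronglyMeasurable (conv K fun y => f (-y)) := aestronglyMeasurable_conv
      hK.integrable.aestronglyMeasurable hf.comp_neg.aestronglyMeasurable
    have h1 := hK.eLpNorm_two_le (fun y => f (-y)) hf.comp_neg (hf2.comp_measurePreserving hmp)
    have h2 := eLpNorm_comp_measurePreserving (p := 2) hm hmp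
    have h3 := eLpNorm_comp_measurePreserving (p := 2) hf.aestronglyMeasurable hmp
    simp only [Function.comp_def] at h2 h3
    rw [e, h2, ← h3]
    exact h1
  hormander y := by
    have h1 := hK.hormander (-y)
    rw [norm_neg] at h1
    have hS : MeasurableSet {x : EuclideanSpace ℝ (Fin n) | 2 * ‖y‖ ≤ ‖x‖} :=
      measurableSet_le measurable_const measurable_norm
    rw [← lintegral_indicator hS] at h1 ⊢
    rw [← lintegral_neg_eq_self] at h1
    refine le_trans (le_of_eq (lintegral_congr fun x => ?_)) h1
    simp only [Set.indicator, Set.mem_ofPred_eq, norm_neg]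
    congr 4
    abel

/-- The transpose of convolution with `K` is convolution with the reflected kernel. -/
lemma IsCalderonZygmundKernel.integral_conv_mul (hK : IsCalderonZygmundKernel K A)
    {f g : EuclideanSpace ℝ (Fin n) → ℂ} (hf : Integrable f) (hg : Integrable g) :
    ∫ x, conv K f x * g x = ∫ y, f y * conv (fun x => K (-x)) g y := by
  obtain ⟨M, hM⟩ := hK.bounded
  have hKc := hK.continuous
  have hi : Integrable (fun z : EuclideanSpace ℝ (Fin n) × EuclideanSpace ℝ (Fin n) =>
      K (z.1 - z.2) * (g z.1 * f z.2)) (volume.prod volume) :=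
    (hg.mul_prod hf).bdd_mul (c := M) (by fun_prop) (Filter.Eventually.of_forall fun z => hM _)
  calc _ = ∫ x, ∫ y, K (x - y) * (g x * f y) := by
        congr 1
        funext x
        rw [conv_apply_swap, ← integral_mul_const]
        congr 1
        funext y
        ring
    _ = ∫ y, ∫ x, K (x - y) * (g x * f y) := integral_integral_swap hi
    _ = _ := by
        congr 1
        funext y
        rw [conv_apply_swap, ← integral_const_mul]
        congr 1
        funext x
        rw [neg_sub]
        ring

/-- The `L^p` bound for `p > 2`, by duality with the exponent `p / (p - 1) < 2`. -/
lemma IsCalderonZygmundKernel.lintegral_rpow_conv_le_of_two_lt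
    (hK : IsCalderonZygmundKernel K A) {p C : ℝ} (hp : 2 < p)
    (hC : ∀ g : EuclideanSpace ℝ (Fin n) → ℂ, Measurable g → Integrable g →
      ∫⁻ x, ‖conv (fun x => K (-x)) g x‖ₑ ^ (p / (p - 1)) ≤
        ENNReal.ofReal C * ∫⁻ x, ‖g x‖ₑ ^ (p / (p - 1)))
    (f : 𝓢(EuclideanSpace ℝ (Fin n), ℂ)) :
    (∫⁻ x, ‖conv K f x‖ₑ ^ p) ^ (1 / p) ≤
      ENNReal.ofReal C ^ ((p - 1) / p) * (∫⁻ x, ‖f x‖ₑ ^ p) ^ (1 / p) := by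
  have hp0 : 0 < p := by linarith
  have hp1 : 0 < p - 1 := by linarith
  have hKm := hK.integrable.aestronglyMeasurable
  set F := conv K f with hF
  have hFc : Continuous F := by
    refine BddAbove.continuous_convolution_right_of_integrable _ ⟨SchwartzMap.seminorm ℝ 0 0 f, ?_⟩
      hK.integrable f.continuous
    rintro _ ⟨x, rfl⟩
    exact f.norm_le_seminorm ℝ x
  have hFfin : ∀ s : ℝ, 1 ≤ s → ∫⁻ x, ‖F x‖ₑ ^ s ≠ ∞ := fun s hs => by
    have hs0 : 0 < s := by linarith
    have hs' : (1 : ℝ≥0∞) ≤ ENNReal.ofReal s := by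
      rw [← ENNReal.ofReal_one]; exact ENNReal.ofReal_le_ofReal hs
    have h1 : eLpNorm F (ENNReal.ofReal s) volume ≠ ∞ := by
      refine ne_top_of_le_ne_top ?_ (eLpNorm_conv_le hKm f.integrable.aestronglyMeasurable hs')
      exact ENNReal.mul_ne_top hK.integrable.2.ne (f.memLp _ volume).eLpNorm_ne_top
    rw [eLpNorm_eq_lintegral_rpow_enorm_toReal (by simpa using hs0) ENNReal.ofReal_ne_top,
      ENNReal.toReal_ofReal hs0.le] at h1
    intro h
    rw [h, ENNReal.top_rpow_of_pos (by positivity)] at h1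
    exact h1 rfl
  -- The extremal function for the duality pairing: `F * g = ‖F‖ ^ p` and `‖g‖ = ‖F‖ ^ (p - 1)`.
  set g : EuclideanSpace ℝ (Fin n) → ℂ :=
    fun x => ((‖F x‖ ^ (p - 2) : ℝ) : ℂ) * (starRingEnd ℂ) (F x) with hg
  have hgc : Continuous g := by
    refine (Complex.continuous_ofReal.comp (hFc.norm.rpow_const fun x => Or.inr ?_)).mul
      (Complex.continuous_conj.comp hFc)
    linarith
  have hgn : ∀ x, ‖g x‖ₑ = ‖F x‖ₑ ^ (p - 1) := fun x => by
    have h1 : ‖g x‖ = ‖F x‖ ^ (p - 1) := by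
      simp only [hg, norm_mul, Complex.norm_real, RCLike.norm_conj, Real.norm_eq_abs]
      rw [abs_of_nonneg (by positivity)]
      nth_rw 2 [← Real.rpow_one ‖F x‖]
      rw [← Real.rpow_add_of_nonneg (norm_nonneg _) (by linarith) zero_le_one]
      congr 1
      ring
    rw [← ofReal_norm, h1, ← ENNReal.ofReal_rpow_of_nonneg (norm_nonneg _) hp1.le, ofReal_norm]
  have hgi : Integrable g := by
    refine ⟨hgc.aestronglyMeasurable, ?_⟩
    change ∫⁻ x, ‖g x‖ₑ < ∞
    simp only [hgn]
    exact (hFfin (p - 1) (by linarith)).lt_top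
  have hgF : ∀ x, F x * g x = ((‖F x‖ ^ p : ℝ) : ℂ) := fun x => by
    simp only [hg]
    rw [mul_left_comm, Complex.mul_conj, Complex.normSq_eq_norm_sq, ← Complex.ofReal_mul]
    congr 1
    rw [← Real.rpow_two, ← Real.rpow_add_of_nonneg (norm_nonneg _) (by linarith) (by norm_num)]
    congr 1
    ring
  set X := ∫⁻ x, ‖F x‖ₑ ^ p with hX
  have hXt : X ≠ ∞ := hFfin p (by linarith)
  have hnn : ∀ x, 0 ≤ ‖F x‖ ^ p := fun x => by positivity
  have hX1 : X = ‖∫ x, F x * g x‖ₑ := by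
    have hXr : X = ∫⁻ x, ENNReal.ofReal (‖F x‖ ^ p) := lintegral_congr fun x => by
      rw [← ENNReal.ofReal_rpow_of_nonneg (norm_nonneg _) hp0.le, ofReal_norm]
    simp only [hgF]
    rw [integral_complex_ofReal, ← ofReal_norm, Complex.norm_real, Real.norm_eq_abs,
      abs_of_nonneg (integral_nonneg hnn), integral_eq_lintegral_of_nonneg_ae
        (Filter.Eventually.of_forall hnn) (by
          exact (hFc.norm.rpow_const fun x => Or.inr hp0.le).aestronglyMeasurable), ← hXr,
      ENNReal.ofReal_toReal hXt]
  have hconj : p.HolderConjugate (p / (p - 1)) := Real.HolderConjugate.conjExponent (by linarith)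
  have hKgm : AEStronglyMeasurable (conv (fun x => K (-x)) g) := aestronglyMeasurable_conv
    hK.comp_neg.integrable.aestronglyMeasurable hgi.aestronglyMeasurable
  have hgX : ∫⁻ x, ‖g x‖ₑ ^ (p / (p - 1)) = X := lintegral_congr fun x => by
    rw [hgn, ← ENNReal.rpow_mul, mul_div_cancel₀ _ hp1.ne']
  have hmain : X ≤ (∫⁻ x, ‖f x‖ₑ ^ p) ^ (1 / p) * (ENNReal.ofReal C ^ ((p - 1) / p) *
      X ^ ((p - 1) / p)) := by
    calc X = ‖∫ y, f y * conv (fun x => K (-x)) g y‖ₑ := by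
          rw [hX1, hK.integral_conv_mul f.integrable hgi]
      _ ≤ ∫⁻ y, ‖f y‖ₑ * ‖conv (fun x => K (-x)) g y‖ₑ := by
          refine (enorm_integral_le_lintegral_enorm _).trans (le_of_eq ?_)
          simp only [enorm_mul]
      _ ≤ (∫⁻ x, ‖f x‖ₑ ^ p) ^ (1 / p) *
          (∫⁻ x, ‖conv (fun x => K (-x)) g x‖ₑ ^ (p / (p - 1))) ^ (1 / (p / (p - 1))) :=
          ENNReal.lintegral_mul_le_Lp_mul_Lq volume hconj
            f.integrable.aestronglyMeasurable.enorm hKgm.enorm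
      _ ≤ (∫⁻ x, ‖f x‖ₑ ^ p) ^ (1 / p) * (ENNReal.ofReal C * X) ^ ((p - 1) / p) := by
          rw [one_div_div]
          gcongr
          have := hC g hgc.measurable hgi
          rwa [hgX] at this
      _ = _ := by rw [ENNReal.mul_rpow_of_nonneg _ _ (by positivity)]
  -- Division by `X ^ ((p - 1) / p)`, which is finite because `f` is a Schwartz function and `K` is
  -- integrable.
  rcases eq_or_ne X 0 with h0 | h0
  · rw [h0, ENNReal.zero_rpow_of_pos (by positivity)]
    exact zero_le
  · have hY0 : X ^ ((p - 1) / p) ≠ 0 := by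
      simpa [ENNReal.rpow_eq_zero_iff, h0] using fun h => absurd h hXt
    have hYt : X ^ ((p - 1) / p) ≠ ∞ := ENNReal.rpow_ne_top_of_nonneg (by positivity) hXt
    refine (ENNReal.mul_le_mul_iff_left hY0 hYt).1 ?_
    rw [← ENNReal.rpow_add _ _ h0 hXt]
    have e : 1 / p + (p - 1) / p = 1 := by field_simp; ring
    rw [e, ENNReal.rpow_one]
    refine hmain.trans (le_of_eq ?_)
    ring

end Duality

/-! ### Proof of the estimates -/

section Mikhlin

variable {n : ℕ} {a χ : EuclideanSpace ℝ (Fin n) → ℝ} {θ₀ a₁ C₀ δ : ℝ}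

/-- Calderón–Zygmund operators are bounded on `L^p` for `1 < p < ∞`, with a bound that depends on
the kernel only through `A`. -/
lemma IsCalderonZygmundKernel.exists_eLpNorm_conv_le (hn : 1 ≤ n) {A : ℝ} (hA : 0 ≤ A)
    {p : ℝ≥0∞} (hp : 1 < p) (hp' : p ≠ ∞) :
    ∃ C : ℝ, 0 < C ∧ ∀ K : EuclideanSpace ℝ (Fin n) → ℂ, IsCalderonZygmundKernel K A →
      ∀ f : 𝓢(EuclideanSpace ℝ (Fin n), ℂ),
        eLpNorm (conv K f) p ≤ ENNReal.ofReal C * eLpNorm f p volume := by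
  have hp0 : p ≠ 0 := (zero_lt_one.trans hp).ne'
  have hr : 1 < p.toReal := by
    rw [← ENNReal.toReal_one]
    exact (ENNReal.toReal_lt_toReal ENNReal.one_ne_top hp').2 hp
  simp only [eLpNorm_eq_lintegral_rpow_enorm_toReal hp0 hp']
  set r := p.toReal with hrdef
  have hr0 : 0 < r := by linarith
  rcases lt_trichotomy r 2 with h | h | h
  · set c := 4 ^ r * r * ((4 * A ^ 2 * 5 ^ n + 10 ^ n + 4 * A) / (r - 1) + A ^ 2 / (2 - r)) with hc
    have hc0 : 0 ≤ c := by
      have h1 : 0 < r - 1 := by linarith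
      have h2 : 0 < 2 - r := by linarith
      positivity
    refine ⟨c ^ (1 / r) + 1, by positivity, fun K hK f => ?_⟩
    calc _ ≤ (ENNReal.ofReal c * ∫⁻ x, ‖f x‖ₑ ^ r) ^ (1 / r) := by
          gcongr
          exact hK.lintegral_rpow_conv_le hn hA hr h f.continuous.measurable f.integrable
      _ ≤ _ := by
          rw [ENNReal.mul_rpow_of_nonneg _ _ (by positivity),
            ENNReal.ofReal_rpow_of_nonneg hc0 (by positivity)]
          gcongr
          linarith
  · refine ⟨A + 1, by positivity, fun K hK f => ?_⟩
    have h2 := hK.eLpNorm_two_le f f.integrable (f.memLp 2 volume)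
    rw [eLpNorm_eq_lintegral_rpow_enorm_toReal (by norm_num) (by simp),
      eLpNorm_eq_lintegral_rpow_enorm_toReal (by norm_num) (by simp), ENNReal.toReal_ofNat] at h2
    rw [h]
    refine h2.trans ?_
    gcongr
    linarith
  · set s := r / (r - 1) with hs
    have h1 : 0 < r - 1 := by linarith
    have hs1 : 1 < s := by rw [hs, lt_div_iff₀ h1]; linarith
    have hs2 : s < 2 := by rw [hs, div_lt_iff₀ h1]; linarith
    set c := 4 ^ s * s * ((4 * A ^ 2 * 5 ^ n + 10 ^ n + 4 * A) / (s - 1) + A ^ 2 / (2 - s)) with hc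
    have hc0 : 0 ≤ c := by
      have h1 : 0 < s - 1 := by linarith
      have h2 : 0 < 2 - s := by linarith
      positivity
    refine ⟨c ^ ((r - 1) / r) + 1, by positivity, fun K hK f => ?_⟩
    refine (hK.lintegral_rpow_conv_le_of_two_lt h (fun g hgm hg =>
      hK.comp_neg.lintegral_rpow_conv_le hn hA hs1 hs2 hgm hg) f).trans ?_
    rw [ENNReal.ofReal_rpow_of_nonneg hc0 (by positivity)]
    gcongr
    linarith

/-- For a classical (`θ₀ = 0`) damping the multipliers satisfy Mikhlin's condition uniformly
in time. -/
lemma convolutorNorm_self_le (hn : 1 ≤ n) (ha : IsOverdampedSymbol n a 0 a₁ C₀ δ)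
    (hχ : IsCutoff χ) {p : ℝ≥0∞} (hp : 1 < p) (hp' : p ≠ ∞) :
    ∃ C : ℝ, 0 < C ∧ ∀ t : ℝ, 0 ≤ t →
      convolutorNorm p p (lowFrequencyKernel a χ δ t) ≤ ENNReal.ofReal C := by
  have hδ := ha.δ_pos
  obtain ⟨C₁, c, hC₁, hc, hsym⟩ := exists_isSymbolAt_annulus ha hχ le_rfl one_pos
  obtain ⟨C₂, hC₂, hker⟩ := exists_isCalderonZygmundKernel_sum hχ hδ
  obtain ⟨C, hC, hLp⟩ := IsCalderonZygmundKernel.exists_eLpNorm_conv_le hn (A := C₂ * C₁)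
    (by positivity) hp hp'
  refine ⟨C, hC, fun t ht => convolutorNorm_le fun f hf => ?_⟩
  have hm := integrable_lowFrequencySymbol hn ha hχ ht
  refine eLpNorm_conv_inverseFourier_le hn hχ hδ hm
    (lowFrequencySymbol_eq_zero hχ hδ t) f.integrable fun N => ?_
  refine (hLp _ (hker _ C₁ hC₁ hm (fun R hR hRle ξ h1 h2 =>
    (hsym t ht R hR hRle ξ h1 h2).mono ?_) N) f).trans ?_
  · refine mul_le_of_le_one_right hC₁ (mul_le_one₀ ?_ (by positivity) ?_)
    · exact (min_le_right _ _).trans (by simp)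
    · exact Real.exp_le_one_iff.2 (neg_nonpos.2 (by positivity))
  · rw [hf, mul_one]

end Mikhlin

theorem theorem2p4 (n : ℕ) (hn : 1 ≤ n) (θ₀ a₁ C₀ δ : ℝ) (hθ₀ : 0 ≤ θ₀) (hθ₁ : θ₀ < 1)
    (a : EuclideanSpace ℝ (Fin n) → ℝ) (ha : IsOverdampedSymbol n a θ₀ a₁ C₀ δ)
    (χ : EuclideanSpace ℝ (Fin n) → ℝ) (hχ : IsCutoff χ)
    (p q : ℝ≥0∞) (hp : 1 ≤ p) (hpq : p ≤ q) :
    (0 < θ₀ →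
      (¬ ((p = 1 ∧ scalingGap n 1 q = θ₀) ∨ (q = ∞ ∧ scalingGap n p ∞ = θ₀)) →
        (θ₀ ≤ scalingGap n p q → ∃ C : ℝ, 0 < C ∧ ∀ t : ℝ, 0 ≤ t →
          convolutorNorm p q (lowFrequencyKernel a χ δ t) ≤
            ENNReal.ofReal (C * (1 + t) ^ (-(1 / (2 - θ₀)) * (scalingGap n p q - θ₀)))) ∧
        (scalingGap n p q < θ₀ → ∃ C : ℝ, 0 < C ∧ ∀ t : ℝ, 0 ≤ t →
          convolutorNorm p q (lowFrequencyKernel a χ δ t) ≤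
            ENNReal.ofReal (C * (1 + t) ^ (1 - scalingGap n p q / θ₀)))) ∧
      ((p = 1 ∧ scalingGap n 1 q = θ₀) ∨ (q = ∞ ∧ scalingGap n p ∞ = θ₀) →
        ∃ C : ℝ, 0 < C ∧ ∀ t : ℝ, 0 ≤ t →
          convolutorNorm p q (lowFrequencyKernel a χ δ t) ≤
            ENNReal.ofReal (C * Real.log (Real.exp 1 + t)))) ∧
    (θ₀ = 0 → ¬ (p = 1 ∧ q = 1) → ¬ (p = ∞ ∧ q = ∞) →
      ∃ C : ℝ, 0 < C ∧ ∀ t : ℝ, 0 ≤ t →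
        convolutorNorm p q (lowFrequencyKernel a χ δ t) ≤
          ENNReal.ofReal (C * (1 + t) ^ (-(1 / 2) * scalingGap n p q))) := by
  refine ⟨fun h0 => ⟨fun hne => ⟨fun hG => ?_, fun hG => ?_⟩, fun he => ?_⟩, fun h0 h1 h2 => ?_⟩
  · rcases hG.eq_or_lt with hG | hG
    · have hp1 : p ≠ 1 := fun h => hne (Or.inl ⟨h, by rw [← h]; exact hG.symm⟩)
      have hq : q ≠ ∞ := fun h => hne (Or.inr ⟨h, by rw [← h]; exact hG.symm⟩)
      obtain ⟨C, hC, h⟩ := convolutorNorm_le_of_scalingGap_eq hn h0 hθ₁ ha hχ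
        (lt_of_le_of_ne hp hp1.symm) hpq hq hG.symm
      refine ⟨C, hC, fun t ht => (h t ht).trans_eq ?_⟩
      rw [← hG, sub_self, mul_zero, Real.rpow_zero, mul_one]
    · exact convolutorNorm_le_of_lt_scalingGap hn hθ₀ hθ₁ ha hχ hp hpq hG
  · exact convolutorNorm_le_of_scalingGap_lt hn h0 hθ₁ ha hχ hp hpq hG
  · refine convolutorNorm_le_log hn h0 hθ₁ ha hχ hp hpq ?_
    rcases he with ⟨rfl, h⟩ | ⟨rfl, h⟩ <;> exact h
  · subst h0
    rcases hpq.eq_or_lt with rfl | hlt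
    · have hp1 : 1 < p := lt_of_le_of_ne hp fun h => h1 ⟨h.symm, h.symm⟩
      obtain ⟨C, hC, h⟩ := convolutorNorm_self_le hn ha hχ hp1 fun h => h2 ⟨h, h⟩
      refine ⟨C, hC, fun t ht => (h t ht).trans_eq ?_⟩
      simp [scalingGap]
    · have hG : 0 < scalingGap n p q := by
        have hp0 : p ≠ 0 := (zero_lt_one.trans_le hp).ne'
        have h1 : (q⁻¹).toReal < (p⁻¹).toReal :=
          ENNReal.toReal_strict_mono (ENNReal.inv_ne_top.2 hp0) (ENNReal.inv_lt_inv.2 hlt)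
        have hn0 : (0 : ℝ) < n := by exact_mod_cast hn
        exact mul_pos hn0 (sub_pos.2 h1)
      have := convolutorNorm_le_of_lt_scalingGap hn hθ₀ hθ₁ ha hχ hp hpq hG
      simpa only [sub_zero] using this
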